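/- Let $V$ be an $n$-dimensional vector space over the finite field $\mathbb F_q$. Write ${V\brack k}$ for the set of all $k$-dimensional subspaces of $V$ and ${a\brack b}=\prod_{0\le i<b}\frac{q^{a-i}-1}{q^{b-i}-1}$ (with ${a\brack 0}=1$) for the Gaussian binomial coefficient. Families $\mathcal F_1\subseteq{V\brack k_1}$ and $\mathcal F_2\subseteq{V\brack k_2}$ are *cross $t$-intersecting* if $\dim(F_1\cap F_2)\ge t$ for all $F_1\in\mathcal F_1$, $F_2\in\mathcal F_2$, and *non-trivial* if moreover $\dim\bigl(\bigcap_{F\in\mathcal F_1\cup\mathcal F_2}F\bigr)<t$. For subspaces $X\subseteq M$ and $T$ of $V$ put $$\mathcal A(k,s,X,M)=\Bigl\{F\in{V\brack k}: X\subseteq F,\ \dim(F\cap M)\ge s\Bigr\},\qquad \mathcal B(\ell,X,M)=\Bigl\{F\in{V\brack \ell}: X\subseteq F\Bigr\}\cup{M\brack \ell},$$ $$\mathcal C(k,T)=\Bigl\{F\in{V\brack k}: T\subseteq F\Bigr\},\qquad \mathcal D(\ell,s,T)=\Bigl\{F\in{V\brack \ell}: \dim(F\cap T)\ge s\Bigr\}.$$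 **Theorem.** Let $n,k_1,k_2,t$ be positive integers with $k_1\ge k_2\ge t+1$, $n\ge k_1+k_2+t+3$ and $(k_1,k_2,t)\notin\{(2,2,1),(3,2,1),(4,2,1)\}$. (i) If $k_2\ge 2t+1$, then the maximum of $|\mathcal F_1||\mathcal F_2|$ over all non-trivial cross $t$-intersecting families $\mathcal F_1\subseteq{V\brack k_1}$, $\mathcal F_2\subseteq{V\brack k_2}$ is $$\left({n-t\brack k_1-t}-q^{(k_2+1-t)(k_1-t)}{n-k_2-1\brack k_1-t}\right)\left({n-t\brack k_2-t}+q^{k_2+1-t}{t\brack 1}\right).$$ The pairs attaining it are exactly those for which there are a $t$-dimensional subspace $X$ and a $(k_2+1)$-dimensional subspace $M$ of $V$ with $X\subseteq M$ such that either (ia) $\mathcal F_1=\mathcal A(k_1,t+1,X,M)$ and $\mathcal F_2=\mathcal B(k_2,X,M)$, or (ib) $k_1=k_2$, $\mathcal F_1=\mathcal B(k_1,X,M)$ and $\mathcal F_2=\mathcal A(k_2,t+1,X,M)$. (ii) If $t+1\le k_2\le 2t$, then the maximum of $|\mathcal F_1||\mathcal F_2|$ over all non-trivial cross $t$-intersecting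 families $\mathcal F_1\subseteq{V\brack k_1}$, $\mathcal F_2\subseteq{V\brack k_2}$ is $${n-t-1\brack k_1-t-1}\left(q^{k_2-t}{t+1\brack 1}{n-t-1\brack k_2-t}+{n-t-1\brack k_2-t-1}\right).$$ The pairs attaining it are exactly those for which there is a $(t+1)$-dimensional subspace $T$ of $V$ such that either (iia) $\mathcal F_1=\mathcal C(k_1,T)$ and $\mathcal F_2=\mathcal D(k_2,t,T)$, or (iib) $k_1=k_2$, $\mathcal F_1=\mathcal D(k_1,t,T)$ and $\mathcal F_2=\mathcal C(k_2,T)$. -/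

import Mathlib

open Module

/-- The Gaussian binomial coefficient `[a choose b]_q`, i.e. the product over `0 ≤ i < b` of
`(q ^ (a - i) - 1) / (q ^ (b - i) - 1)`. It is `1` for `b = 0`. For `a < b` it is `0`, since the
factor with `i = a` vanishes (so the truncated subtraction `a - i` is harmless). -/
def gaussBinom (q a b : ℕ) : ℚ :=
  ∏ i ∈ Finset.range b, ((q : ℚ) ^ (a - i) - 1) / ((q : ℚ) ^ (b - i) - 1)

section Families

variable {K V : Type*} [Field K] [AddCommGroup V] [Module K V]

/-- `F₁` and `F₂` are non-trivial cross `t`-intersecting families of `k₁`-dimensional and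
`k₂`-dimensional subspaces of `V`, respectively. -/
structure IsNontrivialCross (k₁ k₂ t : ℕ) (F₁ F₂ : Set (Submodule K V)) : Prop where
  dim_left : ∀ A ∈ F₁, finrank K A = k₁
  dim_right : ∀ B ∈ F₂, finrank K B = k₂
  cross : ∀ A ∈ F₁, ∀ B ∈ F₂, t ≤ finrank K (A ⊓ B : Submodule K V)
  nontrivial : finrank K (sInf (F₁ ∪ F₂) : Submodule K V) < t

/-- The `k`-subspaces that contain `X` and meet `M` in dimension at least `s`. -/
def famA (k s : ℕ) (X M : Submodule K V) : Set (Submodule K V) :=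
  {F | finrank K F = k ∧ X ≤ F ∧ s ≤ finrank K (F ⊓ M : Submodule K V)}

/-- The `l`-subspaces that contain `X`, together with all the `l`-subspaces of `M`. -/
def famB (l : ℕ) (X M : Submodule K V) : Set (Submodule K V) :=
  {F | finrank K F = l ∧ X ≤ F} ∪ {F | finrank K F = l ∧ F ≤ M}

/-- The `k`-subspaces that contain `T`. -/
def famC (k : ℕ) (T : Submodule K V) : Set (Submodule K V) :=
  {F | finrank K F = k ∧ T ≤ F}

/-- The `l`-subspaces that meet `T` in dimension at least `s`. -/
def famD (l s : ℕ) (T : Submodule K V) : Set (Submodule K V) :=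
  {F | finrank K F = l ∧ s ≤ finrank K (F ⊓ T : Submodule K V)}

end Families

/-- The bound in the case `k₂ ≥ 2 t + 1`. -/
def boundAB (q n k₁ k₂ t : ℕ) : ℚ :=
  (gaussBinom q (n - t) (k₁ - t)
      - (q : ℚ) ^ ((k₂ + 1 - t) * (k₁ - t)) * gaussBinom q (n - k₂ - 1) (k₁ - t))
    * (gaussBinom q (n - t) (k₂ - t) + (q : ℚ) ^ (k₂ + 1 - t) * gaussBinom q t 1)

/-- The bound in the case `t + 1 ≤ k₂ ≤ 2 t`. -/
def boundCD (q n k₁ k₂ t : ℕ) : ℚ :=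
  gaussBinom q (n - t - 1) (k₁ - t - 1)
    * ((q : ℚ) ^ (k₂ - t) * gaussBinom q (t + 1) 1 * gaussBinom q (n - t - 1) (k₂ - t)
      + gaussBinom q (n - t - 1) (k₂ - t - 1))

/-! ### Identities and bounds for Gaussian binomials -/

section GaussBinom

/-! Write θ_a for `gaussBinom q a 1`, the number of points of an a-space, and e(l, s) for `extCount
q n l s`. Everything rests on the ratio e(l, s+1)/e(l, s) ≤ q^(-(n-l)): since n ≥ k₁ + k₂ + t + 3,
forcing one more dimension into the members of one family gains far more than is lost by having
θ_(k-t+1) ways to do it, k being the dimension in the other family. The net factor is `decay` =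
1/((q-1) q^(2t+2)) (`gaussBinom_mul_extCount_succ_le`).

Call T a cover of a family if it meets every member in dimension at least t; each member of one
family covers the other. If S is not a cover of F, some A in F meets S in dimension below t, and
every member of the other family through S contains one of θ_(k-t+1) spaces of dimension one more
than S (`exists_enlargement`, `ncard_ge_le_mul`). Branching until the least dimension of a cover
bounds each family, and the product of the bounds splits into one `coverWeight` per least cover
dimension, nonincreasing in that dimension (`ncard_mul_ncard_le_coverWeight`).

A non-trivial pair is first enlarged to a closed one, in which each family consists of all subspaces
crossing the other. If neither family has a common t-space, both cover dimensions are at least t+1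
and the product is small. Otherwise let X be a t-space common to one family, F. The other, G,
contains every l-space through X, and by non-triviality some B not containing X. If G has no
(t+1)-dimensional cover, the cover bound with dimensions t and t+2 is small. If it has one, all such
covers contain X, and their sum M lies in X + B for each such B, so t+1 ≤ dim M ≤ l+1. Dimension l+1
forces the pair into the A, B shape; dimension t+1 forces the C, D shape or a small product;
intermediate dimensions give small products (`hilton_milner_structure`).

Small means less than `margin` times `leadingTerm` = max(θ_(k₂-t+1), θ_(t+1)) e(k₁, t+1) e(k₂, t),
while the claimed maximum is at least that (`margin_mul_leadingTerm_le`). It remains to compare the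
extremal products: A, B against C, D, where the maximum above switches at k₂ = 2t and second-order
terms decide the tie, and each shape against its version with the roles of the families exchanged.
-/

@[simp] theorem gaussBinom_zero_right (q a : ℕ) : gaussBinom q a 0 = 1 := by simp [gaussBinom]

theorem gaussBinom_succ_succ (q a b : ℕ) :
    gaussBinom q (a + 1) (b + 1)
      = gaussBinom q a b * (((q : ℚ) ^ (a + 1) - 1) / ((q : ℚ) ^ (b + 1) - 1)) := by
  rw [gaussBinom, Finset.prod_range_succ']
  simp only [Nat.add_sub_add_right, Nat.sub_zero, gaussBinom]

@[simp] theorem gaussBinom_zero_succ (q b : ℕ) : gaussBinom q 0 (b + 1) = 0 := by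
  simp [gaussBinom]

theorem gaussBinom_one_right (q a : ℕ) : gaussBinom q a 1 = ((q : ℚ) ^ a - 1) / (q - 1) := by
  simp [gaussBinom]

theorem gaussBinom_eq_zero (q : ℕ) {a b : ℕ} (h : a < b) : gaussBinom q a b = 0 := by
  induction a generalizing b with
  | zero => obtain ⟨b, rfl⟩ := Nat.exists_eq_succ_of_ne_zero h.ne'; exact gaussBinom_zero_succ q b
  | succ a ih =>
    obtain ⟨b, rfl⟩ := Nat.exists_eq_succ_of_ne_zero (Nat.ne_zero_of_lt h)
    rw [gaussBinom_succ_succ, ih (by omega), zero_mul]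

variable {q : ℕ} (hq : 2 ≤ q)
include hq

theorem one_lt_cast_of_two_le : (1 : ℚ) < q := by exact_mod_cast hq

theorem two_le_cast_of_two_le : (2 : ℚ) ≤ q := by exact_mod_cast hq

theorem pow_succ_sub_one_pos (a : ℕ) : (0 : ℚ) < (q : ℚ) ^ (a + 1) - 1 := by
  have := one_lt_pow₀ (one_lt_cast_of_two_le hq) (Nat.succ_ne_zero a)
  simpa using this

theorem gaussBinom_succ_mul (a b : ℕ) :
    gaussBinom q (a + 1) (b + 1) * ((q : ℚ) ^ (b + 1) - 1)
      = gaussBinom q a b * ((q : ℚ) ^ (a + 1) - 1) := by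
  have := (pow_succ_sub_one_pos hq b).ne'
  rw [gaussBinom_succ_succ]
  field_simp

theorem gaussBinom_one_mul (a : ℕ) : gaussBinom q a 1 * ((q : ℚ) - 1) = (q : ℚ) ^ a - 1 := by
  have := one_lt_cast_of_two_le hq
  rw [gaussBinom_one_right, div_mul_cancel₀]
  linarith

theorem gaussBinom_self (a : ℕ) : gaussBinom q a a = 1 := by
  induction a with
  | zero => simp
  | succ a ih =>
    rw [gaussBinom_succ_succ, ih, one_mul, div_self (pow_succ_sub_one_pos hq a).ne']

/-- The recursion in the lower index, written without a - b: both sides vanish for a ≤ b, so no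
hypothesis is needed. -/
theorem gaussBinom_mul_succ (a b : ℕ) :
    (q : ℚ) ^ b * ((q : ℚ) ^ (b + 1) - 1) * gaussBinom q a (b + 1)
      = ((q : ℚ) ^ a - (q : ℚ) ^ b) * gaussBinom q a b := by
  induction a generalizing b with
  | zero => cases b <;> simp
  | succ a ih =>
    cases b with
    | zero => simpa [mul_comm] using gaussBinom_one_mul hq (a + 1)
    | succ b =>
      refine mul_left_cancel₀ (pow_succ_sub_one_pos hq b).ne' ?_
      have h1 := gaussBinom_succ_mul hq a (b + 1)
      have h2 := gaussBinom_succ_mul hq a b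
      have h3 := ih b
      linear_combination ((q : ℚ) ^ (b + 1) - 1) * (q : ℚ) ^ (b + 1) * h1
        - ((q : ℚ) ^ (a + 1) - (q : ℚ) ^ (b + 1)) * h2 + q * ((q : ℚ) ^ (a + 1) - 1) * h3

theorem gaussBinom_pascal (a b : ℕ) :
    gaussBinom q (a + 1) (b + 1)
      = (q : ℚ) ^ (b + 1) * gaussBinom q a (b + 1) + gaussBinom q a b := by
  refine mul_right_cancel₀ (pow_succ_sub_one_pos hq b).ne' ?_
  linear_combination gaussBinom_succ_mul hq a b - q * gaussBinom_mul_succ hq a b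

theorem gaussBinom_nonneg (a b : ℕ) : 0 ≤ gaussBinom q a b := by
  induction a generalizing b with
  | zero => cases b <;> simp
  | succ a ih =>
    cases b with
    | zero => simp
    | succ b =>
      rw [gaussBinom_pascal hq]
      have := ih b
      have := ih (b + 1)
      positivity

/-- Each factor (q^(b+c+1) - 1)/(q^(b+1) - 1) of the product is at least q^c. -/
theorem gaussBinom_pow_le (b c : ℕ) : (q : ℚ) ^ (b * c) ≤ gaussBinom q (b + c) b := by
  induction b with
  | zero => simp
  | succ b ih =>
    have hp := pow_succ_sub_one_pos hq b
    have hq' := one_lt_cast_of_two_le hq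
    refine le_of_mul_le_mul_right ?_ hp
    rw [show b + 1 + c = b + c + 1 by ring, gaussBinom_succ_mul hq]
    have h1 : (q : ℚ) ^ c * ((q : ℚ) ^ (b + 1) - 1) ≤ (q : ℚ) ^ (b + c + 1) - 1 := by
      have : (1 : ℚ) ≤ (q : ℚ) ^ c := one_le_pow₀ hq'.le
      have e : (q : ℚ) ^ c * (q : ℚ) ^ (b + 1) = (q : ℚ) ^ (b + c + 1) := by
        rw [← pow_add]; congr 1; ring
      linarith
    calc (q : ℚ) ^ ((b + 1) * c) * ((q : ℚ) ^ (b + 1) - 1)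
        = (q : ℚ) ^ (b * c) * ((q : ℚ) ^ c * ((q : ℚ) ^ (b + 1) - 1)) := by
          rw [add_mul, one_mul, pow_add]; ring
      _ ≤ _ := mul_le_mul ih h1 (by positivity) (gaussBinom_nonneg hq _ _)

theorem one_le_gaussBinom {a b : ℕ} (h : b ≤ a) : 1 ≤ gaussBinom q a b := by
  obtain ⟨c, rfl⟩ := Nat.exists_eq_add_of_le h
  exact (one_le_pow₀ (one_lt_cast_of_two_le hq).le).trans (gaussBinom_pow_le hq b c)

theorem gaussBinom_pos {a b : ℕ} (h : b ≤ a) : 0 < gaussBinom q a b :=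
  one_pos.trans_le (one_le_gaussBinom hq h)

theorem gaussBinom_mul_prod (m j : ℕ) :
    gaussBinom q (m + j) j * (∏ i ∈ Finset.range j, ((q : ℚ) ^ (i + 1) - 1))
        * (∏ i ∈ Finset.range m, ((q : ℚ) ^ (i + 1) - 1))
      = ∏ i ∈ Finset.range (m + j), ((q : ℚ) ^ (i + 1) - 1) := by
  induction j with
  | zero => simp
  | succ j ih =>
    rw [← add_assoc, Finset.prod_range_succ _ (m + j), ← ih, Finset.prod_range_succ _ j]
    linear_combination (∏ i ∈ Finset.range j, ((q : ℚ) ^ (i + 1) - 1))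
      * (∏ i ∈ Finset.range m, ((q : ℚ) ^ (i + 1) - 1)) * gaussBinom_succ_mul hq (m + j) j

theorem prod_pow_succ_sub_one_pos (m : ℕ) :
    0 < ∏ i ∈ Finset.range m, ((q : ℚ) ^ (i + 1) - 1) :=
  Finset.prod_pos fun i _ => pow_succ_sub_one_pos hq i

theorem gaussBinom_symm (m j : ℕ) : gaussBinom q (m + j) j = gaussBinom q (m + j) m := by
  have hm := (prod_pow_succ_sub_one_pos hq m).ne'
  have hj := (prod_pow_succ_sub_one_pos hq j).ne'
  have h1 := gaussBinom_mul_prod hq m j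
  have h2 := gaussBinom_mul_prod hq j m
  rw [add_comm j m] at h2
  refine mul_right_cancel₀ (mul_ne_zero hm hj) ?_
  linear_combination h1 - h2

/-- Both sides are the q-multinomial coefficient of a, b, c. -/
theorem gaussBinom_mul_gaussBinom_comm (a b c : ℕ) :
    gaussBinom q (a + c + b) b * gaussBinom q (c + a) a
      = gaussBinom q (b + c + a) a * gaussBinom q (c + b) b := by
  have ha := (prod_pow_succ_sub_one_pos hq a).ne'
  have hb := (prod_pow_succ_sub_one_pos hq b).ne'
  have hc := (prod_pow_succ_sub_one_pos hq c).ne'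
  have h1 := gaussBinom_mul_prod hq (a + c) b
  have h2 := gaussBinom_mul_prod hq c a
  have h3 := gaussBinom_mul_prod hq (b + c) a
  have h4 := gaussBinom_mul_prod hq c b
  rw [add_comm a c, ← h2] at h1
  rw [add_comm b c, ← h4] at h3
  rw [show c + a + b = c + b + a by ring, ← h3] at h1
  refine mul_right_cancel₀ (mul_ne_zero (mul_ne_zero ha hb) hc) ?_
  rw [show a + c + b = c + b + a by ring, show b + c + a = c + b + a by ring]
  linear_combination h1

end GaussBinom
-- Extension counts and their rate of decay
section Estimates

/-- The number of `l`-subspaces of an `n`-space that contain a given `s`-subspace. -/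
def extCount (q n l s : ℕ) : ℚ :=
  if s ≤ l then gaussBinom q (n - s) (l - s) else 0

theorem extCount_of_le {q n l s : ℕ} (h : s ≤ l) :
    extCount q n l s = gaussBinom q (n - s) (l - s) := if_pos h

theorem extCount_of_lt {q n l s : ℕ} (h : l < s) : extCount q n l s = 0 := if_neg (by omega)

@[simp] theorem extCount_self (q n l : ℕ) : extCount q n l l = 1 := by simp [extCount]

/-- The rate at which extension counts decay, relative to the number of points of a
complementary interval. -/
def decay (q t : ℕ) : ℚ := 1 / (((q : ℚ) - 1) * (q : ℚ) ^ (2 * t + 2))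

/-- The relative margin by which the extremal products exceed their leading terms. -/
def margin (q t : ℕ) : ℚ := 1 - 1 / (2 * (q : ℚ) ^ (2 * t + 2))

variable {q : ℕ} (hq : 2 ≤ q)
include hq

theorem extCount_nonneg (n l s : ℕ) : 0 ≤ extCount q n l s := by
  unfold extCount
  split_ifs
  · exact gaussBinom_nonneg hq _ _
  · exact le_rfl

theorem extCount_pos {n l s : ℕ} (h : s ≤ l) (hl : l ≤ n) : 0 < extCount q n l s := by
  rw [extCount_of_le h]
  exact gaussBinom_pos hq (by omega)

theorem extCount_succ_mul {n l s : ℕ} (hs : s ≤ l) (hn : s < n) :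
    extCount q n l (s + 1) * ((q : ℚ) ^ (n - s) - 1)
      = extCount q n l s * ((q : ℚ) ^ (l - s) - 1) := by
  rcases hs.eq_or_lt with rfl | hs'
  · simp [extCount_of_lt]
  · rw [extCount_of_le hs, extCount_of_le hs']
    obtain ⟨a, ha⟩ : ∃ a, n - s = a + 1 := ⟨n - s - 1, by omega⟩
    obtain ⟨b, hb⟩ : ∃ b, l - s = b + 1 := ⟨l - s - 1, by omega⟩
    rw [ha, hb, show n - (s + 1) = a by omega, show l - (s + 1) = b by omega,
      gaussBinom_succ_mul hq]

/-- The exact ratio of consecutive counts is (q^(l-s) - 1)/(q^(n-s) - 1), which is at most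
q^(-(n-l)). -/
theorem extCount_succ_mul_pow_le {n l : ℕ} (s : ℕ) (hl : l ≤ n) :
    extCount q n l (s + 1) * (q : ℚ) ^ (n - l) ≤ extCount q n l s := by
  have hq' := one_lt_cast_of_two_le hq
  rcases le_or_gt l s with h | h
  · rw [extCount_of_lt (by omega), zero_mul]
    exact extCount_nonneg hq _ _ _
  · have h1 := extCount_succ_mul hq h.le (h.trans_le hl)
    have h2 : 0 < (q : ℚ) ^ (l - s) - 1 := by
      obtain ⟨b, hb⟩ : ∃ b, l - s = b + 1 := ⟨l - s - 1, by omega⟩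
      rw [hb]; exact pow_succ_sub_one_pos hq b
    have h3 : (q : ℚ) ^ (n - l) * ((q : ℚ) ^ (l - s) - 1) ≤ (q : ℚ) ^ (n - s) - 1 := by
      have : (1 : ℚ) ≤ (q : ℚ) ^ (n - l) := one_le_pow₀ hq'.le
      rw [mul_sub, ← pow_add, show n - l + (l - s) = n - s by omega]
      linarith
    refine le_of_mul_le_mul_right ?_ h2
    rw [← h1, mul_assoc]
    exact mul_le_mul_of_nonneg_left h3 (extCount_nonneg hq _ _ _)

theorem gaussBinom_one_le_pow (a : ℕ) :
    gaussBinom q a 1 * ((q : ℚ) - 1) ≤ (q : ℚ) ^ a := by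
  rw [gaussBinom_one_mul hq]; linarith

theorem gaussBinom_one_succ (a : ℕ) :
    gaussBinom q (a + 1) 1 = q * gaussBinom q a 1 + 1 := by
  have := gaussBinom_pascal hq a 0
  simpa using this

theorem gaussBinom_one_succ' (a : ℕ) :
    gaussBinom q (a + 1) 1 = gaussBinom q a 1 + (q : ℚ) ^ a := by
  have h : (0 : ℚ) < (q : ℚ) - 1 := by linarith [one_lt_cast_of_two_le hq]
  refine mul_right_cancel₀ h.ne' ?_
  rw [add_mul, gaussBinom_one_mul hq, gaussBinom_one_mul hq]
  ring

theorem gaussBinom_one_eq_sum (a : ℕ) :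
    gaussBinom q a 1 = ∑ i ∈ Finset.range a, (q : ℚ) ^ i := by
  induction a with
  | zero => simp
  | succ a ih => rw [gaussBinom_one_succ' hq, ih, Finset.sum_range_succ]

theorem gaussBinom_one_mono {a b : ℕ} (h : a ≤ b) : gaussBinom q a 1 ≤ gaussBinom q b 1 := by
  rw [gaussBinom_one_eq_sum hq, gaussBinom_one_eq_sum hq]
  exact Finset.sum_le_sum_of_subset_of_nonneg (by simpa using h) fun _ _ _ => by positivity

theorem two_mul_gaussBinom_one_le {a b : ℕ} (h : a + 1 ≤ b) :
    2 * gaussBinom q a 1 ≤ gaussBinom q b 1 := by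
  refine le_trans ?_ (gaussBinom_one_mono hq h)
  rw [gaussBinom_one_succ hq]
  have := mul_le_mul_of_nonneg_right (two_le_cast_of_two_le hq) (gaussBinom_nonneg hq a 1)
  linarith

theorem decay_pos (t : ℕ) : 0 < decay q t := by
  have : (0 : ℚ) < (q : ℚ) - 1 := by linarith [one_lt_cast_of_two_le hq]
  unfold decay
  positivity

theorem decay_mul (t : ℕ) : decay q t * (((q : ℚ) - 1) * (q : ℚ) ^ (2 * t + 2)) = 1 := by
  have : (0 : ℚ) < (q : ℚ) - 1 := by linarith [one_lt_cast_of_two_le hq]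
  unfold decay
  field_simp

theorem pow_mul_decay_le (t : ℕ) : (q : ℚ) ^ (2 * t + 2) * decay q t ≤ 1 := by
  have h := decay_mul hq t
  have h1 : (1 : ℚ) ≤ (q : ℚ) - 1 := by linarith [two_le_cast_of_two_le hq]
  have h2 : 0 ≤ (q : ℚ) ^ (2 * t + 2) * decay q t := mul_nonneg (by positivity) (decay_pos hq t).le
  nlinarith

/-- Passing to a larger subspace more than compensates for the choice of a point. -/
theorem gaussBinom_mul_extCount_succ_le {n k l t : ℕ} (s : ℕ) (ht : t ≤ k)
    (hn : k + l + t + 3 ≤ n) :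
    gaussBinom q (k - t + 1) 1 * extCount q n l (s + 1) ≤ decay q t * extCount q n l s := by
  have hq' := one_lt_cast_of_two_le hq
  have hpos : (0 : ℚ) < ((q : ℚ) - 1) * (q : ℚ) ^ (2 * t + 2) := by
    have : (0 : ℚ) < (q : ℚ) - 1 := by linarith
    positivity
  have h1 := extCount_succ_mul_pow_le hq (l := l) (n := n) s (by omega)
  have h2 := gaussBinom_one_le_pow hq (k - t + 1)
  -- The exponents add up to k + t + 3, which is at most n - l by `hn`; this is what fixes the
  -- exponent 2t + 2 in `decay`.
  have h3 : (q : ℚ) ^ (k - t + 1) * (q : ℚ) ^ (2 * t + 2) ≤ (q : ℚ) ^ (n - l) := by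
    rw [← pow_add]
    exact pow_le_pow_right₀ hq'.le (by omega)
  refine le_of_mul_le_mul_left ?_ hpos
  have h4 := decay_mul hq t
  have h5 := extCount_nonneg hq n l (s + 1)
  calc ((q : ℚ) - 1) * (q : ℚ) ^ (2 * t + 2)
        * (gaussBinom q (k - t + 1) 1 * extCount q n l (s + 1))
      = (gaussBinom q (k - t + 1) 1 * ((q : ℚ) - 1)) * (q : ℚ) ^ (2 * t + 2)
        * extCount q n l (s + 1) := by ring
    _ ≤ (q : ℚ) ^ (k - t + 1) * (q : ℚ) ^ (2 * t + 2) * extCount q n l (s + 1) := by gcongr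
    _ ≤ (q : ℚ) ^ (n - l) * extCount q n l (s + 1) := by gcongr
    _ ≤ extCount q n l s := by linarith
    _ = _ := by linear_combination (-extCount q n l s) * h4

theorem two_mul_pow_mul_decay_le (t : ℕ) : 2 * (q : ℚ) ^ t * decay q t ≤ 1 := by
  have hq' := two_le_cast_of_two_le hq
  refine le_trans (mul_le_mul_of_nonneg_right ?_ (decay_pos hq t).le) (pow_mul_decay_le hq t)
  rw [show 2 * t + 2 = 1 + t + (t + 1) by ring, pow_add, pow_add, pow_one]
  have : (1 : ℚ) ≤ (q : ℚ) ^ (t + 1) := one_le_pow₀ (by linarith)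
  have h2 : 0 ≤ (q : ℚ) ^ t := by positivity
  have h3 := mul_le_mul_of_nonneg_right hq' h2
  exact h3.trans (le_mul_of_one_le_right (h3.trans' (by positivity)) this)

theorem gaussBinom_one_mul_decay_le {t : ℕ} (ht : 1 ≤ t) :
    gaussBinom q (t + 1) 1 * decay q t ≤ 1 / 4 := by
  have hq' := two_le_cast_of_two_le hq
  have h1 : gaussBinom q (t + 1) 1 ≤ (q : ℚ) ^ (t + 1) := by
    have := gaussBinom_one_le_pow hq (t + 1)
    have := gaussBinom_nonneg hq (t + 1) 1
    nlinarith
  have h2 := pow_mul_decay_le hq t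
  have h3 := decay_pos hq t
  have h4 : (4 : ℚ) ≤ (q : ℚ) ^ (t + 1) := by
    calc (4 : ℚ) = 2 ^ 2 := by norm_num
      _ ≤ (q : ℚ) ^ 2 := by gcongr
      _ ≤ _ := pow_le_pow_right₀ (by linarith) (by omega)
  rw [show 2 * t + 2 = (t + 1) + (t + 1) by ring, pow_add] at h2
  have h5 : 0 ≤ (q : ℚ) ^ (t + 1) * decay q t := by positivity
  have h6 : gaussBinom q (t + 1) 1 * decay q t ≤ (q : ℚ) ^ (t + 1) * decay q t := by gcongr
  nlinarith

theorem decay_le {t : ℕ} (ht : 1 ≤ t) : decay q t ≤ 1 / 16 := by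
  have hq' := two_le_cast_of_two_le hq
  have h2 := pow_mul_decay_le hq t
  have h3 := decay_pos hq t
  have h4 : (16 : ℚ) ≤ (q : ℚ) ^ (2 * t + 2) := by
    calc (16 : ℚ) = 2 ^ 4 := by norm_num
      _ ≤ (q : ℚ) ^ 4 := by gcongr
      _ ≤ _ := pow_le_pow_right₀ (by linarith) (by omega)
  nlinarith

theorem margin_ge (t : ℕ) : 7 / 8 ≤ margin q t := by
  have hq' := two_le_cast_of_two_le hq
  have h4 : (4 : ℚ) ≤ (q : ℚ) ^ (2 * t + 2) := by
    calc (4 : ℚ) = 2 ^ 2 := by norm_num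
      _ ≤ (q : ℚ) ^ 2 := by gcongr
      _ ≤ _ := pow_le_pow_right₀ (by linarith) (by omega)
  have : 1 / (2 * (q : ℚ) ^ (2 * t + 2)) ≤ 1 / (2 * 4) := by gcongr
  unfold margin
  linarith

/-- With y = q^(t+1) the left side is at most (1 - 1/y)², against 1 - 1/(2y²) on the right. For q =
2 the left side equals (1 - 1/y)² and tends to 1 as t grows, so `margin` cannot be replaced by a
constant below 1. -/
theorem sq_mul_decay_lt_margin (t : ℕ) :
    gaussBinom q (t + 1) 1 ^ 2 * decay q t < margin q t := by
  have hq' := two_le_cast_of_two_le hq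
  have h1 := gaussBinom_one_mul hq (t + 1)
  set y : ℚ := (q : ℚ) ^ (t + 1) with hy
  have hy2 : (2 : ℚ) ≤ y := by
    calc (2 : ℚ) ≤ (q : ℚ) ^ 1 := by simpa using hq'
      _ ≤ _ := pow_le_pow_right₀ (by linarith) (by omega)
  have hyy : (q : ℚ) ^ (2 * t + 2) = y ^ 2 := by rw [hy, ← pow_mul]; congr 1; ring
  have h0 : 0 ≤ gaussBinom q (t + 1) 1 := gaussBinom_nonneg hq _ _
  have h2 : gaussBinom q (t + 1) 1 ≤ y - 1 := by nlinarith
  have h3 : decay q t ≤ 1 / y ^ 2 := by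
    rw [le_div_iff₀ (by positivity), ← hyy, mul_comm]
    exact pow_mul_decay_le hq t
  calc gaussBinom q (t + 1) 1 ^ 2 * decay q t ≤ (y - 1) ^ 2 * (1 / y ^ 2) := by
        have := (decay_pos hq t).le
        gcongr
    _ < 1 - 1 / (2 * y ^ 2) := by
        have e : 1 - 1 / (2 * y ^ 2) - (y - 1) ^ 2 * (1 / y ^ 2) = (4 * y - 3) / (2 * y ^ 2) := by
          field_simp; ring
        have : 0 < (4 * y - 3) / (2 * y ^ 2) := div_pos (by linarith) (by positivity)
        linarith
    _ = margin q t := by rw [margin, hyy]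

/-- The product is at most q/((q² - 1)(q - 1)²), which equals 2/3 at q = 2. It controls the case of
a least cover of dimension at least t + 2. -/
theorem gaussBinom_two_mul_decay_le (t : ℕ) :
    gaussBinom q (t + 2) t * decay q t ≤ 2 / 3 := by
  have hq' := two_le_cast_of_two_le hq
  have e1 : gaussBinom q (t + 2) t = gaussBinom q (t + 2) 2 := (gaussBinom_symm hq t 2).symm
  have e2 := gaussBinom_succ_mul hq (t + 1) 1
  have e3 := gaussBinom_one_mul hq (t + 1)
  have e4 := decay_mul hq t
  rw [e1]
  simp only [show t + 1 + 1 = t + 2 by ring, show 1 + 1 = 2 by rfl] at e2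
  set y : ℚ := (q : ℚ) ^ t with hy
  have hy1 : 1 ≤ y := one_le_pow₀ (by linarith)
  rw [show (q : ℚ) ^ (t + 2) = y * q ^ 2 by rw [hy, pow_add]] at e2
  rw [show (q : ℚ) ^ (t + 1) = y * q by rw [hy, pow_add, pow_one]] at e3
  rw [show (q : ℚ) ^ (2 * t + 2) = y ^ 2 * q ^ 2 by rw [hy, ← pow_mul, pow_add, mul_comm t 2]] at e4
  set g := gaussBinom q (t + 2) 2
  set x : ℚ := (q : ℚ) with hx
  have hd := decay_pos hq t
  have hx1 : 0 < x - 1 := by linarith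
  have hx2 : 0 < x ^ 2 - 1 := by nlinarith
  have hg : g * ((x ^ 2 - 1) * (x - 1)) = (y * x ^ 2 - 1) * (y * x - 1) := by
    linear_combination (x - 1) * e2 + (y * x ^ 2 - 1) * e3
  have hg' : g * ((x ^ 2 - 1) * (x - 1)) ≤ y ^ 2 * x ^ 3 := by
    rw [hg]; nlinarith [mul_pos (by linarith : 0 < y) (by linarith : 0 < x)]
  have hb : x ≤ 2 / 3 * ((x ^ 2 - 1) * (x - 1) ^ 2) := by
    have h1 : (3 : ℚ) ≤ x ^ 2 - 1 := by nlinarith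
    have h2 : x - 1 ≤ (x - 1) ^ 2 := by nlinarith
    have h3 : 3 * (x - 1) ≤ (x ^ 2 - 1) * (x - 1) ^ 2 := mul_le_mul h1 h2 hx1.le hx2.le
    linarith
  refine le_of_mul_le_mul_right ?_ (by positivity : 0 < (x ^ 2 - 1) * (x - 1) ^ 2)
  calc g * decay q t * ((x ^ 2 - 1) * (x - 1) ^ 2)
      = g * ((x ^ 2 - 1) * (x - 1)) * (decay q t * (x - 1)) := by ring
    _ ≤ y ^ 2 * x ^ 3 * (decay q t * (x - 1)) := by gcongr
    _ = x := by linear_combination x * e4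
    _ ≤ _ := hb

end Estimates
-- Exchanging the two dimensions; counting subspaces that miss a given one
section Bounds

variable {q : ℕ} (hq : 2 ≤ q)
include hq

theorem mul_extCount_succ_le {n l : ℕ} (s : ℕ) (hl : l < n) :
    q * extCount q n l (s + 1) ≤ extCount q n l s := by
  have h := extCount_succ_mul_pow_le hq s hl.le
  have h1 : (q : ℚ) ≤ (q : ℚ) ^ (n - l) :=
    le_self_pow₀ (one_lt_cast_of_two_le hq).le (by omega)
  nlinarith [mul_le_mul_of_nonneg_left h1 (extCount_nonneg hq n l (s + 1))]

/-- The extra members of a Hilton–Milner type family are few. -/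
theorem pow_mul_extCount_le {n k l t j : ℕ} (ht : 1 ≤ t) (hk : t + 1 ≤ k)
    (hn : k + l + t + 3 ≤ n) (hj : 2 ≤ j) :
    (q : ℚ) ^ j * gaussBinom q t 1 * extCount q n l (t + j - 1) ≤ 1 / 8 * extCount q n l t := by
  have hq' := two_le_cast_of_two_le hq
  -- An extra dimension divides the count by at least q, so q^j e(l, t+j-1) does not increase with j
  -- and j = 2 is the worst case.
  have h1 : (q : ℚ) ^ j * extCount q n l (t + j - 1) ≤ (q : ℚ) ^ 2 * extCount q n l (t + 1) := by
    induction j, hj using Nat.le_induction with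
    | base => simp
    | succ j hj ih =>
      refine le_trans ?_ ih
      have := mul_extCount_succ_le hq (n := n) (l := l) (t + j - 1) (by omega)
      rw [show t + (j + 1) - 1 = t + j - 1 + 1 by omega, pow_succ, mul_assoc]
      gcongr
  have h2 := extCount_succ_mul_pow_le hq (n := n) (l := l) t (by omega)
  have h3 : gaussBinom q t 1 ≤ (q : ℚ) ^ t := by
    nlinarith [gaussBinom_one_le_pow hq t, gaussBinom_nonneg hq t 1]
  have h4 := extCount_nonneg hq n l (t + 1)
  -- Here n - l ≥ k + t + 3 ≥ 2t + 4 ≥ t + 5, the last because t ≥ 1.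
  have h5 : (8 : ℚ) * (q : ℚ) ^ (t + 2) ≤ (q : ℚ) ^ (n - l) := by
    calc (8 : ℚ) * (q : ℚ) ^ (t + 2) = 2 ^ 3 * (q : ℚ) ^ (t + 2) := by norm_num
      _ ≤ (q : ℚ) ^ 3 * (q : ℚ) ^ (t + 2) := by gcongr
      _ = (q : ℚ) ^ (t + 5) := by ring
      _ ≤ _ := pow_le_pow_right₀ (by linarith) (by omega)
  have h6 := gaussBinom_nonneg hq t 1
  calc (q : ℚ) ^ j * gaussBinom q t 1 * extCount q n l (t + j - 1)
      = gaussBinom q t 1 * ((q : ℚ) ^ j * extCount q n l (t + j - 1)) := by ring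
    _ ≤ gaussBinom q t 1 * ((q : ℚ) ^ 2 * extCount q n l (t + 1)) := by gcongr
    _ ≤ (q : ℚ) ^ t * ((q : ℚ) ^ 2 * extCount q n l (t + 1)) := by gcongr
    _ = 1 / 8 * (8 * (q : ℚ) ^ (t + 2) * extCount q n l (t + 1)) := by ring
    _ ≤ 1 / 8 * ((q : ℚ) ^ (n - l) * extCount q n l (t + 1)) := by gcongr
    _ ≤ _ := by linarith

/-- The ratio e(k, t+1)/e(k, t) has the same denominator q^(n-t) - 1 for both values of k. The
inequalities that follow read off which family should bear the extra dimension. -/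
theorem extCount_swap_mul {n k₁ k₂ t : ℕ} (h₁ : t ≤ k₁) (h₂ : t ≤ k₂) (hn : t < n) :
    extCount q n k₁ t * extCount q n k₂ (t + 1) * ((q : ℚ) ^ (k₁ - t) - 1)
      = extCount q n k₁ (t + 1) * extCount q n k₂ t * ((q : ℚ) ^ (k₂ - t) - 1) := by
  have e1 := extCount_succ_mul hq h₁ hn
  have e2 := extCount_succ_mul hq h₂ hn
  obtain ⟨m, hm⟩ : ∃ m, n - t = m + 1 := ⟨n - t - 1, by omega⟩
  rw [hm] at e1 e2
  refine mul_right_cancel₀ (pow_succ_sub_one_pos hq m).ne' ?_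
  linear_combination extCount q n k₁ t * ((q : ℚ) ^ (k₁ - t) - 1) * e2
    - extCount q n k₂ t * ((q : ℚ) ^ (k₂ - t) - 1) * e1

theorem extCount_swap_le {n k₁ k₂ t : ℕ} (h : k₂ ≤ k₁) (h₂ : t + 1 ≤ k₂) (hn : t < n) :
    extCount q n k₁ t * extCount q n k₂ (t + 1) ≤ extCount q n k₁ (t + 1) * extCount q n k₂ t := by
  have e := extCount_swap_mul hq (n := n) (by omega : t ≤ k₁) (by omega : t ≤ k₂) hn
  obtain ⟨b, rfl⟩ := Nat.exists_eq_add_of_le h₂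
  obtain ⟨c, rfl⟩ := Nat.exists_eq_add_of_le h
  rw [show t + 1 + b + c - t = b + c + 1 by omega, show t + 1 + b - t = b + 1 by omega] at e
  have h1 := pow_succ_sub_one_pos hq (b + c)
  have h2 : (q : ℚ) ^ (b + 1) ≤ (q : ℚ) ^ (b + c + 1) :=
    pow_le_pow_right₀ (one_lt_cast_of_two_le hq).le (by omega)
  have h3 := mul_nonneg (extCount_nonneg hq n (t + 1 + b + c) (t + 1))
    (extCount_nonneg hq n (t + 1 + b) t)
  refine le_of_mul_le_mul_right ?_ h1
  rw [e]
  gcongr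

theorem two_mul_extCount_swap_le {n k₁ k₂ t : ℕ} (h : k₂ < k₁) (h₂ : t + 1 ≤ k₂) (hn : t < n) :
    2 * (extCount q n k₁ t * extCount q n k₂ (t + 1))
      ≤ extCount q n k₁ (t + 1) * extCount q n k₂ t := by
  have e := extCount_swap_mul hq (n := n) (by omega : t ≤ k₁) (by omega : t ≤ k₂) hn
  obtain ⟨b, rfl⟩ := Nat.exists_eq_add_of_le h₂
  obtain ⟨c, rfl⟩ := Nat.exists_eq_add_of_lt h
  rw [show t + 1 + b + c + 1 - t = b + c + 1 + 1 by omega,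
    show t + 1 + b - t = b + 1 by omega] at e
  have h1 := pow_succ_sub_one_pos hq (b + c + 1)
  have h2 : 2 * (q : ℚ) ^ (b + 1) ≤ (q : ℚ) ^ (b + c + 1 + 1) := by
    have := pow_le_pow_right₀ (one_lt_cast_of_two_le hq).le (by omega : b + 1 + 1 ≤ b + c + 1 + 1)
    have h4 := mul_le_mul_of_nonneg_right (two_le_cast_of_two_le hq)
      (by positivity : 0 ≤ (q : ℚ) ^ (b + 1))
    rw [pow_succ _ (b + 1)] at this
    linarith
  have h3 := mul_nonneg (extCount_nonneg hq n (t + 1 + b + c + 1) (t + 1))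
    (extCount_nonneg hq n (t + 1 + b) t)
  refine le_of_mul_le_mul_right ?_ h1
  rw [mul_assoc, e]
  nlinarith

/-- By `extCount_swap_mul` this says that θ_(a+1)/(q^a - 1) does not increase with a. -/
theorem gaussBinom_mul_extCount_swap_le {n k₁ k₂ t : ℕ} (h : k₂ ≤ k₁) (h₂ : t + 1 ≤ k₂)
    (hn : t < n) :
    gaussBinom q (k₁ - t + 1) 1 * (extCount q n k₁ t * extCount q n k₂ (t + 1))
      ≤ gaussBinom q (k₂ - t + 1) 1 * (extCount q n k₁ (t + 1) * extCount q n k₂ t) := by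
  have e := extCount_swap_mul hq (n := n) (by omega : t ≤ k₁) (by omega : t ≤ k₂) hn
  obtain ⟨b, rfl⟩ := Nat.exists_eq_add_of_le h₂
  obtain ⟨c, rfl⟩ := Nat.exists_eq_add_of_le h
  rw [show t + 1 + b + c - t = b + c + 1 by omega, show t + 1 + b - t = b + 1 by omega] at *
  have hq' := one_lt_cast_of_two_le hq
  have h1 := pow_succ_sub_one_pos hq (b + c)
  have h2 : (q : ℚ) ^ (b + 1) ≤ (q : ℚ) ^ (b + c + 1) :=
    pow_le_pow_right₀ (one_lt_cast_of_two_le hq).le (by omega)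
  have h3 := mul_nonneg (extCount_nonneg hq n (t + 1 + b + c) (t + 1))
    (extCount_nonneg hq n (t + 1 + b) t)
  have g1 := gaussBinom_one_mul hq (b + c + 1 + 1)
  have g2 := gaussBinom_one_mul hq (b + 1 + 1)
  set Q1 := gaussBinom q (b + c + 1 + 1) 1
  set Q2 := gaussBinom q (b + 1 + 1) 1
  have key : Q1 * ((q : ℚ) ^ (b + 1) - 1) ≤ Q2 * ((q : ℚ) ^ (b + c + 1) - 1) := by
    refine le_of_mul_le_mul_right ?_ (by linarith : (0 : ℚ) < (q : ℚ) - 1)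
    rw [mul_right_comm, g1, mul_right_comm, g2, pow_succ _ (b + c + 1), pow_succ _ (b + 1)]
    nlinarith
  refine le_of_mul_le_mul_right ?_ h1
  rw [mul_assoc, e]
  nlinarith

/-- The number of `k`-subspaces through a fixed member that meet a further `w`-space trivially,
as a function of `w`. -/
def missCount (q K N w : ℕ) : ℚ := (q : ℚ) ^ (w * K) * gaussBinom q (N - w) K

omit hq in
@[simp] theorem missCount_zero (K N : ℕ) : missCount q K N 0 = gaussBinom q N K := by
  simp [missCount]

theorem missCount_nonneg (K N w : ℕ) : 0 ≤ missCount q K N w :=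
  mul_nonneg (by positivity) (gaussBinom_nonneg hq _ _)

theorem missCount_sub_succ {K N i : ℕ} (h : i ≤ N) :
    missCount q (K + 1) (N + 1) i - missCount q (K + 1) (N + 1) (i + 1)
      = (q : ℚ) ^ i * missCount q K N i := by
  unfold missCount
  rw [show N + 1 - i = N - i + 1 by omega, show N + 1 - (i + 1) = N - i by omega,
    gaussBinom_pascal hq]
  ring

theorem missCount_antitone {K N i j : ℕ} (h : i ≤ j) (hj : j ≤ N) :
    missCount q K N j ≤ missCount q K N i := by
  induction j, h using Nat.le_induction with
  | base => exact le_rfl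
  | succ j h ih =>
    refine le_trans ?_ (ih (by omega))
    cases K with
    | zero => simp [missCount]
    | succ K =>
      obtain ⟨N, rfl⟩ : ∃ M, N = M + 1 := ⟨N - 1, by omega⟩
      have := missCount_sub_succ hq (K := K) (by omega : j ≤ N)
      have := mul_nonneg (by positivity : 0 ≤ (q : ℚ) ^ j) (missCount_nonneg hq K N j)
      linarith

/-- Pascal's rule telescoped along a flag of the w-space: the i-th term counts the subspaces that
miss the i-dimensional step but contain exactly one of the q^i new points of the next step. -/
theorem gaussBinom_sub_missCount {K N w : ℕ} (h : w ≤ N + 1) :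
    gaussBinom q (N + 1) (K + 1) - missCount q (K + 1) (N + 1) w
      = ∑ i ∈ Finset.range w, (q : ℚ) ^ i * missCount q K N i := by
  induction w with
  | zero => simp
  | succ w ih =>
    rw [Finset.sum_range_succ, ← ih (by omega), ← missCount_sub_succ hq (by omega)]
    ring

theorem missCount_succ_ge {K N w : ℕ} (h : w ≤ N + 1) :
    gaussBinom q (N + 1) (K + 1) - gaussBinom q w 1 * gaussBinom q N K
      ≤ missCount q (K + 1) (N + 1) w := by
  have : gaussBinom q (N + 1) (K + 1) - missCount q (K + 1) (N + 1) w
      ≤ gaussBinom q w 1 * gaussBinom q N K := by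
    rw [gaussBinom_sub_missCount hq h, gaussBinom_one_eq_sum hq, Finset.sum_mul]
    refine Finset.sum_le_sum fun i hi => ?_
    have := missCount_antitone hq (K := K) (Nat.zero_le i)
      (by have := Finset.mem_range.1 hi; omega : i ≤ N)
    rw [missCount_zero] at this
    gcongr
  linarith

end Bounds
-- Estimates and comparisons of the two extremal products
section ExtremalBounds

variable {q : ℕ} (hq : 2 ≤ q)
include hq

theorem extCount_sub_le_missCount {n k t i : ℕ} (hk : t + 1 ≤ k) (hn : k < n)
    (hi : i + t + 1 ≤ n) :
    extCount q n k (t + 1) - gaussBinom q i 1 * extCount q n k (t + 2)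
      ≤ missCount q (k - t - 1) (n - t - 1) i := by
  rcases hk.eq_or_lt with rfl | hk'
  · rw [extCount_self, extCount_of_lt (by omega)]
    simp [missCount]
  · rw [extCount_of_le hk, extCount_of_le hk']
    obtain ⟨K, rfl⟩ := Nat.exists_eq_add_of_lt hk'
    obtain ⟨N, rfl⟩ : ∃ N, n = t + 2 + N := ⟨n - t - 2, by omega⟩
    have := missCount_succ_ge hq (K := K) (N := N) (w := i) (by omega)
    simpa only [show t + 2 + N - (t + 1) = N + 1 by omega,
      show t + 1 + K + 1 - (t + 1) = K + 1 by omega, show t + 2 + N - (t + 2) = N by omega,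
      show t + 1 + K + 1 - (t + 2) = K by omega, show t + 1 + K + 1 - t - 1 = K + 1 by omega,
      show t + 2 + N - t - 1 = N + 1 by omega] using this

theorem missCount_le_extCount {n k t i : ℕ} (hk : t + 1 ≤ k) (hi : i + t + 1 ≤ n) :
    missCount q (k - t - 1) (n - t - 1) i ≤ extCount q n k (t + 1) := by
  rw [extCount_of_le hk, ← missCount_zero, show n - (t + 1) = n - t - 1 by omega,
    show k - (t + 1) = k - t - 1 by omega]
  exact missCount_antitone hq (Nat.zero_le _) (by omega)

theorem hitCount_eq_sum {n k t w : ℕ} (hk : t + 1 ≤ k) (hn : t + 1 ≤ n) (hw : w + t ≤ n) :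
    gaussBinom q (n - t) (k - t) - (q : ℚ) ^ (w * (k - t)) * gaussBinom q (n - t - w) (k - t)
      = ∑ i ∈ Finset.range w, (q : ℚ) ^ i * missCount q (k - t - 1) (n - t - 1) i := by
  have := gaussBinom_sub_missCount hq (K := k - t - 1) (N := n - t - 1) (w := w) (by omega)
  rw [← this, show n - t - 1 + 1 = n - t by omega, show k - t - 1 + 1 = k - t by omega, missCount]

theorem hitCount_le {n k t w : ℕ} (hk : t + 1 ≤ k) (hn : t + 1 ≤ n) (hw : w + t ≤ n) :
    gaussBinom q (n - t) (k - t) - (q : ℚ) ^ (w * (k - t)) * gaussBinom q (n - t - w) (k - t)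
      ≤ gaussBinom q w 1 * extCount q n k (t + 1) := by
  rw [hitCount_eq_sum hq hk hn hw, gaussBinom_one_eq_sum hq, Finset.sum_mul]
  refine Finset.sum_le_sum fun i hi => ?_
  have := Finset.mem_range.1 hi
  have := missCount_le_extCount hq (n := n) hk (i := i) (by omega)
  gcongr

/-- In the sum of `hitCount_eq_sum` the index stays at most w, so the correction carries θ_w instead
of θ_(w+1). This saves a factor 2, which `margin` relies on. -/
theorem le_hitCount {n k t w : ℕ} (hk : t + 1 ≤ k) (hn : k < n) (hw : w + 1 + t ≤ n) :
    gaussBinom q (w + 1) 1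
        * (extCount q n k (t + 1) - gaussBinom q w 1 * extCount q n k (t + 2))
      ≤ gaussBinom q (n - t) (k - t)
        - (q : ℚ) ^ ((w + 1) * (k - t)) * gaussBinom q (n - t - (w + 1)) (k - t) := by
  rw [hitCount_eq_sum hq hk (by omega) hw, gaussBinom_one_eq_sum hq (w + 1), Finset.sum_mul]
  refine Finset.sum_le_sum fun i hi => ?_
  have := Finset.mem_range.1 hi
  have h1 := extCount_sub_le_missCount hq (n := n) hk hn (i := i) (by omega)
  have h2 := gaussBinom_one_mono hq (by omega : i ≤ w)
  have h3 := extCount_nonneg hq n k (t + 2)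
  refine mul_le_mul_of_nonneg_left (le_trans ?_ h1) (by positivity)
  gcongr

omit hq in
theorem boundAB_eq {n k₁ k₂ t : ℕ} (hk₂ : t ≤ k₂) :
    boundAB q n k₁ k₂ t =
      (gaussBinom q (n - t) (k₁ - t) - (q : ℚ) ^ ((k₂ - t + 1) * (k₁ - t))
          * gaussBinom q (n - t - (k₂ - t + 1)) (k₁ - t))
        * (extCount q n k₂ t + (q : ℚ) ^ (k₂ - t + 1) * gaussBinom q t 1) := by
  rw [boundAB, extCount_of_le hk₂, show k₂ + 1 - t = k₂ - t + 1 by omega,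
    show n - t - (k₂ - t + 1) = n - k₂ - 1 by omega]

/-- By Pascal's rule, q^(k₂-t) times the large Gaussian binomial is e(k₂, t) - e(k₂, t+1): the
k₂-spaces that meet T in a prescribed t-space. -/
theorem boundCD_eq {n k₁ k₂ t : ℕ} (hk₁ : t + 1 ≤ k₁) (hk₂ : t + 1 ≤ k₂) (hn : t + 1 ≤ n) :
    boundCD q n k₁ k₂ t = extCount q n k₁ (t + 1)
      * (gaussBinom q (t + 1) 1 * (extCount q n k₂ t - extCount q n k₂ (t + 1))
        + extCount q n k₂ (t + 1)) := by
  have hp := gaussBinom_pascal hq (n - t - 1) (k₂ - t - 1)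
  rw [boundCD, extCount_of_le hk₁, extCount_of_le hk₂, extCount_of_le (by omega : t ≤ k₂)]
  rw [show n - t - 1 + 1 = n - t by omega, show k₂ - t - 1 + 1 = k₂ - t by omega] at hp
  rw [hp, show n - (t + 1) = n - t - 1 by omega, show k₂ - (t + 1) = k₂ - t - 1 by omega,
    show k₁ - (t + 1) = k₁ - t - 1 by omega]
  ring

theorem margin_mul_le_boundAB {n k₁ k₂ t : ℕ} (hk₁ : t + 1 ≤ k₁) (hk₂ : t + 1 ≤ k₂)
    (hn : k₁ + k₂ + t + 3 ≤ n) :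
    margin q t * (gaussBinom q (k₂ - t + 1) 1 * (extCount q n k₁ (t + 1) * extCount q n k₂ t))
      ≤ boundAB q n k₁ k₂ t := by
  have hq' := two_le_cast_of_two_le hq
  have h1 := le_hitCount hq hk₁ (by omega : k₁ < n) (w := k₂ - t) (by omega)
  have h2 := gaussBinom_mul_extCount_succ_le hq (n := n) (k := k₂) (l := k₁) (t + 1)
    (by omega : t ≤ k₂) (by omega)
  have h3 := two_mul_gaussBinom_one_le hq (le_refl (k₂ - t + 1))
  have h4 := extCount_nonneg hq n k₁ (t + 2)
  have h5 := extCount_nonneg hq n k₁ (t + 1)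
  have h6 := extCount_nonneg hq n k₂ t
  -- The relative loss in the lower bound `h1` is θ_(k₂-t) e(k₁, t+2)/e(k₁, t+1), at most half of
  -- `decay`; hence the 2 in the denominator of `margin`.
  have h7 : decay q t ≤ 2 * (1 - margin q t) := by
    have : 2 * (1 - margin q t) = 1 / (q : ℚ) ^ (2 * t + 2) := by
      unfold margin; field_simp; ring
    rw [this, le_div_iff₀ (by positivity), mul_comm]
    exact pow_mul_decay_le hq t
  have h8 := gaussBinom_nonneg hq (k₂ - t + 1) 1
  have h9 := gaussBinom_nonneg hq t 1
  rw [boundAB_eq (by omega)]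
  have hA : gaussBinom q (k₂ - t + 1) 1 * (margin q t * extCount q n k₁ (t + 1)) ≤
      gaussBinom q (n - t) (k₁ - t) - (q : ℚ) ^ ((k₂ - t + 1) * (k₁ - t))
          * gaussBinom q (n - t - (k₂ - t + 1)) (k₁ - t) := by
    refine le_trans (mul_le_mul_of_nonneg_left ?_ h8) h1
    have := mul_le_mul_of_nonneg_right h3 h4
    have := mul_le_mul_of_nonneg_right h7 h5
    simp only [show t + 1 + 1 = t + 2 by ring] at h2
    linarith
  have hm := margin_ge hq t
  calc _ = gaussBinom q (k₂ - t + 1) 1 * (margin q t * extCount q n k₁ (t + 1))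
        * extCount q n k₂ t := by ring
    _ ≤ _ := by
      refine mul_le_mul hA (le_add_of_nonneg_right (by positivity)) h6 (le_trans ?_ hA)
      have : 0 ≤ margin q t := by linarith
      positivity

theorem margin_mul_le_boundCD {n k₁ k₂ t : ℕ} (hk₁ : t + 1 ≤ k₁) (hk₂ : t + 1 ≤ k₂)
    (hn : k₁ + k₂ + t + 3 ≤ n) :
    margin q t * (gaussBinom q (t + 1) 1 * (extCount q n k₁ (t + 1) * extCount q n k₂ t))
      ≤ boundCD q n k₁ k₂ t := by
  have hq' := two_le_cast_of_two_le hq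
  rw [boundCD_eq hq hk₁ hk₂ (by omega)]
  have h1 := extCount_succ_mul_pow_le hq (n := n) (l := k₂) t (by omega)
  have h2 : 2 * (q : ℚ) ^ (2 * t + 2) ≤ (q : ℚ) ^ (n - k₂) := by
    calc 2 * (q : ℚ) ^ (2 * t + 2) ≤ q * (q : ℚ) ^ (2 * t + 2) := by gcongr
      _ = (q : ℚ) ^ (2 * t + 3) := by ring
      _ ≤ _ := pow_le_pow_right₀ (by linarith) (by omega)
  have h4 := extCount_nonneg hq n k₂ (t + 1)
  have h5 := extCount_nonneg hq n k₁ (t + 1)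
  have h3 : extCount q n k₂ (t + 1) ≤ (1 - margin q t) * extCount q n k₂ t := by
    have e : 1 - margin q t = 1 / (2 * (q : ℚ) ^ (2 * t + 2)) := by unfold margin; ring
    rw [e, one_div_mul_eq_div, le_div_iff₀ (by positivity)]
    exact le_trans (mul_le_mul_of_nonneg_left h2 h4) h1
  have h8 := gaussBinom_nonneg hq (t + 1) 1
  calc _ = extCount q n k₁ (t + 1)
        * (gaussBinom q (t + 1) 1 * (margin q t * extCount q n k₂ t)) := by ring
    _ ≤ _ := by
      refine mul_le_mul_of_nonneg_left ?_ h5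
      refine le_add_of_le_of_nonneg (mul_le_mul_of_nonneg_left ?_ h8) h4
      linarith

theorem boundCD_le {n k₁ k₂ t : ℕ} (hk₁ : t + 1 ≤ k₁) (hk₂ : t + 1 ≤ k₂) (hn : t + 1 ≤ n) :
    boundCD q n k₁ k₂ t
      ≤ gaussBinom q (t + 1) 1 * (extCount q n k₁ (t + 1) * extCount q n k₂ t) := by
  rw [boundCD_eq hq hk₁ hk₂ hn]
  have h1 := one_le_gaussBinom hq (by omega : 1 ≤ t + 1)
  have h4 := extCount_nonneg hq n k₂ (t + 1)
  have h5 := extCount_nonneg hq n k₁ (t + 1)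
  have : gaussBinom q (t + 1) 1 * (extCount q n k₂ t - extCount q n k₂ (t + 1))
        + extCount q n k₂ (t + 1) ≤ gaussBinom q (t + 1) 1 * extCount q n k₂ t := by
    nlinarith [mul_le_mul_of_nonneg_right h1 h4]
  calc _ ≤ _ := mul_le_mul_of_nonneg_left this h5
    _ = _ := by ring

/-- With a = k₁ - t, b = k₂ - t and n - t = a + b + c + 1, this compares the terms subtracted in the
two Hilton–Milner products. Up to elementary factors both are the q-multinomial coefficient of a, b,
c + 1. -/
theorem missCount_swap (a b c : ℕ) :
    (q : ℚ) ^ b * (gaussBinom q (a + b + c + 1) b * ((q : ℚ) ^ ((b + 1) * a) * gaussBinom q (a + c) a)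
        * ((q : ℚ) ^ (a + c + 1) - 1))
      = (q : ℚ) ^ a * (gaussBinom q (a + b + c + 1) a
        * ((q : ℚ) ^ ((a + 1) * b) * gaussBinom q (b + c) b) * ((q : ℚ) ^ (b + c + 1) - 1)) := by
  have h1 := gaussBinom_mul_gaussBinom_comm hq a b (c + 1)
  have h2 := gaussBinom_succ_mul hq (a + c) c
  have h3 := gaussBinom_succ_mul hq (b + c) c
  rw [gaussBinom_symm hq a c, add_assoc, gaussBinom_symm hq a (c + 1)] at h2
  rw [gaussBinom_symm hq b c, add_assoc, gaussBinom_symm hq b (c + 1)] at h3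
  rw [show a + (c + 1) + b = a + b + c + 1 by ring, show c + 1 + a = a + (c + 1) by ring,
    show b + (c + 1) + a = a + b + c + 1 by ring, show c + 1 + b = b + (c + 1) by ring] at h1
  rw [show (b + 1) * a = a * b + a by ring, show (a + 1) * b = a * b + b by ring, pow_add _ (a * b),
    pow_add _ (a * b), ← add_assoc] at *
  linear_combination (q : ℚ) ^ (a * b) * (q : ℚ) ^ b * (q : ℚ) ^ a
    * (((q : ℚ) ^ (c + 1) - 1) * h1 - gaussBinom q (a + b + c + 1) b * h2
      + gaussBinom q (a + b + c + 1) a * h3)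

/-- Exchanging the roles of the two families makes the Hilton–Milner product smaller. -/
theorem boundAB_swap_lt {n k₁ k₂ t : ℕ} (hk : k₂ < k₁) (hk₂ : t + 1 ≤ k₂) (ht : 1 ≤ t)
    (hn : k₁ + k₂ + t + 3 ≤ n) : boundAB q n k₂ k₁ t < boundAB q n k₁ k₂ t := by
  have hq' := two_le_cast_of_two_le hq
  have h0 := hitCount_le hq (n := n) (k := k₂) (t := t) (w := k₁ - t + 1) (by omega) (by omega)
    (by omega)
  have h1 := gaussBinom_mul_extCount_succ_le hq (n := n) (k := k₁) (l := k₂) (t := t) t (by omega)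
    (by omega)
  have h2 := hitCount_eq_sum hq (n := n) (k := k₁) (t := t) (w := k₂ - t + 1) (by omega) (by omega)
    (by omega)
  have h2' : 0 ≤ ∑ i ∈ Finset.range (k₂ - t + 1),
      (q : ℚ) ^ i * missCount q (k₁ - t - 1) (n - t - 1) i :=
    Finset.sum_nonneg fun i _ => mul_nonneg (by positivity) (missCount_nonneg hq _ _ _)
  rw [← h2] at h2'
  replace h1 := h0.trans h1
  rw [boundAB_eq (by omega), boundAB_eq (by omega)]
  rw [extCount_of_le (by omega : t ≤ k₂)] at *
  rw [extCount_of_le (by omega : t ≤ k₁)] at *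
  clear h0 h2
  obtain ⟨b, hb⟩ : ∃ b, k₂ - t = b + 1 := ⟨k₂ - t - 1, by omega⟩
  obtain ⟨d, hd⟩ : ∃ d, k₁ - t = b + 1 + d + 1 := ⟨k₁ - t - (b + 2), by omega⟩
  obtain ⟨c, hc⟩ : ∃ c, n - t = b + 1 + d + 1 + (b + 1) + c + 1 :=
    ⟨n - t - (b + 1 + d + 1 + (b + 1) + 1), by omega⟩
  have hct : 2 * t + 2 ≤ c := by omega
  rw [hb, hd, hc] at h1 h2' ⊢
  simp only [show b + 1 + d + 1 + (b + 1) + c + 1 - (b + 1 + d + 1 + 1) = b + 1 + c by omega,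
    show b + 1 + d + 1 + (b + 1) + c + 1 - (b + 1 + 1) = b + 1 + d + 1 + c by omega] at h1 h2' ⊢
  have key := missCount_swap hq (b + 1 + d + 1) (b + 1) c
  have hGa : (q : ℚ) ^ ((b + 1 + d + 1) * (b + 1 + c + 1))
      ≤ gaussBinom q (b + 1 + d + 1 + (b + 1) + c + 1) (b + 1 + d + 1) := by
    have := gaussBinom_pow_le hq (b + 1 + d + 1) (b + 1 + c + 1)
    rwa [show b + 1 + d + 1 + (b + 1 + c + 1) = b + 1 + d + 1 + (b + 1) + c + 1 by ring] at this
  have hGa1 := gaussBinom_pos hq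
    (by omega : b + 1 + d + 1 ≤ b + 1 + d + 1 + (b + 1) + c + 1)
  have hGb := gaussBinom_pos hq (by omega : b + 1 ≤ b + 1 + d + 1 + (b + 1) + c + 1)
  have heps : (q : ℚ) ^ (b + 1 + d + 1 + 1) * gaussBinom q t 1
      * ((q : ℚ) ^ (b + 1 + d + 1 + c + 1) - 1)
      ≤ gaussBinom q (b + 1 + d + 1 + (b + 1) + c + 1) (b + 1 + d + 1) := by
    refine le_trans ?_ hGa
    have e1 : gaussBinom q t 1 ≤ (q : ℚ) ^ t := by
      nlinarith [gaussBinom_one_le_pow hq t, gaussBinom_nonneg hq t 1]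
    calc _ ≤ (q : ℚ) ^ (b + 1 + d + 1 + 1) * (q : ℚ) ^ t * (q : ℚ) ^ (b + 1 + d + 1 + c + 1) := by
          have := gaussBinom_nonneg hq t 1
          have := (pow_succ_sub_one_pos hq (b + 1 + d + 1 + c)).le
          gcongr
          linarith
      _ ≤ _ := by
          rw [← pow_add, ← pow_add]
          refine pow_le_pow_right₀ (by linarith) ?_
          nlinarith
  have hP := pow_succ_sub_one_pos hq (b + 1 + d + 1 + c)
  have hdq : (2 : ℚ) ≤ (q : ℚ) ^ (d + 1) :=
    hq'.trans (le_self_pow₀ (by linarith) (by omega))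
  have hdec := decay_le hq ht
  have hε : 0 ≤ (q : ℚ) ^ (b + 1 + 1) * gaussBinom q t 1 :=
    mul_nonneg (by positivity) (gaussBinom_nonneg hq _ _)
  have hε' : 0 ≤ (q : ℚ) ^ (b + 1 + d + 1 + 1) * gaussBinom q t 1 :=
    mul_nonneg (by positivity) (gaussBinom_nonneg hq _ _)
  have key2 : gaussBinom q (b + 1 + d + 1 + (b + 1) + c + 1) (b + 1)
      * ((q : ℚ) ^ ((b + 1 + 1) * (b + 1 + d + 1)) * gaussBinom q (b + 1 + d + 1 + c) (b + 1 + d + 1))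
        * ((q : ℚ) ^ (b + 1 + d + 1 + c + 1) - 1)
      = gaussBinom q (b + 1 + d + 1 + (b + 1) + c + 1) (b + 1 + d + 1)
        * ((q : ℚ) ^ ((b + 1 + d + 1 + 1) * (b + 1)) * gaussBinom q (b + 1 + c) (b + 1))
        * ((q : ℚ) ^ (b + 1 + d + 1 + c + 1) - (q : ℚ) ^ (d + 1)) := by
    refine mul_left_cancel₀ (by positivity : (q : ℚ) ^ (b + 1) ≠ 0) ?_
    linear_combination key
  -- What remains is (Gb - U')(Ga + ε') < (Ga - U)(Gb + ε). The right side minus the left is (U' Ga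
  -- - U Gb) - (Gb - U') ε' + (Ga - U) ε. The last term is nonnegative. By `key2`, the first term
  -- times y - 1 equals U' Ga (x - 1) with x = q^(k₁-k₂) ≥ 2, and this outweighs the middle one.
  clear key hGa hct hc hd hb hk hn hk₂
  generalize gaussBinom q (b + 1 + d + 1 + (b + 1) + c + 1) (b + 1 + d + 1) = Ga at *
  generalize gaussBinom q (b + 1 + d + 1 + (b + 1) + c + 1) (b + 1) = Gb at *
  generalize (q : ℚ) ^ ((b + 1 + d + 1 + 1) * (b + 1)) * gaussBinom q (b + 1 + c) (b + 1) = U' at *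
  generalize (q : ℚ) ^ ((b + 1 + 1) * (b + 1 + d + 1))
    * gaussBinom q (b + 1 + d + 1 + c) (b + 1 + d + 1) = U at *
  generalize (q : ℚ) ^ (b + 1 + d + 1 + 1) * gaussBinom q t 1 = ε' at *
  generalize (q : ℚ) ^ (b + 1 + 1) * gaussBinom q t 1 = ε at *
  generalize (q : ℚ) ^ (b + 1 + d + 1 + c + 1) = y at *
  generalize (q : ℚ) ^ (d + 1) = x at *
  have hU' : Gb - U' ≤ 1 / 16 * Gb := h1.trans (by gcongr)
  have hGa0 := hGa1.le
  have s1 : (15 / 16 * Gb) * Ga ≤ (U' * Ga - U * Gb) * (y - 1) := by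
    have e : (U' * Ga - U * Gb) * (y - 1) = U' * Ga * (x - 1) := by linear_combination -key2
    rw [e]
    have : 15 / 16 * Gb ≤ U' := by linarith
    calc _ ≤ U' * Ga := by gcongr
      _ ≤ _ := le_mul_of_one_le_right (mul_nonneg (by linarith) hGa0) (by linarith)
  have s2 : (Gb - U') * ε' * (y - 1) ≤ 1 / 16 * Gb * Ga := by
    calc (Gb - U') * ε' * (y - 1) = (Gb - U') * (ε' * (y - 1)) := by ring
      _ ≤ 1 / 16 * Gb * (ε' * (y - 1)) := mul_le_mul_of_nonneg_right hU' (mul_nonneg hε' hP.le)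
      _ ≤ _ := by gcongr
  have s3 : 0 < (U' * Ga - U * Gb) - (Gb - U') * ε' := by
    refine (mul_pos_iff_of_pos_right hP).1 ?_
    nlinarith [mul_pos hGb hGa1]
  nlinarith [mul_nonneg h2' hε]

/-- Here k₂ = 2t, so the leading terms agree. With C, C₂ the extension counts for s = 2, 3 and B =
e(2, 1), the claim reduces to C (q² + q + 1) < C₂ (B + q²). Since q³ - 1 = (q - 1)(q² + q + 1), the
condition k - 2 ≥ 3 suffices; the excluded triples are those with k₁ ≤ 4. -/
theorem boundAB_lt_boundCD_one {n k : ℕ} (hk : 5 ≤ k) (hn : k < n) :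
    boundAB q n k 2 1 < boundCD q n k 2 1 := by
  have hq' := two_le_cast_of_two_le hq
  rw [boundAB_eq (by omega), boundCD_eq hq (by omega) (by omega) (by omega),
    hitCount_eq_sum hq (by omega) (by omega) (by omega)]
  have e0 : missCount q (k - 1 - 1) (n - 1 - 1) 0 = extCount q n k (1 + 1) := by
    rw [missCount_zero, extCount_of_le (by omega)]
    simp only [Nat.sub_sub]
  have e1 : missCount q (k - 1 - 1) (n - 1 - 1) 0 - missCount q (k - 1 - 1) (n - 1 - 1) 1
      = extCount q n k (1 + 2) := by
    have := missCount_sub_succ hq (K := k - 3) (N := n - 3) (i := 0) (by omega)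
    rw [show k - 3 + 1 = k - 1 - 1 by omega, show n - 3 + 1 = n - 1 - 1 by omega, missCount_zero,
      pow_zero, one_mul, zero_add, missCount_zero] at this
    rw [extCount_of_le (by omega), missCount_zero, this]
  have h1 := extCount_succ_mul hq (n := n) (l := k) (s := 1 + 1) (by omega) (by omega)
  have hB : extCount q n 2 1 * ((q : ℚ) - 1) = (q : ℚ) ^ (n - 1) - 1 := by
    rw [extCount_of_le (by omega)]; exact gaussBinom_one_mul hq (n - 1)
  have hC := extCount_pos hq (n := n) (l := k) (s := 1 + 1) (by omega) (by omega)
  have hC2 := extCount_nonneg hq n k (1 + 2)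
  have hpow : (q : ℚ) ^ 3 ≤ (q : ℚ) ^ (k - (1 + 1)) := pow_le_pow_right₀ (by linarith) (by omega)
  have hg : gaussBinom q (1 + 1) 1 = q + 1 := by
    rw [gaussBinom_one_succ hq, gaussBinom_self hq, mul_one]
  have hsplit : (q : ℚ) ^ (n - 1) = q * (q : ℚ) ^ (n - (1 + 1)) := by
    rw [← pow_succ']; congr 1; omega
  simp only [show 2 - 1 + 1 = 2 by norm_num, Finset.sum_range_succ, Finset.sum_range_zero, hg,
    gaussBinom_self hq, pow_zero, pow_one, one_mul, zero_add, mul_one,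
    show extCount q n 2 (1 + 1) = 1 from extCount_self q n 2,
    show 1 + 1 + 1 = 1 + 2 by norm_num] at *
  rw [show missCount q (k - 1 - 1) (n - 1 - 1) 1 = extCount q n k (1 + 1) - extCount q n k (1 + 2) by
    linarith, e0]
  generalize extCount q n k (1 + 1) = C at *
  generalize extCount q n k (1 + 2) = C₂ at *
  generalize extCount q n 2 1 = B at *
  generalize (q : ℚ) ^ (n - (1 + 1)) = w at *
  generalize (q : ℚ) = x at *
  have h3 : C * (x ^ 2 + x + 1) ≤ C₂ * B / x := by
    rw [le_div_iff₀ (by linarith)]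
    refine le_of_mul_le_mul_right ?_ (by linarith : 0 < x - 1)
    calc C * (x ^ 2 + x + 1) * x * (x - 1) = x * (C * (x ^ 3 - 1)) := by ring
      _ ≤ x * (C * (x ^ (k - (1 + 1)) - 1)) := by gcongr
      _ = C₂ * (x * w - x) := by rw [← h1]; ring
      _ ≤ C₂ * (x ^ (n - 1) - 1) := by rw [hsplit]; gcongr; linarith
      _ = C₂ * B * (x - 1) := by rw [← hB]; ring
  rw [le_div_iff₀ (by linarith)] at h3
  have h4 : C * (x ^ 2 + x + 1) < C * (x ^ 2 + x + 1) * x := by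
    have : 0 < C * (x ^ 2 + x + 1) := by positivity
    nlinarith
  have h5 : 0 ≤ x * C₂ * x ^ 2 := by positivity
  have h6 : C * (x ^ 2 + x + 1) * x < C₂ * B * x := by
    refine mul_lt_mul_of_pos_right (h4.trans_le h3) (by linarith)
  nlinarith

/-- Again both leading terms are θ C B, where θ = θ_(t+1), C = e(k, t+1) and B = e(2t, t). At second
order the C, D product loses (θ - 1) C d with d = e(2t, t+1), and the A, B product loses at least
2(θ - 1) C₂ B with C₂ = e(k, t+2). The latter is at least 4/3 of the former, and the surplus third
absorbs the few extra members of B. -/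
theorem boundAB_lt_boundCD_two_mul {n k t : ℕ} (ht : 2 ≤ t) (hk : 2 * t ≤ k)
    (hn : k + 2 * t + t + 3 ≤ n) :
    boundAB q n k (2 * t) t < boundCD q n k (2 * t) t := by
  have hq' := two_le_cast_of_two_le hq
  have e0 : missCount q (k - t - 1) (n - t - 1) 0 = extCount q n k (t + 1) := by
    rw [missCount_zero, extCount_of_le (by omega)]
    simp only [Nat.sub_sub]
  have hs := fun i (hi : i ≤ n - t - 2) =>
    missCount_sub_succ hq (K := k - t - 2) (N := n - t - 2) (i := i) hi
  rw [show k - t - 2 + 1 = k - t - 1 by omega, show n - t - 2 + 1 = n - t - 1 by omega] at hs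
  have e1 := hs 0 (by omega)
  have e2 := hs 1 (by omega)
  rw [missCount_zero (k - t - 2), pow_zero, one_mul, zero_add] at e1
  rw [show gaussBinom q (n - t - 2) (k - t - 2) = extCount q n k (t + 2) by
    rw [extCount_of_le (by omega)]; simp only [Nat.sub_sub]] at e1
  have e3 := extCount_sub_le_missCount hq (n := n) (k := k) (t := t + 1) (i := 1) (by omega)
    (by omega) (by omega)
  rw [gaussBinom_self hq, one_mul, show k - (t + 1) - 1 = k - t - 2 by omega,
    show n - (t + 1) - 1 = n - t - 2 by omega] at e3
  have e4 := extCount_succ_mul_pow_le hq (n := n) (l := k) (t + 2) (by omega)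
  have e5 : (64 : ℚ) ≤ (q : ℚ) ^ (n - k) := by
    calc (64 : ℚ) = 2 ^ 6 := by norm_num
      _ ≤ (q : ℚ) ^ 6 := by gcongr
      _ ≤ _ := pow_le_pow_right₀ (by linarith) (by omega)
  have hC := extCount_pos hq (n := n) (l := k) (s := t + 1) (by omega) (by omega)
  have hC2 := extCount_nonneg hq n k (t + 2)
  have hC3 := extCount_nonneg hq n k (t + 3)
  simp only [show t + 1 + 1 = t + 2 by ring, show t + 1 + 2 = t + 3 by ring, show 1 + 1 = 2 by norm_num, pow_one] at e2 e3 e4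
  have e6 : extCount q n k (t + 3) ≤ 1 / 64 * extCount q n k (t + 2) := by
    nlinarith [mul_le_mul_of_nonneg_left e5 hC3]
  have hA : gaussBinom q (n - t) (k - t) - (q : ℚ) ^ ((2 * t - t + 1) * (k - t))
          * gaussBinom q (n - t - (2 * t - t + 1)) (k - t)
      ≤ gaussBinom q (t + 1) 1 * extCount q n k (t + 1)
        - 2 * (gaussBinom q (t + 1) 1 - 1) * extCount q n k (t + 2) := by
    rw [hitCount_eq_sum hq (by omega) (by omega) (by omega), show 2 * t - t + 1 = t + 1 by omega]
    obtain ⟨s, rfl⟩ := Nat.exists_eq_add_of_le' ht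
    rw [Finset.sum_range_succ', Finset.sum_range_succ', gaussBinom_one_succ hq,
      gaussBinom_one_succ hq]
    have hsum : ∑ i ∈ Finset.range (s + 1), (q : ℚ) ^ (i + 1 + 1)
        * missCount q (k - (s + 2) - 1) (n - (s + 2) - 1) (i + 1 + 1)
        ≤ (q : ℚ) ^ 2 * gaussBinom q (s + 1) 1
          * missCount q (k - (s + 2) - 1) (n - (s + 2) - 1) 2 := by
      rw [gaussBinom_one_eq_sum hq, Finset.mul_sum, Finset.sum_mul]
      refine Finset.sum_le_sum fun i hi => ?_
      have := Finset.mem_range.1 hi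
      rw [show (q : ℚ) ^ (i + 1 + 1) = q ^ 2 * q ^ i by ring]
      exact mul_le_mul_of_nonneg_left (missCount_antitone hq (by omega) (by omega)) (by positivity)
    have hm := one_le_gaussBinom hq (by omega : 1 ≤ s + 1)
    simp only [zero_add, pow_zero, pow_one, one_mul]
    rw [e0] at *
    set m := gaussBinom q (s + 1) 1
    have hf1 : missCount q (k - (s + 2) - 1) (n - (s + 2) - 1) 1
      = extCount q n k (s + 2 + 1) - extCount q n k (s + 2 + 2) := by linarith
    have hf2 : missCount q (k - (s + 2) - 1) (n - (s + 2) - 1) 2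
      ≤ extCount q n k (s + 2 + 1) - extCount q n k (s + 2 + 2)
        - q * (63 / 64 * extCount q n k (s + 2 + 2)) := by
      have : (q : ℚ) * (63 / 64 * extCount q n k (s + 2 + 2))
        ≤ q * missCount q (k - (s + 2) - 2) (n - (s + 2) - 2) 1 := by gcongr; linarith
      linarith
    rw [hf1]
    have h7 : (q : ℚ) ^ 2 * m * missCount q (k - (s + 2) - 1) (n - (s + 2) - 1) 2
      ≤ (q : ℚ) ^ 2 * m * (extCount q n k (s + 2 + 1) - extCount q n k (s + 2 + 2)
        - q * (63 / 64 * extCount q n k (s + 2 + 2))) := by gcongr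
    generalize extCount q n k (s + 2 + 1) = C at *
    generalize extCount q n k (s + 2 + 2) = C₂ at *
    generalize (q : ℚ) = x at *
    -- The losses of C₂ are q from i = 1 and at least q² m (1 + 63q/64) from i ≥ 2. This inequality
    -- makes their sum at least 2(q + q² m) = 2(θ_(t+1) - 1).
    have h8 : x ^ 2 * m + x ≤ 63 / 64 * (x ^ 3 * m) := by
      have a1 : 2 * (x ^ 2 * m) ≤ x ^ 3 * m := by
        rw [show x ^ 3 * m = x * (x ^ 2 * m) by ring]; gcongr
      have a2 : 2 * x ≤ x ^ 2 * m := by nlinarith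
      linarith
    nlinarith [mul_le_mul_of_nonneg_right h8 hC2]
  have c1 := extCount_succ_mul hq (n := n) (l := k) (s := t + 1) (by omega) (by omega)
  have c2 := extCount_succ_mul hq (n := n) (l := 2 * t) (s := t) (by omega) (by omega)
  have hB0 := extCount_nonneg hq n (2 * t) t
  have hd1 := extCount_nonneg hq n (2 * t) (t + 1)
  have hW : (0 : ℚ) < (q : ℚ) ^ (n - (t + 1)) - 1 := by
    have := pow_succ_sub_one_pos hq (n - (t + 2))
    rwa [show n - (t + 2) + 1 = n - (t + 1) by omega] at this
  have hratio : 2 * (extCount q n k (t + 1) * extCount q n (2 * t) (t + 1))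
      ≤ 3 * (extCount q n k (t + 2) * extCount q n (2 * t) t) := by
    have a1 : (q : ℚ) ^ (n - t) = q * (q : ℚ) ^ (n - (t + 1)) := by
      rw [← pow_succ']; congr 1; omega
    have a2 : (q : ℚ) ^ t ≤ q * (q : ℚ) ^ (k - (t + 1)) := by
      rw [← pow_succ']; exact pow_le_pow_right₀ (by linarith) (by omega)
    have a3 : (q : ℚ) ^ 2 ≤ (q : ℚ) ^ t := pow_le_pow_right₀ (by linarith) ht
    rw [show 2 * t - t = t by omega, a1] at c2
    rw [show t + 1 + 1 = t + 2 by ring] at c1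
    generalize (q : ℚ) ^ (k - (t + 1)) = u at *
    generalize (q : ℚ) ^ (n - (t + 1)) = w at *
    generalize (q : ℚ) ^ t = y at *
    generalize extCount q n k (t + 1) = C at *
    generalize extCount q n k (t + 2) = C₂ at *
    generalize extCount q n (2 * t) (t + 1) = d at *
    generalize extCount q n (2 * t) t = B at *
    generalize (q : ℚ) = x at *
    refine le_of_mul_le_mul_right ?_ (mul_pos (by linarith : 0 < x) hW)
    have b1 : d * (x * (w - 1)) ≤ B * (y - 1) := by
      rw [← c2]; gcongr; linarith
    -- After y ≤ x u and y ≥ x², what is left is (x - 1)(x - 2) ≥ 0; this is where t ≥ 2 enters.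
    have b2 : 2 * (y - 1) ≤ 3 * (x * (u - 1)) := by nlinarith
    calc 2 * (C * d) * (x * (w - 1)) = 2 * C * (d * (x * (w - 1))) := by ring
      _ ≤ 2 * C * (B * (y - 1)) := by gcongr
      _ = C * B * (2 * (y - 1)) := by ring
      _ ≤ C * B * (3 * (x * (u - 1))) := by gcongr
      _ = 3 * (C₂ * B) * (x * (w - 1)) := by linear_combination (-3) * B * x * c1
  have hε : 8 * ((q : ℚ) ^ (t + 1) * gaussBinom q t 1) ≤ extCount q n (2 * t) (t + 1) := by
    have a1 := extCount_succ_mul_pow_le hq (n := n) (l := 2 * t) (t + 1) (by omega)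
    have a2 : 1 ≤ extCount q n (2 * t) (t + 1 + 1) := by
      rw [extCount_of_le (by omega)]; exact one_le_gaussBinom hq (by omega)
    have a3 : gaussBinom q t 1 ≤ (q : ℚ) ^ t := by
      nlinarith [gaussBinom_one_le_pow hq t, gaussBinom_nonneg hq t 1]
    calc 8 * ((q : ℚ) ^ (t + 1) * gaussBinom q t 1)
        ≤ 2 ^ 3 * ((q : ℚ) ^ (t + 1) * (q : ℚ) ^ t) := by
          norm_num only
          gcongr
      _ ≤ (q : ℚ) ^ 3 * ((q : ℚ) ^ (t + 1) * (q : ℚ) ^ t) := by gcongr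
      _ = (q : ℚ) ^ (2 * t + 4) := by ring
      _ ≤ (q : ℚ) ^ (n - 2 * t) := pow_le_pow_right₀ (by linarith) (by omega)
      _ ≤ extCount q n (2 * t) (t + 1 + 1) * (q : ℚ) ^ (n - 2 * t) :=
        le_mul_of_one_le_left (by positivity) a2
      _ ≤ _ := a1
  have hθ : 3 ≤ gaussBinom q (t + 1) 1 := by
    have := gaussBinom_one_mono hq (by omega : 2 ≤ t + 1)
    rw [gaussBinom_one_succ hq, gaussBinom_self hq] at this
    linarith
  have hd2 := extCount_pos hq (n := n) (l := 2 * t) (s := t + 1) (by omega) (by omega)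
  rw [boundAB_eq (by omega), boundCD_eq hq (by omega) (by omega) (by omega)]
  have hε0 : 0 ≤ (q : ℚ) ^ (t + 1) * gaussBinom q t 1 :=
    mul_nonneg (by positivity) (gaussBinom_nonneg hq _ _)
  rw [show 2 * t - t + 1 = t + 1 by omega] at *
  refine lt_of_le_of_lt (mul_le_mul_of_nonneg_right hA (by linarith)) ?_
  clear hA e0 e1 e2 e3 e4 e6 hs c1 c2 hC3
  generalize (q : ℚ) ^ (t + 1) * gaussBinom q t 1 = ε at *
  generalize gaussBinom q (t + 1) 1 = θ at *
  generalize extCount q n k (t + 1) = C at *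
  generalize extCount q n k (t + 2) = C₂ at *
  generalize extCount q n (2 * t) (t + 1) = d at *
  generalize extCount q n (2 * t) t = B at *
  have f1 : 0 ≤ 2 * (θ - 1) * C₂ * ε := by
    have : 0 ≤ θ - 1 := by linarith
    positivity
  have f2 : θ * C * ε < 1 / 3 * ((θ - 1) * (C * d)) := by
    have : θ * ε < 1 / 3 * ((θ - 1) * d) := by nlinarith
    nlinarith
  have f3 := mul_le_mul_of_nonneg_left hratio (by linarith : 0 ≤ θ - 1)
  nlinarith

/-- In the range `k₂ ≤ 2t` the second construction beats the Hilton–Milner one. -/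
theorem boundAB_lt_boundCD {n k₁ k₂ t : ℕ} (ht : 1 ≤ t) (hk : k₂ ≤ k₁) (hk₂ : t + 1 ≤ k₂)
    (hn : k₁ + k₂ + t + 3 ≤ n) (h₂ : (k₁, k₂, t) ≠ (2, 2, 1)) (h₃ : (k₁, k₂, t) ≠ (3, 2, 1))
    (h₄ : (k₁, k₂, t) ≠ (4, 2, 1)) (h : k₂ ≤ 2 * t) :
    boundAB q n k₁ k₂ t < boundCD q n k₁ k₂ t := by
  have hq' := two_le_cast_of_two_le hq
  have hE : 0 < extCount q n k₁ (t + 1) * extCount q n k₂ t :=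
    mul_pos (extCount_pos hq (by omega) (by omega)) (extCount_pos hq (by omega) (by omega))
  rcases h.eq_or_lt with rfl | h
  · rcases ht.eq_or_lt with rfl | ht'
    · refine boundAB_lt_boundCD_one hq ?_ (by omega)
      simp only [ne_eq, Prod.mk.injEq, mul_one, and_true] at h₂ h₃ h₄
      omega
    · exact boundAB_lt_boundCD_two_mul hq ht' hk hn
  -- For k₂ < 2t crude constants suffice: θ_(k₂-t+1) ≤ θ_(t+1)/2, the extra members of B cost a
  -- factor 9/8, and 9/16 < 7/8.
  · refine lt_of_lt_of_le ?_ (margin_mul_le_boundCD hq (by omega) hk₂ hn)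
    have h0 := hitCount_le hq (n := n) (k := k₁) (t := t) (w := k₂ - t + 1) (by omega) (by omega)
      (by omega)
    have h1 := pow_mul_extCount_le hq (k := k₁) (l := k₂) ht (by omega) hn
      (by omega : 2 ≤ k₂ - t + 1)
    rw [show t + (k₂ - t + 1) - 1 = k₂ by omega, extCount_self, mul_one] at h1
    have h2 := two_mul_gaussBinom_one_le hq (by omega : k₂ - t + 1 + 1 ≤ t + 1)
    rw [boundAB_eq (by omega)]
    have h3 := extCount_nonneg hq n k₂ t
    have h4 := extCount_nonneg hq n k₁ (t + 1)
    have h5 := gaussBinom_pos hq (by omega : 1 ≤ t + 1)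
    calc _ ≤ gaussBinom q (k₂ - t + 1) 1 * extCount q n k₁ (t + 1)
          * (extCount q n k₂ t + 1 / 8 * extCount q n k₂ t) := by
          refine mul_le_mul h0 (by linarith) ?_ ?_
          · exact add_nonneg h3 (mul_nonneg (by positivity) (gaussBinom_nonneg hq _ _))
          · exact mul_nonneg (gaussBinom_nonneg hq _ _) h4
      _ = 9 / 8 * gaussBinom q (k₂ - t + 1) 1
          * (extCount q n k₁ (t + 1) * extCount q n k₂ t) := by ring
      _ ≤ 9 / 16 * gaussBinom q (t + 1) 1
          * (extCount q n k₁ (t + 1) * extCount q n k₂ t) := by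
          refine mul_le_mul_of_nonneg_right ?_ hE.le
          linarith
      _ < 7 / 8 * gaussBinom q (t + 1) 1
          * (extCount q n k₁ (t + 1) * extCount q n k₂ t) := by
          refine mul_lt_mul_of_pos_right ?_ hE
          linarith
      _ ≤ _ := by
          rw [mul_assoc]
          have := margin_ge hq t
          gcongr

end ExtremalBounds
-- Counting subspaces over a finite field
theorem gaussBinom_mul_prod_sub {q : ℕ} (hq : 2 ≤ q) (m k : ℕ) :
    gaussBinom q m k * ∏ i ∈ Finset.range k, ((q : ℚ) ^ k - (q : ℚ) ^ i)
      = ∏ i ∈ Finset.range k, ((q : ℚ) ^ m - (q : ℚ) ^ i) := by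
  induction k with
  | zero => simp
  | succ k ih =>
    rw [Finset.prod_range_succ', Finset.prod_range_succ _ k, ← ih]
    have : ∏ i ∈ Finset.range k, ((q : ℚ) ^ (k + 1) - (q : ℚ) ^ (i + 1))
        = (q : ℚ) ^ k * ∏ i ∈ Finset.range k, ((q : ℚ) ^ k - (q : ℚ) ^ i) := by
      have e : (q : ℚ) ^ k = ∏ _i ∈ Finset.range k, (q : ℚ) := by simp
      conv_rhs => rw [e, ← Finset.prod_mul_distrib, ← e]
      exact Finset.prod_congr rfl fun i _ => by ring
    rw [this]
    linear_combination (∏ i ∈ Finset.range k, ((q : ℚ) ^ k - (q : ℚ) ^ i))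
      * gaussBinom_mul_succ hq m k

section Counting

variable {K V : Type*} [Field K] [AddCommGroup V] [Module K V]

theorem Submodule.mkQ_surjInv (W : Submodule K V) (x : V ⧸ W) :
    W.mkQ (Function.surjInv W.mkQ_surjective x) = x :=
  Function.surjInv_eq W.mkQ_surjective x

/-- Splitting vectors along a section of the quotient map. -/
noncomputable def Submodule.equivQuotientProd (W : Submodule K V) : V ≃ (V ⧸ W) × W where
  toFun v := (W.mkQ v, ⟨v - Function.surjInv W.mkQ_surjective (W.mkQ v), by
    rw [← Submodule.Quotient.mk_eq_zero W, ← Submodule.mkQ_apply, map_sub, Submodule.mkQ_surjInv,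
      sub_self]⟩)
  invFun p := Function.surjInv W.mkQ_surjective p.1 + p.2
  left_inv v := by simp
  right_inv p := by
    have h : W.mkQ (Function.surjInv W.mkQ_surjective p.1 + p.2) = p.1 := by
      rw [map_add, Submodule.mkQ_surjInv, Submodule.mkQ_apply,
        (Submodule.Quotient.mk_eq_zero W).2 p.2.2, add_zero]
    ext
    · exact h
    · simp only [h]; simp

/-- Tuples that are independent modulo `W` consist of an independent tuple in the quotient and
an arbitrary tuple in `W`. -/
noncomputable def linearIndependentModEquiv (W : Submodule K V) (k : ℕ) :
    {s : Fin k → V // LinearIndependent K (W.mkQ ∘ s)}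
      ≃ {s : Fin k → V ⧸ W // LinearIndependent K s} × (Fin k → W) where
  toFun s := (⟨W.mkQ ∘ s.1, s.2⟩, fun i => (W.equivQuotientProd (s.1 i)).2)
  invFun p := ⟨fun i => W.equivQuotientProd.symm (p.1.1 i, p.2 i), by
    have : W.mkQ ∘ (fun i => W.equivQuotientProd.symm (p.1.1 i, p.2 i)) = p.1.1 := by
      funext i
      exact congrArg Prod.fst (W.equivQuotientProd.apply_symm_apply (p.1.1 i, p.2 i))
    rw [this]; exact p.1.2⟩
  left_inv s := by
    ext i
    exact W.equivQuotientProd.symm_apply_apply (s.1 i)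
  right_inv p := by
    ext i
    · exact congrArg Prod.fst (W.equivQuotientProd.apply_symm_apply (p.1.1 i, p.2 i))
    · exact congrArg (fun x => (x.2 : V)) (W.equivQuotientProd.apply_symm_apply (p.1.1 i, p.2 i))

/-- The span of a tuple that is independent modulo `W`. -/
def spanOfIndependentMod (W : Submodule K V) (k : ℕ)
    (s : {s : Fin k → V // LinearIndependent K (W.mkQ ∘ s)}) :
    {F : Submodule K V // finrank K F = k ∧ Disjoint F W} :=
  ⟨Submodule.span K (Set.range s.1), by
    refine ⟨by rw [finrank_span_eq_card (LinearIndependent.of_comp _ s.2), Fintype.card_fin], ?_⟩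
    have := Submodule.range_ker_disjoint s.2
    rwa [Submodule.ker_mkQ] at this⟩

/-- The tuples with a given span are the independent tuples of the span. -/
def spanFiberEquiv [FiniteDimensional K V] (W : Submodule K V) (k : ℕ)
    (F : {F : Submodule K V // finrank K F = k ∧ Disjoint F W}) :
    {s // spanOfIndependentMod W k s = F} ≃ {s : Fin k → F.1 // LinearIndependent K s} where
  toFun s := ⟨fun i => ⟨s.1.1 i, by
      have h : Submodule.span K (Set.range s.1.1) = F.1 := congrArg Subtype.val s.2
      rw [← h]; exact Submodule.subset_span ⟨i, rfl⟩⟩, by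
    have h := LinearIndependent.of_comp _ s.1.2
    exact LinearIndependent.of_comp F.1.subtype h⟩
  invFun s := ⟨⟨fun i => s.1 i, by
      have h : LinearIndependent K (F.1.subtype ∘ s.1) :=
        s.2.map' _ (Submodule.ker_subtype _)
      refine h.map ?_
      rw [Submodule.ker_mkQ]
      refine F.2.2.mono_left ?_
      rw [Submodule.span_le]
      rintro _ ⟨i, rfl⟩
      exact (s.1 i).2⟩, by
    have h : LinearIndependent K (F.1.subtype ∘ s.1) := s.2.map' _ (Submodule.ker_subtype _)
    apply Subtype.ext
    refine Submodule.eq_of_le_of_finrank_eq ?_ ?_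
    · simp only [spanOfIndependentMod]
      rw [Submodule.span_le]
      rintro _ ⟨i, rfl⟩
      exact (s.1 i).2
    · exact (finrank_span_eq_card h).trans ((Fintype.card_fin k).trans F.2.1.symm)⟩
  left_inv s := rfl
  right_inv s := rfl

variable [Finite K] [FiniteDimensional K V]

instance finite_submodule_of_finite_field : Finite (Submodule K V) :=
  have := Module.finite_of_finite K (M := V)
  inferInstance

theorem natCard_linearIndependent {k : ℕ} (hk : k ≤ finrank K V) :
    Nat.card {s : Fin k → V // LinearIndependent K s}
      = ∏ i ∈ Finset.range k, (Nat.card K ^ finrank K V - Nat.card K ^ i) := by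
  have := Module.finite_of_finite K (M := V)
  have := Fintype.ofFinite K
  rw [card_linearIndependent hk, Nat.card_eq_fintype_card, Finset.prod_range]

theorem two_le_natCard : 2 ≤ Nat.card K := Finite.one_lt_card

/-- Double count of the k-tuples independent modulo W: by their span, each fibre being the ordered
bases of the span, and by their image in the quotient together with a free choice of k vectors of W.
-/
theorem natCard_disjoint_mul (W : Submodule K V) {k : ℕ} (hk : k ≤ finrank K (V ⧸ W)) :
    Nat.card {F : Submodule K V // finrank K F = k ∧ Disjoint F W}
        * ∏ i ∈ Finset.range k, (Nat.card K ^ k - Nat.card K ^ i)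
      = (∏ i ∈ Finset.range k, (Nat.card K ^ finrank K (V ⧸ W) - Nat.card K ^ i))
        * Nat.card K ^ (finrank K W * k) := by
  have := Module.finite_of_finite K (M := V)
  have e1 := Nat.card_congr (linearIndependentModEquiv W k)
  have e2 := Nat.card_congr (Equiv.sigmaFiberEquiv (spanOfIndependentMod W k)).symm
  have := Fintype.ofFinite {F : Submodule K V // finrank K F = k ∧ Disjoint F W}
  rw [Nat.card_prod, natCard_linearIndependent hk, Nat.card_fun, Nat.card_eq_fintype_card (α := Fin k),
    Fintype.card_fin, Module.natCard_eq_pow_finrank (K := K) (V := W), ← pow_mul, e2,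
    Nat.card_sigma] at e1
  rw [← e1, Finset.sum_congr rfl fun F _ => (Nat.card_congr (spanFiberEquiv W k F)).trans
    (natCard_linearIndependent F.2.1.ge)]
  rw [Finset.sum_congr rfl fun F _ => by rw [F.2.1]]
  rw [Finset.sum_const, Finset.card_univ, smul_eq_mul, Nat.card_eq_fintype_card]

theorem ncard_disjoint (W : Submodule K V) (k : ℕ) :
    ({F : Submodule K V | finrank K F = k ∧ Disjoint F W}.ncard : ℚ)
      = (Nat.card K : ℚ) ^ (finrank K W * k)
        * gaussBinom (Nat.card K) (finrank K V - finrank K W) k := by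
  have hq := two_le_natCard (K := K)
  have hq' := one_lt_cast_of_two_le hq
  have hN : finrank K (V ⧸ W) = finrank K V - finrank K W := by
    have := W.finrank_quotient_add_finrank; omega
  rw [← Nat.card_coe_set_eq]
  rcases lt_or_ge (finrank K V - finrank K W) k with h | h
  · rw [gaussBinom_eq_zero _ h, mul_zero, Nat.cast_eq_zero, Nat.card_eq_zero]
    left
    refine ⟨fun F => ?_⟩
    have := Submodule.finrank_add_finrank_le_of_disjoint F.2.2
    have := F.2.1
    omega
  · have hc := natCard_disjoint_mul W (h.trans_eq hN.symm)
    have hcast : ∀ m, k ≤ m → ((∏ i ∈ Finset.range k, (Nat.card K ^ m - Nat.card K ^ i) : ℕ) : ℚ)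
        = ∏ i ∈ Finset.range k, ((Nat.card K : ℚ) ^ m - (Nat.card K : ℚ) ^ i) := by
      intro m hm
      rw [Nat.cast_prod]
      refine Finset.prod_congr rfl fun i hi => ?_
      rw [Nat.cast_sub (Nat.pow_le_pow_right (by omega)
        ((Finset.mem_range.1 hi).le.trans hm))]
      push_cast; rfl
    have hpos : (0 : ℚ) < ∏ i ∈ Finset.range k, ((Nat.card K : ℚ) ^ k - (Nat.card K : ℚ) ^ i) :=
      Finset.prod_pos fun i hi => sub_pos.2 (pow_lt_pow_right₀ hq' (Finset.mem_range.1 hi))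
    refine mul_right_cancel₀ hpos.ne' ?_
    have hc' := congrArg (Nat.cast : ℕ → ℚ) hc
    rw [Nat.cast_mul, hcast k le_rfl, Nat.cast_mul, hcast _ (h.trans_eq hN.symm), hN,
      ← gaussBinom_mul_prod_sub hq (finrank K V - finrank K W)] at hc'
    refine hc'.trans ?_
    push_cast
    ring

/-- The number of subspaces through `S` that meet `M` only in `S`. -/
theorem ncard_inf_eq {S M : Submodule K V} (hSM : S ≤ M) {k : ℕ} (hk : finrank K S ≤ k) :
    ({F : Submodule K V | finrank K F = k ∧ S ≤ F ∧ F ⊓ M = S}.ncard : ℚ)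
      = (Nat.card K : ℚ) ^ ((finrank K M - finrank K S) * (k - finrank K S))
        * gaussBinom (Nat.card K) (finrank K V - finrank K M) (k - finrank K S) := by
  have hdim : ∀ F : Submodule K V, S ≤ F →
      finrank K (F.map S.mkQ) + finrank K S = finrank K F := by
    intro F hF
    have := LinearMap.finrank_range_add_finrank_ker (S.mkQ.domRestrict F)
    rwa [LinearMap.range_domRestrict, LinearMap.ker_domRestrict, Submodule.ker_mkQ,
      (Submodule.comapSubtypeEquivOfLe hF).finrank_eq] at this
  have := ncard_disjoint (M.map S.mkQ) (k - finrank K S)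
  have h1 := hdim M hSM
  have h2 := S.finrank_quotient_add_finrank
  rw [show finrank K (M.map S.mkQ) = finrank K M - finrank K S by omega,
    show finrank K (V ⧸ S) - (finrank K M - finrank K S) = finrank K V - finrank K M by omega]
    at this
  rw [← this]
  congr 1
  symm
  have hmap : ∀ F : Submodule K (V ⧸ S), (F.comap S.mkQ).map S.mkQ = F := fun F =>
    Submodule.map_comap_eq_of_surjective S.mkQ_surjective F
  have hinj := Submodule.comap_injective_of_surjective S.mkQ_surjective
  have hdisj : ∀ F : Submodule K (V ⧸ S),
      Disjoint F (M.map S.mkQ) ↔ F.comap S.mkQ ⊓ M = S := by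
    intro F
    rw [disjoint_iff, ← hinj.eq_iff, Submodule.comap_inf, Submodule.comap_map_mkQ,
      sup_eq_right.2 hSM, Submodule.comap_bot, Submodule.ker_mkQ]
  refine Set.ncard_congr (fun F _ => F.comap S.mkQ) ?_ ?_ ?_
  · rintro F ⟨hF, hFM⟩
    have := hdim (F.comap S.mkQ) (S.le_comap_mkQ F)
    rw [hmap] at this
    exact ⟨by omega, S.le_comap_mkQ F, (hdisj F).1 hFM⟩
  · intro F G _ _ h
    exact hinj h
  · rintro F ⟨hF, hSF, hFM⟩
    have h3 : (F.map S.mkQ).comap S.mkQ = F := by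
      rw [Submodule.comap_map_mkQ, sup_eq_right.2 hSF]
    have := hdim F hSF
    exact ⟨F.map S.mkQ, ⟨by omega, (hdisj _).2 (by rw [h3, hFM])⟩, h3⟩

theorem ncard_ge (S : Submodule K V) (k : ℕ) :
    ({F : Submodule K V | finrank K F = k ∧ S ≤ F}.ncard : ℚ)
      = extCount (Nat.card K) (finrank K V) k (finrank K S) := by
  rcases le_or_gt (finrank K S) k with hk | hk
  · have := ncard_inf_eq (le_refl S) hk
    simpa [extCount_of_le hk] using this
  · rw [extCount_of_lt hk, Nat.cast_eq_zero, Set.ncard_eq_zero]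
    ext F
    simp only [Set.mem_ofPred_eq, Set.mem_empty_iff_false, iff_false, not_and]
    intro hF hS
    have := Submodule.finrank_mono hS
    omega

theorem ncard_Icc {S W : Submodule K V} (hSW : S ≤ W) (k : ℕ) :
    ({F : Submodule K V | finrank K F = k ∧ S ≤ F ∧ F ≤ W}.ncard : ℚ)
      = extCount (Nat.card K) (finrank K W) k (finrank K S) := by
  have := ncard_ge (S.comap W.subtype) k
  rw [show finrank K (S.comap W.subtype) = finrank K S from
    (Submodule.comapSubtypeEquivOfLe hSW).finrank_eq] at this
  rw [← this]
  congr 1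
  symm
  refine Set.ncard_congr (fun F _ => F.map W.subtype) ?_ ?_ ?_
  · rintro F ⟨hF, hSF⟩
    refine ⟨by rw [← hF]; exact Submodule.finrank_map_subtype_eq W F, ?_, ?_⟩
    · rw [← inf_eq_right.2 hSW, ← Submodule.map_comap_subtype]
      exact Submodule.map_mono hSF
    · exact Submodule.map_subtype_le W F
  · rintro F G - - h
    exact Submodule.map_injective_of_injective W.subtype_injective h
  · rintro F ⟨hF, hSF, hFW⟩
    refine ⟨F.comap W.subtype, ⟨?_, Submodule.comap_mono hSF⟩, ?_⟩
    · rw [(Submodule.comapSubtypeEquivOfLe hFW).finrank_eq, hF]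
    · rw [Submodule.map_comap_subtype, inf_eq_right.2 hFW]

theorem ncard_le (W : Submodule K V) (k : ℕ) :
    ({F : Submodule K V | finrank K F = k ∧ F ≤ W}.ncard : ℚ)
      = gaussBinom (Nat.card K) (finrank K W) k := by
  have := ncard_Icc (bot_le : ⊥ ≤ W) k
  simpa [extCount_of_le] using this

end Counting
-- Covers and the branching bound
section Covers

variable {K V : Type*} [Field K] [AddCommGroup V] [Module K V]

/-- `T` meets every member of `F` in dimension at least `t`. -/
def IsCover (t : ℕ) (T : Submodule K V) (F : Set (Submodule K V)) : Prop :=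
  ∀ A ∈ F, t ≤ finrank K (A ⊓ T : Submodule K V)

variable [Finite K] [FiniteDimensional K V]

theorem exists_finrank_eq_between {S W : Submodule K V} (h : S ≤ W) {d : ℕ}
    (h1 : finrank K S ≤ d) (h2 : d ≤ finrank K W) :
    ∃ U : Submodule K V, finrank K U = d ∧ S ≤ U ∧ U ≤ W := by
  have h3 := ncard_Icc h d
  have h4 := extCount_pos (two_le_natCard (K := K)) h1 h2
  rw [← h3, Nat.cast_pos, Set.ncard_pos] at h4
  exact h4

theorem exists_finrank_eq_inf_eq {S M : Submodule K V} (h : S ≤ M) {d : ℕ}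
    (h1 : finrank K S ≤ d) (h2 : finrank K M + d ≤ finrank K V + finrank K S) :
    ∃ U : Submodule K V, finrank K U = d ∧ S ≤ U ∧ U ⊓ M = S := by
  have h3 := ncard_inf_eq h h1
  have hq := two_le_natCard (K := K)
  have h5 := Submodule.finrank_le M
  have h4 := gaussBinom_pos hq
    (by omega : d - finrank K S ≤ finrank K V - finrank K M)
  have h6 : (0 : ℚ) < Nat.card K := by linarith [one_lt_cast_of_two_le hq]
  have h7 : (0 : ℚ) < ({F : Submodule K V | finrank K F = d ∧ S ≤ F ∧ F ⊓ M = S}.ncard : ℚ) := by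
    rw [h3]; positivity
  rw [Nat.cast_pos, Set.ncard_pos] at h7
  exact h7

theorem cast_ncard_mono {G G' : Set (Submodule K V)} (h : G ⊆ G') :
    (G.ncard : ℚ) ≤ G'.ncard := by
  exact_mod_cast Set.ncard_le_ncard h (Set.toFinite _)

theorem ncard_le_mul_of_forall_exists {G I : Set (Submodule K V)} {B : ℚ}
    (h : ∀ U ∈ G, ∃ S ∈ I, S ≤ U) (hB : ∀ S ∈ I, ({U ∈ G | S ≤ U}.ncard : ℚ) ≤ B) :
    (G.ncard : ℚ) ≤ I.ncard * B := by
  classical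
  have hI := Set.toFinite I
  have h1 : G.ncard ≤ ∑ S ∈ hI.toFinset, {U ∈ G | S ≤ U}.ncard := by
    refine le_trans (Set.ncard_le_ncard (t := ⋃ S ∈ hI.toFinset, {U ∈ G | S ≤ U}) ?_
      (Set.toFinite _)) (Finset.set_ncard_biUnion_le _ _)
    intro U hU
    obtain ⟨S, hS, hSU⟩ := h U hU
    exact Set.mem_biUnion (by simpa using hS) ⟨hU, hSU⟩
  calc (G.ncard : ℚ) ≤ ∑ S ∈ hI.toFinset, ({U ∈ G | S ≤ U}.ncard : ℚ) := by exact_mod_cast h1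
    _ ≤ ∑ S ∈ hI.toFinset, B := Finset.sum_le_sum fun S hS => hB S (by simpa using hS)
    _ = I.ncard * B := by rw [Finset.sum_const, nsmul_eq_mul, Set.ncard_eq_toFinset_card I hI]

/-- A subspace `S` that meets `A` in dimension less than `t` lies in a subspace `W` of controlled
dimension that meets every subspace through `S` that `t`-intersects `A` in more than `S`. -/
theorem exists_enlargement {S A : Submodule K V} {t : ℕ}
    (hS : finrank K (A ⊓ S : Submodule K V) < t) (ht : t ≤ finrank K A) :
    ∃ W : Submodule K V, S ≤ W ∧ finrank K W = finrank K S + (finrank K A - t + 1) ∧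
      ∀ G : Submodule K V, S ≤ G → t ≤ finrank K (A ⊓ G : Submodule K V) →
        finrank K S + 1 ≤ finrank K (G ⊓ W : Submodule K V) := by
  -- The dimension of A' is just large enough that, inside A, any subspace of dimension at least t
  -- meets A' in more than dim (A ⊓ S). Then G ⊓ (S ⊔ A') = S is impossible, since it would put (A ⊓
  -- G) ⊓ A' inside A ⊓ S.
  obtain ⟨A', hA', h1, h2⟩ := exists_finrank_eq_between (inf_le_left : A ⊓ S ≤ A)
    (d := finrank K (A ⊓ S : Submodule K V) + (finrank K A - t + 1)) (by omega) (by omega)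
  have h3 : S ⊓ A' = A ⊓ S :=
    le_antisymm (le_inf (inf_le_right.trans h2) inf_le_left) (le_inf inf_le_right h1)
  refine ⟨S ⊔ A', le_sup_left, ?_, fun G hSG hG => ?_⟩
  · have := Submodule.finrank_sup_add_finrank_inf_eq S A'
    rw [h3] at this
    omega
  · by_contra hlt
    have h4 : G ⊓ (S ⊔ A') = S :=
      (Submodule.eq_of_le_of_finrank_le (le_inf hSG le_sup_left) (by omega)).symm
    have h5 : (A ⊓ G) ⊓ A' ≤ A ⊓ S := by
      refine le_inf (inf_le_left.trans inf_le_left) (le_trans ?_ h4.le)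
      exact le_inf (inf_le_left.trans inf_le_right) (inf_le_right.trans le_sup_right)
    have h6 := Submodule.finrank_sup_add_finrank_inf_eq (A ⊓ G) A'
    have h7 := Submodule.finrank_mono h5
    have h8 : finrank K ((A ⊓ G) ⊔ A' : Submodule K V) ≤ finrank K A :=
      Submodule.finrank_mono (sup_le inf_le_left h2)
    omega

/-- One branching step: every U through S contains one of the spaces S' with S ≤ S' ≤ W and one more
dimension than S, and their number depends on dim A and t only. -/
theorem ncard_ge_le_mul {S A : Submodule K V} {G : Set (Submodule K V)} {t : ℕ} {B : ℚ}
    (hS : finrank K (A ⊓ S : Submodule K V) < t) (ht : t ≤ finrank K A)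
    (hG : ∀ U ∈ G, t ≤ finrank K (A ⊓ U : Submodule K V))
    (hB : ∀ S' : Submodule K V, finrank K S' = finrank K S + 1 →
      ({U ∈ G | S' ≤ U}.ncard : ℚ) ≤ B) :
    ({U ∈ G | S ≤ U}.ncard : ℚ) ≤ gaussBinom (Nat.card K) (finrank K A - t + 1) 1 * B := by
  obtain ⟨W, hSW, hW, hWG⟩ := exists_enlargement hS ht
  have hc := ncard_Icc hSW (finrank K S + 1)
  rw [extCount_of_le (by omega), hW, Nat.add_sub_cancel_left, Nat.add_sub_cancel_left] at hc
  rw [← hc]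
  refine ncard_le_mul_of_forall_exists ?_ ?_
  · rintro U ⟨hU, hSU⟩
    obtain ⟨S', h1, h2, h3⟩ := exists_finrank_eq_between (le_inf hSU hSW) (Nat.le_succ _)
      (hWG U hSU (hG U hU))
    exact ⟨S', ⟨h1, h2, h3.trans inf_le_right⟩, h3.trans inf_le_left⟩
  · rintro S' ⟨h1, -, -⟩
    refine le_trans ?_ (hB S' h1)
    exact cast_ncard_mono fun U hU => ⟨hU.1.1, hU.2⟩

/-- If no subspace of dimension less than `m` covers `F`, then few members of a family crossing
`F` contain a given subspace. -/
theorem ncard_ge_le_pow_mul {F G : Set (Submodule K V)} {k l t m : ℕ} (ht : t ≤ k)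
    (hF : ∀ A ∈ F, finrank K A = k) (hG : ∀ B ∈ G, finrank K B = l)
    (hFG : ∀ A ∈ F, ∀ B ∈ G, t ≤ finrank K (A ⊓ B : Submodule K V))
    (hm : ∀ T, IsCover t T F → m ≤ finrank K T) (S : Submodule K V) (hS : finrank K S ≤ m) :
    ({U ∈ G | S ≤ U}.ncard : ℚ) ≤ gaussBinom (Nat.card K) (k - t + 1) 1 ^ (m - finrank K S)
      * extCount (Nat.card K) (finrank K V) l m := by
  obtain ⟨j, hj⟩ := Nat.exists_eq_add_of_le hS
  induction j generalizing S with
  | zero =>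
    rw [hj, add_zero, Nat.sub_self, pow_zero, one_mul, ← ncard_ge]
    exact cast_ncard_mono fun U hU => ⟨hG U hU.1, hU.2⟩
  | succ j ih =>
    have hcov : ¬ IsCover t S F := fun h => by have := hm S h; omega
    unfold IsCover at hcov
    push Not at hcov
    obtain ⟨A, hA, hAS⟩ := hcov
    rw [show m - finrank K S = j + 1 by omega, pow_succ', mul_assoc, ← hF A hA]
    refine ncard_ge_le_mul hAS (by rw [hF A hA]; exact ht) (hFG A hA) fun S' hS' => ?_
    have := ih S' (by omega) (by omega)
    rwa [show m - finrank K S' = j by omega, ← hF A hA] at this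

/-- Each member of G contains one of the t-subspaces of its cover T, and from there one branches m -
t times against F. -/
theorem ncard_le_of_isCover {F G : Set (Submodule K V)} {k l t m : ℕ} (ht : t ≤ k)
    (hF : ∀ A ∈ F, finrank K A = k) (hG : ∀ B ∈ G, finrank K B = l)
    (hFG : ∀ A ∈ F, ∀ B ∈ G, t ≤ finrank K (A ⊓ B : Submodule K V))
    (hm : ∀ T, IsCover t T F → m ≤ finrank K T) (htm : t ≤ m) {T : Submodule K V}
    (hT : IsCover t T G) :
    (G.ncard : ℚ) ≤ gaussBinom (Nat.card K) (finrank K T) t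
      * (gaussBinom (Nat.card K) (k - t + 1) 1 ^ (m - t)
        * extCount (Nat.card K) (finrank K V) l m) := by
  rw [← ncard_le T t]
  refine ncard_le_mul_of_forall_exists ?_ ?_
  · intro U hU
    obtain ⟨S, h1, -, h2⟩ := exists_finrank_eq_between (bot_le : ⊥ ≤ U ⊓ T) (d := t)
      (by simp) (hT U hU)
    exact ⟨S, ⟨h1, h2.trans inf_le_right⟩, h2.trans inf_le_left⟩
  · rintro S ⟨hS, -⟩
    have := ncard_ge_le_pow_mul ht hF hG hFG hm S (by omega)
    rwa [hS] at this

/-- The weight of a minimal cover of dimension `m` in the product bound. -/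
def coverWeight (q n k l t m : ℕ) : ℚ :=
  gaussBinom q m t * (gaussBinom q (k - t + 1) 1 ^ (m - t) * extCount q n l m)

theorem coverWeight_nonneg {q : ℕ} (hq : 2 ≤ q) (n k l t m : ℕ) :
    0 ≤ coverWeight q n k l t m :=
  mul_nonneg (gaussBinom_nonneg hq _ _)
    (mul_nonneg (pow_nonneg (gaussBinom_nonneg hq _ _) _) (extCount_nonneg hq _ _ _))

/-- One more dimension multiplies the Gaussian binomial by at most 2 q^t and the remaining factors
by at most `decay`, and 2 q^t times `decay` is at most 1. -/
theorem coverWeight_succ_le {q : ℕ} (hq : 2 ≤ q) {n k l t m : ℕ} (ht : t ≤ k)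
    (hn : k + l + t + 3 ≤ n) (hm : t ≤ m) :
    coverWeight q n k l t (m + 1) ≤ coverWeight q n k l t m := by
  have hq' := two_le_cast_of_two_le hq
  obtain ⟨j, rfl⟩ := Nat.exists_eq_add_of_le hm
  have h1 := gaussBinom_mul_extCount_succ_le hq (n := n) (l := l) (t + j) ht hn
  have h2 : gaussBinom q (t + j + 1) t ≤ 2 * (q : ℚ) ^ t * gaussBinom q (t + j) t := by
    have e1 := gaussBinom_succ_mul hq (t + j) j
    have e2 := gaussBinom_symm hq t (j + 1)
    have e3 := gaussBinom_symm hq t j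
    rw [← add_assoc] at e2
    rw [e2, e3] at e1
    have hp := pow_succ_sub_one_pos hq j
    refine le_of_mul_le_mul_right ?_ hp
    rw [e1]
    have h0 := gaussBinom_nonneg hq (t + j) t
    have h3 : (q : ℚ) ^ (t + j + 1) - 1 ≤ 2 * (q : ℚ) ^ t * ((q : ℚ) ^ (j + 1) - 1) := by
      have a1 : (2 : ℚ) ≤ (q : ℚ) ^ (j + 1) := hq'.trans (le_self_pow₀ (by linarith) (by omega))
      have a2 : (0 : ℚ) ≤ (q : ℚ) ^ t := by positivity
      rw [add_assoc, pow_add]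
      nlinarith
    nlinarith
  have h3 := two_mul_pow_mul_decay_le hq t
  have h4 := gaussBinom_nonneg hq (t + j) t
  have h5 := gaussBinom_nonneg hq (k - t + 1) 1
  have h6 := extCount_nonneg hq n l (t + j)
  have h7 := extCount_nonneg hq n l (t + j + 1)
  unfold coverWeight
  rw [show t + j + 1 - t = j + 1 by omega, Nat.add_sub_cancel_left, pow_succ]
  calc gaussBinom q (t + j + 1) t * (gaussBinom q (k - t + 1) 1 ^ j * gaussBinom q (k - t + 1) 1
        * extCount q n l (t + j + 1))
      ≤ 2 * (q : ℚ) ^ t * gaussBinom q (t + j) t * (gaussBinom q (k - t + 1) 1 ^ j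
        * gaussBinom q (k - t + 1) 1 * extCount q n l (t + j + 1)) := by gcongr
    _ = 2 * (q : ℚ) ^ t * gaussBinom q (t + j) t * gaussBinom q (k - t + 1) 1 ^ j
        * (gaussBinom q (k - t + 1) 1 * extCount q n l (t + j + 1)) := by ring
    _ ≤ 2 * (q : ℚ) ^ t * gaussBinom q (t + j) t * gaussBinom q (k - t + 1) 1 ^ j
        * (decay q t * extCount q n l (t + j)) := by gcongr
    _ = 2 * (q : ℚ) ^ t * decay q t * (gaussBinom q (t + j) t
        * (gaussBinom q (k - t + 1) 1 ^ j * extCount q n l (t + j))) := by ring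
    _ ≤ _ := mul_le_of_le_one_left (by positivity) h3

theorem coverWeight_antitone {q : ℕ} (hq : 2 ≤ q) {n k l t m m' : ℕ} (ht : t ≤ k)
    (hn : k + l + t + 3 ≤ n) (hm : t ≤ m) (h : m ≤ m') :
    coverWeight q n k l t m' ≤ coverWeight q n k l t m := by
  induction m', h using Nat.le_induction with
  | base => exact le_rfl
  | succ m' h ih => exact (coverWeight_succ_le hq ht hn (hm.trans h)).trans ih

omit [Finite K] [FiniteDimensional K V] in
theorem exists_minimal_cover {F : Set (Submodule K V)} {t : ℕ} (hF : ∃ T, IsCover t T F) :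
    ∃ T, IsCover t T F ∧ ∀ T', IsCover t T' F → finrank K T ≤ finrank K T' := by
  classical
  have h : ∃ m, ∃ T, IsCover t T F ∧ finrank K T = m := by
    obtain ⟨T, hT⟩ := hF
    exact ⟨_, T, hT, rfl⟩
  obtain ⟨T, hT, hT'⟩ := Nat.find_spec h
  exact ⟨T, hT, fun T' h' => hT'.trans_le (Nat.find_min' h ⟨T', h', rfl⟩)⟩

/-- The bound for each family mixes both least cover dimensions: its own in the number of starting
t-spaces, that of the other family in the depth of branching. In the product the factors regroup by
cover dimension, and each group decreases separately. -/
theorem ncard_mul_ncard_le_coverWeight {F G : Set (Submodule K V)} {k l t s s' : ℕ}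
    (htk : t ≤ k) (htl : t ≤ l) (hn : k + l + t + 3 ≤ finrank K V)
    (hF : ∀ A ∈ F, finrank K A = k) (hG : ∀ B ∈ G, finrank K B = l)
    (hFG : ∀ A ∈ F, ∀ B ∈ G, t ≤ finrank K (A ⊓ B : Submodule K V))
    (hF0 : F.Nonempty) (hG0 : G.Nonempty) (hs : t ≤ s) (hs' : t ≤ s')
    (hFs : ∀ T, IsCover t T F → s ≤ finrank K T) (hGs : ∀ T, IsCover t T G → s' ≤ finrank K T) :
    (F.ncard : ℚ) * G.ncard ≤ coverWeight (Nat.card K) (finrank K V) k l t s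
      * coverWeight (Nat.card K) (finrank K V) l k t s' := by
  have hq := two_le_natCard (K := K)
  have hGF : ∀ B ∈ G, ∀ A ∈ F, t ≤ finrank K (B ⊓ A : Submodule K V) :=
    fun B hB A hA => by rw [inf_comm]; exact hFG A hA B hB
  obtain ⟨B₀, hB₀⟩ := hG0
  obtain ⟨A₀, hA₀⟩ := hF0
  obtain ⟨T, hT, hTm⟩ := exists_minimal_cover ⟨B₀, fun A hA => hFG A hA B₀ hB₀⟩
  obtain ⟨T', hT', hTm'⟩ := exists_minimal_cover ⟨A₀, fun B hB => hGF B hB A₀ hA₀⟩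
  have h1 := hFs T hT
  have h2 := hGs T' hT'
  have b1 := ncard_le_of_isCover htk hF hG hFG hTm (hs.trans h1) hT'
  have b2 := ncard_le_of_isCover htl hG hF hGF hTm' (hs'.trans h2) hT
  calc (F.ncard : ℚ) * G.ncard ≤ _ :=
        mul_le_mul b2 b1 (by positivity) ((Nat.cast_nonneg _).trans b2)
    _ = coverWeight (Nat.card K) (finrank K V) k l t (finrank K T)
      * coverWeight (Nat.card K) (finrank K V) l k t (finrank K T') := by
        unfold coverWeight; ring
    _ ≤ _ := mul_le_mul (coverWeight_antitone hq htk hn hs h1)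
        (coverWeight_antitone hq htl (by omega) hs' h2) (coverWeight_nonneg hq _ _ _ _ _)
        (coverWeight_nonneg hq _ _ _ _ _)

end Covers
-- Pairs in which one family has a common t-space
section HiltonMilner

theorem gaussBinom_one_sub {q : ℕ} (hq : 2 ≤ q) (t j : ℕ) :
    gaussBinom q (t + j) 1 - gaussBinom q j 1 = (q : ℚ) ^ j * gaussBinom q t 1 := by
  have h : (q : ℚ) - 1 ≠ 0 := by linarith [one_lt_cast_of_two_le hq]
  refine mul_right_cancel₀ h ?_
  rw [sub_mul, mul_assoc, gaussBinom_one_mul hq, gaussBinom_one_mul hq, gaussBinom_one_mul hq]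
  ring

variable {K V : Type*} [Field K] [AddCommGroup V] [Module K V] [Finite K] [FiniteDimensional K V]

theorem ncard_diff_eq {P Q : Set (Submodule K V)} (h : Q ⊆ P) :
    ((P \ Q).ncard : ℚ) = P.ncard - Q.ncard := by
  have := Set.ncard_sdiff_add_ncard_of_subset h (Set.toFinite _)
  rw [eq_sub_iff_add_eq]
  exact_mod_cast this

/-- The number of hyperplanes of `M` that do not contain `X`. -/
theorem ncard_hyperplane_not_ge {X M : Submodule K V} {t j : ℕ} (hX : finrank K X = t)
    (hM : finrank K M = t + j + 1) (hXM : X ≤ M) :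
    ({H : Submodule K V | finrank K H = t + j ∧ H ≤ M ∧ ¬ X ≤ H}.ncard : ℚ)
      = (Nat.card K : ℚ) ^ (j + 1) * gaussBinom (Nat.card K) t 1 := by
  have hq := two_le_natCard (K := K)
  have h1 := ncard_le M (t + j)
  have h2 := ncard_Icc hXM (t + j)
  rw [hM, hX, extCount_of_le (by omega), show t + j + 1 - t = 1 + j by omega,
    Nat.add_sub_cancel_left, gaussBinom_symm hq] at h2
  rw [hM, show t + j + 1 = 1 + (t + j) by ring, gaussBinom_symm hq] at h1
  have h3 : {H : Submodule K V | finrank K H = t + j ∧ H ≤ M ∧ ¬ X ≤ H}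
      = {H : Submodule K V | finrank K H = t + j ∧ H ≤ M}
        \ {H : Submodule K V | finrank K H = t + j ∧ X ≤ H ∧ H ≤ M} := by
    ext H
    simp only [Set.mem_sdiff, Set.mem_ofPred_eq]
    tauto
  rw [h3, ncard_diff_eq (by rintro H ⟨hH, -, hHM⟩; exact ⟨hH, hHM⟩), h1, h2, ← gaussBinom_one_sub hq]
  congr 2 <;> ring_nf

/-- A `(t+1)`-dimensional cover of all the `l`-subspaces through `X` contains `X`. -/
theorem le_of_isCover {X T : Submodule K V} {G : Set (Submodule K V)} {l t : ℕ}
    (hX : finrank K X = t) (hT : finrank K T = t + 1) (hl : t ≤ l) (hn : l + t + 1 ≤ finrank K V)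
    (hGX : ∀ B : Submodule K V, finrank K B = l → X ≤ B → B ∈ G) (hcov : IsCover t T G) :
    X ≤ T := by
  have h1 := Submodule.finrank_add_le_finrank_add_finrank X T
  -- A member B through X in general position: it meets X ⊔ T only in X. As T covers it, B ⊓ T has
  -- dimension t and so equals X.
  obtain ⟨B, hB, hXB, hBX⟩ := exists_finrank_eq_inf_eq (le_sup_left : X ≤ X ⊔ T) (d := l)
    (by omega) (by omega)
  have h2 := hcov B (hGX B hB hXB)
  have h3 : B ⊓ T ≤ X := le_trans (inf_le_inf_left _ le_sup_right) hBX.le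
  have h4 := Submodule.eq_of_le_of_finrank_le h3 (by omega)
  rw [← h4]
  exact inf_le_right

omit [Finite K] in
-- T has only one dimension more than X, and B ⊓ T, of dimension at least t, is not inside X; so the
-- two span T.
theorem le_sup_of_not_le {X T B : Submodule K V} {t : ℕ} (hX : finrank K X = t)
    (hT : finrank K T = t + 1) (hXT : X ≤ T) (hB : t ≤ finrank K (B ⊓ T : Submodule K V))
    (hXB : ¬ X ≤ B) : T ≤ X ⊔ B ∧ finrank K (X ⊔ B : Submodule K V) = finrank K B + 1 := by
  have h1 : X ⊔ (B ⊓ T) = T := by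
    refine Submodule.eq_of_le_of_finrank_le (sup_le hXT inf_le_right) ?_
    by_contra hlt
    have h2 : X = X ⊔ (B ⊓ T) := Submodule.eq_of_le_of_finrank_le le_sup_left (by omega)
    have h3 : B ⊓ T ≤ X := sup_eq_left.1 h2.symm
    have h4 := Submodule.eq_of_le_of_finrank_le h3 (by omega)
    exact hXB (h4 ▸ inf_le_left)
  have h2 : T ≤ X ⊔ B := by
    rw [← h1]; exact sup_le_sup_left inf_le_left _
  refine ⟨h2, ?_⟩
  have e1 := Submodule.finrank_sup_add_finrank_inf_eq X (B ⊓ T)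
  rw [h1] at e1
  have e2 := Submodule.finrank_sup_add_finrank_inf_eq X B
  have e3 : finrank K (X ⊓ (B ⊓ T) : Submodule K V) ≤ finrank K (X ⊓ B : Submodule K V) :=
    Submodule.finrank_mono (inf_le_inf_left _ inf_le_left)
  have e4 : finrank K (X ⊓ B : Submodule K V) < finrank K X :=
    Submodule.finrank_lt_finrank_of_lt
      (lt_of_le_of_ne inf_le_left fun h => hXB (inf_eq_left.1 h))
  have e5 : finrank K (B ⊓ T : Submodule K V) + finrank K (X ⊔ B : Submodule K V)
      ≤ finrank K B + (t + 1) := by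
    have := Submodule.finrank_sup_add_finrank_inf_eq B T
    have h6 : X ⊔ B ≤ B ⊔ T := sup_le (hXT.trans le_sup_right) le_sup_left
    have := Submodule.finrank_mono h6
    omega
  omega

/-- An upper bound for the family whose members contain `X`. -/
theorem ncard_le_of_cover_span {X M W : Submodule K V} {F G : Set (Submodule K V)}
    {k l t m : ℕ} (htl : t ≤ l) (hX : finrank K X = t) (hM : finrank K M = m)
    (hW : finrank K W = l + 1) (hXM : X ≤ M) (hMW : M ≤ W)
    (hF : ∀ A ∈ F, finrank K A = k) (hG : ∀ B ∈ G, finrank K B = l)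
    (hGF : ∀ B ∈ G, ∀ A ∈ F, t ≤ finrank K (B ⊓ A : Submodule K V))
    (hFX : ∀ A ∈ F, X ≤ A) (hFW : ∀ A ∈ F, t + 1 ≤ finrank K (A ⊓ W : Submodule K V))
    (hcov : ∀ T : Submodule K V, finrank K T = t + 1 → IsCover t T G → T ≤ M) :
    (F.ncard : ℚ) ≤ gaussBinom (Nat.card K) (m - t) 1
        * extCount (Nat.card K) (finrank K V) k (t + 1)
      + (gaussBinom (Nat.card K) (l - t + 1) 1 - gaussBinom (Nat.card K) (m - t) 1)
        * (gaussBinom (Nat.card K) (l - t + 1) 1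
          * extCount (Nat.card K) (finrank K V) k (t + 2)) := by
  have c1 := ncard_Icc hXM (t + 1)
  have c2 := ncard_Icc (hXM.trans hMW) (t + 1)
  rw [hM, hX, extCount_of_le (by omega), Nat.add_sub_cancel_left] at c1
  rw [hW, hX, extCount_of_le (by omega), Nat.add_sub_cancel_left,
    show l + 1 - t = l - t + 1 by omega] at c2
  set I : Set (Submodule K V) := {T | finrank K T = t + 1 ∧ X ≤ T ∧ T ≤ M} with hI
  set J : Set (Submodule K V) := {T | finrank K T = t + 1 ∧ X ≤ T ∧ T ≤ W} with hJ
  have hIJ : I ⊆ J := fun T hT => ⟨hT.1, hT.2.1, hT.2.2.trans hMW⟩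
  rw [← c1, ← c2, ← ncard_diff_eq hIJ]
  -- Members are sorted by a (t+1)-space T with X ≤ T ≤ W that they contain. If T lies outside M, it
  -- is not a cover of G, and one further branching step applies.
  have hsplit : F ⊆ {A ∈ F | ∃ T ∈ I, T ≤ A} ∪ {A ∈ F | ∃ T ∈ J \ I, T ≤ A} := by
    intro A hA
    obtain ⟨T, h1, h2, h3⟩ := exists_finrank_eq_between
      (le_inf (hFX A hA) (hXM.trans hMW)) (by omega : finrank K X ≤ t + 1) (hFW A hA)
    have hTJ : T ∈ J := ⟨h1, h2, h3.trans inf_le_right⟩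
    by_cases hTI : T ∈ I
    · exact Or.inl ⟨hA, T, hTI, h3.trans inf_le_left⟩
    · exact Or.inr ⟨hA, T, ⟨hTJ, hTI⟩, h3.trans inf_le_left⟩
  have h1 := cast_ncard_mono hsplit
  have h2 : (({A ∈ F | ∃ T ∈ I, T ≤ A} ∪ {A ∈ F | ∃ T ∈ J \ I, T ≤ A}).ncard : ℚ)
      ≤ ({A ∈ F | ∃ T ∈ I, T ≤ A}.ncard : ℚ) + ({A ∈ F | ∃ T ∈ J \ I, T ≤ A}.ncard : ℚ) := by
    exact_mod_cast Set.ncard_union_le _ _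
  refine h1.trans (h2.trans (add_le_add ?_ ?_))
  · refine ncard_le_mul_of_forall_exists (fun A hA => hA.2) fun T hT => ?_
    rw [← hT.1, ← ncard_ge]
    exact cast_ncard_mono fun A hA => ⟨hF A hA.1.1, hA.2⟩
  · refine ncard_le_mul_of_forall_exists (fun A hA => hA.2) fun T hT => ?_
    have hnc : ¬ IsCover t T G := fun h => hT.2 ⟨hT.1.1, hT.1.2.1, hcov T hT.1.1 h⟩
    unfold IsCover at hnc
    push Not at hnc
    obtain ⟨B, hB, hBT⟩ := hnc
    refine le_trans (cast_ncard_mono (G' := {A ∈ F | T ≤ A}) fun A hA => ⟨hA.1.1, hA.2⟩) ?_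
    rw [c2, ← hG B hB]
    refine ncard_ge_le_mul hBT (by rw [hG B hB]; exact htl) (hGF B hB) fun S' hS' => ?_
    rw [hT.1.1] at hS'
    rw [show t + 2 = finrank K S' by omega, ← ncard_ge]
    exact cast_ncard_mono fun A hA => ⟨hF A hA.1, hA.2⟩

/-- An upper bound for the family that contains all the `l`-subspaces through `X`. -/
theorem ncard_le_of_inf_hyperplane {X M : Submodule K V} {G : Set (Submodule K V)}
    {l t j : ℕ} {B : ℚ} (hX : finrank K X = t) (hM : finrank K M = t + j + 1) (hXM : X ≤ M)
    (hG : ∀ B ∈ G, finrank K B = l)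
    (hGM : ∀ B ∈ G, ¬ X ≤ B → t + j ≤ finrank K (B ⊓ M : Submodule K V))
    (hB : ∀ H : Submodule K V, finrank K H = t + j → H ≤ M → ¬ X ≤ H →
      ({U ∈ {U ∈ G | ¬ X ≤ U} | H ≤ U}.ncard : ℚ) ≤ B) :
    (G.ncard : ℚ) ≤ extCount (Nat.card K) (finrank K V) l t
      + (Nat.card K : ℚ) ^ (j + 1) * gaussBinom (Nat.card K) t 1 * B := by
  have hsplit : G ⊆ {U ∈ G | X ≤ U} ∪ {U ∈ G | ¬ X ≤ U} := by
    intro U hU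
    by_cases h : X ≤ U
    · exact Or.inl ⟨hU, h⟩
    · exact Or.inr ⟨hU, h⟩
  have h1 := cast_ncard_mono hsplit
  have h2 : (({U ∈ G | X ≤ U} ∪ {U ∈ G | ¬ X ≤ U}).ncard : ℚ)
      ≤ ({U ∈ G | X ≤ U}.ncard : ℚ) + ({U ∈ G | ¬ X ≤ U}.ncard : ℚ) := by
    exact_mod_cast Set.ncard_union_le _ _
  refine h1.trans (h2.trans (add_le_add ?_ ?_))
  · rw [← hX, ← ncard_ge]
    exact cast_ncard_mono fun U hU => ⟨hG U hU.1, hU.2⟩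
  · rw [← ncard_hyperplane_not_ge hX hM hXM]
    refine ncard_le_mul_of_forall_exists ?_ fun H hH => hB H hH.1 hH.2.1 hH.2.2
    rintro U ⟨hU, hXU⟩
    obtain ⟨H, h3, -, h4⟩ := exists_finrank_eq_between (bot_le : ⊥ ≤ U ⊓ M) (by simp)
      (hGM U hU hXU)
    exact ⟨H, ⟨h3, h4.trans inf_le_right, fun h => hXU (h.trans (h4.trans inf_le_left))⟩,
      h4.trans inf_le_left⟩

/-- The structure of a crossing pair in which every member of `F` contains `X` and some
`(t+1)`-dimensional subspace covers `G`. -/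
theorem hilton_milner_structure {X : Submodule K V} {F G : Set (Submodule K V)} {k l t : ℕ}
    (htl : t + 1 ≤ l) (htk : t + 1 ≤ k) (hn : k + l + t + 3 ≤ finrank K V)
    (hX : finrank K X = t)
    (hF : ∀ A ∈ F, finrank K A = k) (hG : ∀ B ∈ G, finrank K B = l)
    (hFG : ∀ A ∈ F, ∀ B ∈ G, t ≤ finrank K (A ⊓ B : Submodule K V))
    (hFX : ∀ A ∈ F, X ≤ A) (hGX : ∀ B : Submodule K V, finrank K B = l → X ≤ B → B ∈ G)
    (hnon : ∃ B ∈ G, ¬ X ≤ B) (hcov : ∃ T : Submodule K V, finrank K T = t + 1 ∧ IsCover t T G) :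
    (∃ M : Submodule K V, finrank K M = l + 1 ∧ X ≤ M ∧ F ⊆ famA k (t + 1) X M ∧ G ⊆ famB l X M) ∨
    (∃ T : Submodule K V, finrank K T = t + 1 ∧ F ⊆ famC k T ∧ G ⊆ famD l t T) ∨
    (∃ m, t + 2 ≤ m ∧ m ≤ l ∧
      (F.ncard : ℚ) ≤ gaussBinom (Nat.card K) (m - t) 1
          * extCount (Nat.card K) (finrank K V) k (t + 1)
        + (gaussBinom (Nat.card K) (l - t + 1) 1 - gaussBinom (Nat.card K) (m - t) 1)
          * (gaussBinom (Nat.card K) (l - t + 1) 1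
            * extCount (Nat.card K) (finrank K V) k (t + 2)) ∧
      (G.ncard : ℚ) ≤ extCount (Nat.card K) (finrank K V) l t
        + (Nat.card K : ℚ) ^ (m - t) * gaussBinom (Nat.card K) t 1
          * extCount (Nat.card K) (finrank K V) l (m - 1)) ∨
    ((F.ncard : ℚ) ≤ extCount (Nat.card K) (finrank K V) k (t + 1)
        + (gaussBinom (Nat.card K) (l - t + 1) 1 - 1)
          * (gaussBinom (Nat.card K) (l - t + 1) 1
            * extCount (Nat.card K) (finrank K V) k (t + 2)) ∧
      (G.ncard : ℚ) ≤ extCount (Nat.card K) (finrank K V) l t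
        + Nat.card K * gaussBinom (Nat.card K) t 1
          * (gaussBinom (Nat.card K) (k - t + 1) 1
            * extCount (Nat.card K) (finrank K V) l (t + 1))) := by
  have hq := two_le_natCard (K := K)
  obtain ⟨B₀, hB₀, hXB₀⟩ := hnon
  obtain ⟨T₀, hT₀, hT₀c⟩ := hcov
  have hXT : ∀ T : Submodule K V, finrank K T = t + 1 → IsCover t T G → X ≤ T := fun T hT hTc =>
    le_of_isCover hX hT (by omega) (by omega) hGX hTc
  -- The sum of all (t+1)-dimensional covers of G. It lies in X ⊔ B for every member B not
  -- containing X, and its dimension decides the case.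
  set M : Submodule K V := sSup {T | finrank K T = t + 1 ∧ IsCover t T G} with hMdef
  have hTM : ∀ T : Submodule K V, finrank K T = t + 1 → IsCover t T G → T ≤ M := fun T hT hTc =>
    le_sSup ⟨hT, hTc⟩
  have hXM : X ≤ M := (hXT T₀ hT₀ hT₀c).trans (hTM T₀ hT₀ hT₀c)
  have hMB : ∀ B ∈ G, ¬ X ≤ B → M ≤ X ⊔ B := fun B hB hXB =>
    sSup_le fun T hT => (le_sup_of_not_le hX hT.1 (hXT T hT.1 hT.2) (hT.2 B hB) hXB).1
  have hdimB : ∀ B ∈ G, ¬ X ≤ B → finrank K (X ⊔ B : Submodule K V) = l + 1 := fun B hB hXB => by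
    rw [(le_sup_of_not_le hX hT₀ (hXT T₀ hT₀ hT₀c) (hT₀c B hB) hXB).2, hG B hB]
  have hFW : ∀ B ∈ G, ¬ X ≤ B → ∀ A ∈ F, t + 1 ≤ finrank K (A ⊓ (X ⊔ B) : Submodule K V) := by
    intro B hB hXB A hA
    by_contra hlt
    have h1 : X ≤ A ⊓ (X ⊔ B) := le_inf (hFX A hA) le_sup_left
    have h2 := Submodule.eq_of_le_of_finrank_le h1 (by omega)
    have h3 : A ⊓ B ≤ X := by rw [h2]; exact inf_le_inf_left _ le_sup_right
    have h4 := Submodule.eq_of_le_of_finrank_le h3 (by have := hFG A hA B hB; omega)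
    exact hXB (h4 ▸ inf_le_right)
  have hGF : ∀ B ∈ G, ∀ A ∈ F, t ≤ finrank K (B ⊓ A : Submodule K V) :=
    fun B hB A hA => by rw [inf_comm]; exact hFG A hA B hB
  have hm1 : t + 1 ≤ finrank K M := hT₀.ge.trans (Submodule.finrank_mono (hTM T₀ hT₀ hT₀c))
  have hm2 : finrank K M ≤ l + 1 := (Submodule.finrank_mono (hMB B₀ hB₀ hXB₀)).trans_eq
    (hdimB B₀ hB₀ hXB₀)
  have hFbound := ncard_le_of_cover_span (by omega : t ≤ l) hX rfl (hdimB B₀ hB₀ hXB₀)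
    hXM (hMB B₀ hB₀ hXB₀) hF hG hGF hFX (hFW B₀ hB₀ hXB₀) hTM
  have hGM : ∀ B ∈ G, ¬ X ≤ B → finrank K M ≤ finrank K (B ⊓ M : Submodule K V) + 1 := by
    intro B hB hXB
    have h1 := Submodule.finrank_sup_add_finrank_inf_eq B M
    have h2 : finrank K (B ⊔ M : Submodule K V) ≤ l + 1 := by
      rw [← hdimB B hB hXB]
      exact Submodule.finrank_mono (sup_le le_sup_right (hMB B hB hXB))
    have := hG B hB
    omega
  rcases hm2.eq_or_lt with hm | hm2'
  · left
    have hMeq : ∀ B ∈ G, ¬ X ≤ B → M = X ⊔ B := fun B hB hXB =>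
      Submodule.eq_of_le_of_finrank_le (hMB B hB hXB) (by rw [hdimB B hB hXB, hm])
    refine ⟨M, hm, hXM, fun A hA => ⟨hF A hA, hFX A hA, ?_⟩, fun B hB => ?_⟩
    · rw [hMeq B₀ hB₀ hXB₀]
      exact hFW B₀ hB₀ hXB₀ A hA
    · by_cases hXB : X ≤ B
      · exact Or.inl ⟨hG B hB, hXB⟩
      · exact Or.inr ⟨hG B hB, by rw [hMeq B hB hXB]; exact le_sup_right⟩
  right
  rcases hm1.eq_or_lt with hm | hm1'
  -- A single cover T₀. Unless T₀ lies in every member of F, some A₀ in F meets T₀ exactly in X, and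
  -- A₀ then restricts the members of G not containing X.
  · have hMT : T₀ = M := Submodule.eq_of_le_of_finrank_le (hTM T₀ hT₀ hT₀c) (by omega)
    by_cases hall : ∀ A ∈ F, T₀ ≤ A
    · exact Or.inl ⟨T₀, hT₀, fun A hA => ⟨hF A hA, hall A hA⟩, fun B hB => ⟨hG B hB, hT₀c B hB⟩⟩
    right; right
    push Not at hall
    obtain ⟨A₀, hA₀, hTA₀⟩ := hall
    refine ⟨?_, ?_⟩
    · rw [← hm, Nat.add_sub_cancel_left, gaussBinom_self hq, one_mul] at hFbound
      exact hFbound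
    · have hXT₀ := hXT T₀ hT₀ hT₀c
      have hinf : A₀ ⊓ T₀ = X := by
        refine (Submodule.eq_of_le_of_finrank_le (le_inf (hFX A₀ hA₀) hXT₀) ?_).symm
        have : finrank K (A₀ ⊓ T₀ : Submodule K V) < finrank K T₀ :=
          Submodule.finrank_lt_finrank_of_lt
            (lt_of_le_of_ne inf_le_right fun h => hTA₀ (inf_eq_right.1 h))
        omega
      have hW : finrank K (A₀ ⊔ T₀ : Submodule K V) = k + 1 := by
        have := Submodule.finrank_sup_add_finrank_inf_eq A₀ T₀
        rw [hinf] at this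
        have := hF A₀ hA₀
        omega
      have := ncard_le_of_inf_hyperplane (j := 0) hX hT₀ hXT₀ hG
        (fun B hB _ => hT₀c B hB) (B := gaussBinom (Nat.card K) (k - t + 1) 1
            * extCount (Nat.card K) (finrank K V) l (t + 1)) ?_
      · simpa using this
      intro H hH hHT hXH
      rw [Nat.add_zero] at hH
      have c := ncard_Icc (hHT.trans (le_sup_right : T₀ ≤ A₀ ⊔ T₀)) (t + 1)
      rw [hW, hH, extCount_of_le (by omega), Nat.add_sub_cancel_left,
        show k + 1 - t = k - t + 1 by omega] at c
      rw [← c]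
      refine ncard_le_mul_of_forall_exists ?_ ?_
      · rintro U ⟨⟨hU, hXU⟩, hHU⟩
        -- Otherwise U would meet T₀, A₀ and A₀ ⊔ T₀ in the same t-space, which lies in A₀ ⊓ T₀ = X
        -- and so equals X, although X is not contained in U.
        have hdim : t + 1 ≤ finrank K (U ⊓ (A₀ ⊔ T₀) : Submodule K V) := by
          by_contra hlt
          have e1 : U ⊓ T₀ = U ⊓ (A₀ ⊔ T₀) :=
            Submodule.eq_of_le_of_finrank_le (inf_le_inf_left _ le_sup_right)
              (by have := hT₀c U hU; omega)
          have e2 : U ⊓ A₀ = U ⊓ (A₀ ⊔ T₀) :=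
            Submodule.eq_of_le_of_finrank_le (inf_le_inf_left _ le_sup_left)
              (by have := hGF U hU A₀ hA₀; omega)
          have e3 : U ⊓ T₀ ≤ X := by
            rw [← hinf]
            exact le_inf ((e1.trans e2.symm).le.trans inf_le_right) inf_le_right
          have e4 := Submodule.eq_of_le_of_finrank_le e3 (by have := hT₀c U hU; omega)
          exact hXU (e4 ▸ inf_le_left)
        obtain ⟨H', h1, h2, h3⟩ := exists_finrank_eq_between
          (le_inf hHU (hHT.trans (le_sup_right : T₀ ≤ A₀ ⊔ T₀)))
          (by omega : finrank K H ≤ t + 1) hdim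
        exact ⟨H', ⟨h1, h2, h3.trans inf_le_right⟩, h3.trans inf_le_left⟩
      · rintro H' ⟨h1, -, -⟩
        rw [← h1, ← ncard_ge]
        exact cast_ncard_mono fun U hU => ⟨hG U hU.1.1.1, hU.2⟩
  · right; left
    obtain ⟨j, hj⟩ : ∃ j, finrank K M = t + j + 1 := ⟨finrank K M - t - 1, by omega⟩
    refine ⟨finrank K M, hm1', by omega, hFbound, ?_⟩
    have := ncard_le_of_inf_hyperplane (j := j) (l := l) hX hj hXM hG
      (fun B hB hXB => by have := hGM B hB hXB; omega)
      (B := extCount (Nat.card K) (finrank K V) l (t + j)) ?_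
    · rw [show finrank K M - t = j + 1 by omega, show finrank K M - 1 = t + j by omega]
      exact this
    intro H hH _ _
    rw [← hH, ← ncard_ge]
    exact cast_ncard_mono fun U hU => ⟨hG U hU.1.1, hU.2⟩

end HiltonMilner
-- Sizes and non-triviality of the extremal families
section ExtremalFamilies

variable {K V : Type*} [Field K] [AddCommGroup V] [Module K V]

theorem IsNontrivialCross.symm {k₁ k₂ t : ℕ} {F₁ F₂ : Set (Submodule K V)}
    (h : IsNontrivialCross k₁ k₂ t F₁ F₂) : IsNontrivialCross k₂ k₁ t F₂ F₁ where
  dim_left := h.dim_right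
  dim_right := h.dim_left
  cross A hA B hB := by rw [inf_comm]; exact h.cross B hB A hA
  nontrivial := by rw [Set.union_comm]; exact h.nontrivial

variable [Finite K] [FiniteDimensional K V]

theorem ncard_famA {X M : Submodule K V} {k t : ℕ} (hX : finrank K X = t) (hXM : X ≤ M)
    (hk : t ≤ k) :
    ((famA k (t + 1) X M).ncard : ℚ)
      = gaussBinom (Nat.card K) (finrank K V - t) (k - t)
        - (Nat.card K : ℚ) ^ ((finrank K M - t) * (k - t))
          * gaussBinom (Nat.card K) (finrank K V - finrank K M) (k - t) := by
  have h1 := ncard_ge X k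
  have h2 := ncard_inf_eq hXM (hX.trans_le hk)
  rw [hX, extCount_of_le hk] at h1
  rw [hX] at h2
  have h3 : famA k (t + 1) X M = {F : Submodule K V | finrank K F = k ∧ X ≤ F}
      \ {F : Submodule K V | finrank K F = k ∧ X ≤ F ∧ F ⊓ M = X} := by
    ext F
    simp only [famA, Set.mem_sdiff, Set.mem_ofPred_eq]
    constructor
    · rintro ⟨a, b, c⟩
      refine ⟨⟨a, b⟩, fun h => ?_⟩
      rw [h.2.2, hX] at c
      omega
    · rintro ⟨⟨a, b⟩, c⟩
      refine ⟨a, b, ?_⟩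
      by_contra hlt
      exact c ⟨a, b, (Submodule.eq_of_le_of_finrank_le (le_inf b hXM) (by omega)).symm⟩
  rw [h3, ncard_diff_eq (by rintro F ⟨a, b, -⟩; exact ⟨a, b⟩), h1, h2]

theorem ncard_famB {X M : Submodule K V} {l t : ℕ} (hX : finrank K X = t) (hXM : X ≤ M)
    (hl : t ≤ l) (hM : finrank K M = l + 1) :
    ((famB l X M).ncard : ℚ) = extCount (Nat.card K) (finrank K V) l t
      + (Nat.card K : ℚ) ^ (l - t + 1) * gaussBinom (Nat.card K) t 1 := by
  obtain ⟨j, rfl⟩ := Nat.exists_eq_add_of_le hl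
  have h1 := ncard_ge X (t + j)
  have h2 := ncard_hyperplane_not_ge hX hM hXM
  rw [hX] at h1
  rw [Nat.add_sub_cancel_left, ← h1, ← h2]
  have h3 : famB (t + j) X M = {F : Submodule K V | finrank K F = t + j ∧ X ≤ F}
      ∪ {H : Submodule K V | finrank K H = t + j ∧ H ≤ M ∧ ¬ X ≤ H} := by
    ext F
    simp only [famB, Set.mem_union, Set.mem_ofPred_eq]
    tauto
  have h4 : Disjoint {F : Submodule K V | finrank K F = t + j ∧ X ≤ F}
      {H : Submodule K V | finrank K H = t + j ∧ H ≤ M ∧ ¬ X ≤ H} :=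
    Set.disjoint_left.2 fun F h h' => h'.2.2 h.2
  rw [h3, Set.ncard_union_eq h4 (Set.toFinite _) (Set.toFinite _), Nat.cast_add]

theorem ncard_famC {T : Submodule K V} {k t : ℕ} (hT : finrank K T = t + 1) :
    ((famC k T).ncard : ℚ) = extCount (Nat.card K) (finrank K V) k (t + 1) := by
  rw [← hT, ← ncard_ge]; rfl

theorem ncard_famD {T : Submodule K V} {l t : ℕ} (hT : finrank K T = t + 1) (hl : t + 1 ≤ l) :
    ((famD l t T).ncard : ℚ)
      = (Nat.card K : ℚ) ^ (l - t) * gaussBinom (Nat.card K) (t + 1) 1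
          * gaussBinom (Nat.card K) (finrank K V - t - 1) (l - t)
        + gaussBinom (Nat.card K) (finrank K V - t - 1) (l - t - 1) := by
  classical
  have hq := two_le_natCard (K := K)
  have h1 := ncard_ge T l
  rw [hT, extCount_of_le hl] at h1
  have hI := ncard_le T t
  rw [hT, add_comm t 1, gaussBinom_symm hq] at hI
  set I : Set (Submodule K V) := {H | finrank K H = t ∧ H ≤ T} with hIdef
  set P : Set (Submodule K V) := {G | finrank K G = l ∧ finrank K (G ⊓ T : Submodule K V) = t}
    with hPdef
  -- The fibres of G ↦ G ⊓ T over the hyperplanes of T all have the same size.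
  have hP : (P.ncard : ℚ) = I.ncard * ((Nat.card K : ℚ) ^ (l - t)
      * gaussBinom (Nat.card K) (finrank K V - t - 1) (l - t)) := by
    have hPf := Set.toFinite P
    have hIf := Set.toFinite I
    have hmaps : ∀ G ∈ hPf.toFinset, G ⊓ T ∈ hIf.toFinset := by
      intro G hG
      rw [Set.Finite.mem_toFinset] at hG ⊢
      exact ⟨hG.2, inf_le_right⟩
    rw [Set.ncard_eq_toFinset_card P hPf, Finset.card_eq_sum_card_fiberwise hmaps, Nat.cast_sum,
      Set.ncard_eq_toFinset_card I hIf, ← nsmul_eq_mul, ← Finset.sum_const]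
    refine Finset.sum_congr rfl fun H hH => ?_
    rw [Set.Finite.mem_toFinset] at hH
    have h2 := ncard_inf_eq hH.2 (by have := hH.1; omega : finrank K H ≤ l)
    rw [hH.1, hT, Nat.add_sub_cancel_left, one_mul,
      show finrank K V - (t + 1) = finrank K V - t - 1 by omega] at h2
    rw [← h2, ← Set.ncard_coe_finset]
    congr 2
    ext G
    simp only [Finset.coe_filter, Set.Finite.mem_toFinset, hPdef, Set.mem_ofPred_eq]
    constructor
    · rintro ⟨⟨a, b⟩, c⟩
      exact ⟨a, by rw [← c]; exact inf_le_left, c⟩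
    · rintro ⟨a, b, c⟩
      exact ⟨⟨a, by rw [c]; exact hH.1⟩, c⟩
  have h3 : famD l t T = P ∪ {G : Submodule K V | finrank K G = l ∧ T ≤ G} := by
    ext G
    simp only [famD, Set.mem_union, hPdef, Set.mem_ofPred_eq]
    constructor
    · rintro ⟨a, b⟩
      rcases b.eq_or_lt with b | b
      · exact Or.inl ⟨a, b.symm⟩
      · have := Submodule.eq_of_le_of_finrank_le (inf_le_right : G ⊓ T ≤ T) (by omega)
        exact Or.inr ⟨a, inf_eq_right.1 this⟩
    · rintro (⟨a, b⟩ | ⟨a, b⟩)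
      · exact ⟨a, b.ge⟩
      · rw [inf_eq_right.2 b]
        exact ⟨a, by omega⟩
  have h4 : Disjoint P {G : Submodule K V | finrank K G = l ∧ T ≤ G} := by
    refine Set.disjoint_left.2 fun G h h' => ?_
    have := h.2
    rw [inf_eq_right.2 h'.2] at this
    omega
  rw [h3, Set.ncard_union_eq h4 (Set.toFinite _) (Set.toFinite _), Nat.cast_add, hP, h1, hI,
    show finrank K V - (t + 1) = finrank K V - t - 1 by omega,
    show l - (t + 1) = l - t - 1 by omega, add_comm 1 t]
  ring

theorem ncard_famA_mul_ncard_famB {X M : Submodule K V} {k l t : ℕ} (hX : finrank K X = t)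
    (hXM : X ≤ M) (hk : t ≤ k) (hl : t ≤ l) (hM : finrank K M = l + 1) :
    ((famA k (t + 1) X M).ncard : ℚ) * (famB l X M).ncard
      = boundAB (Nat.card K) (finrank K V) k l t := by
  rw [boundAB_eq hl, ncard_famA hX hXM hk, ncard_famB hX hXM hl hM, hM,
    show l + 1 - t = l - t + 1 by omega,
    show finrank K V - t - (l - t + 1) = finrank K V - (l + 1) by omega]

theorem ncard_famC_mul_ncard_famD {T : Submodule K V} {k l t : ℕ} (hT : finrank K T = t + 1)
    (hk : t + 1 ≤ k) (hl : t + 1 ≤ l) :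
    ((famC k T).ncard : ℚ) * (famD l t T).ncard
      = boundCD (Nat.card K) (finrank K V) k l t := by
  rw [boundCD, ncard_famC hT, ncard_famD hT hl, extCount_of_le hk, Nat.sub_sub, Nat.sub_sub k]

theorem exists_hyperplane_not_ge {X M : Submodule K V} {t j : ℕ} (ht : 1 ≤ t)
    (hX : finrank K X = t) (hM : finrank K M = t + j + 1) (hXM : X ≤ M) :
    ∃ H : Submodule K V, finrank K H = t + j ∧ H ≤ M ∧ ¬ X ≤ H := by
  have hq := two_le_natCard (K := K)
  have h1 := ncard_hyperplane_not_ge hX hM hXM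
  have h2 := gaussBinom_pos hq ht
  have h3 : (0 : ℚ) < Nat.card K := by linarith [one_lt_cast_of_two_le hq]
  have h4 : (0 : ℚ) < ({H : Submodule K V | finrank K H = t + j ∧ H ≤ M ∧ ¬ X ≤ H}.ncard : ℚ) := by
    rw [h1]; positivity
  rw [Nat.cast_pos, Set.ncard_pos] at h4
  exact h4

omit [Finite K] in
theorem finrank_inf_lt {X H : Submodule K V} (h : ¬ X ≤ H) :
    finrank K (X ⊓ H : Submodule K V) < finrank K X :=
  Submodule.finrank_lt_finrank_of_lt (lt_of_le_of_ne inf_le_left fun e => h (inf_eq_left.1 e))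

theorem isNontrivialCross_famA_famB {X M : Submodule K V} {k l t : ℕ} (ht : 1 ≤ t)
    (hl : t + 1 ≤ l) (hn : 2 * l + 1 ≤ finrank K V + t)
    (hX : finrank K X = t) (hXM : X ≤ M) (hM : finrank K M = l + 1) :
    IsNontrivialCross k l t (famA k (t + 1) X M) (famB l X M) where
  dim_left A hA := hA.1
  dim_right := by rintro B (hB | hB) <;> exact hB.1
  cross := by
    rintro A ⟨-, hXA, hAM⟩ B (⟨hB, hXB⟩ | ⟨hB, hBM⟩)
    · exact hX.ge.trans (Submodule.finrank_mono (le_inf hXA hXB))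
    · have h1 := Submodule.finrank_sup_add_finrank_inf_eq (A ⊓ M) B
      have h2 : finrank K ((A ⊓ M) ⊔ B : Submodule K V) ≤ finrank K M :=
        Submodule.finrank_mono (sup_le inf_le_right hBM)
      have h3 : finrank K ((A ⊓ M) ⊓ B : Submodule K V) ≤ finrank K (A ⊓ B : Submodule K V) :=
        Submodule.finrank_mono (inf_le_inf_right _ inf_le_left)
      omega
  nontrivial := by
    obtain ⟨j, rfl⟩ := Nat.exists_eq_add_of_le (by omega : t ≤ l)
    -- Two members of B suffice: H inside M without X, and B through X with B ⊓ M = X. They meet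
    -- inside X ⊓ H, of dimension below t.
    obtain ⟨H, h1, h2, h3⟩ := exists_hyperplane_not_ge ht hX hM hXM
    obtain ⟨B, h4, h5, h6⟩ := exists_finrank_eq_inf_eq hXM (d := t + j) (by omega) (by omega)
    refine lt_of_le_of_lt (Submodule.finrank_mono ?_) ((finrank_inf_lt h3).trans_eq hX)
    have hB : sInf (famA k (t + 1) X M ∪ famB (t + j) X M) ≤ B :=
      sInf_le (Or.inr (Or.inl ⟨h4, h5⟩))
    have hH : sInf (famA k (t + 1) X M ∪ famB (t + j) X M) ≤ H :=
      sInf_le (Or.inr (Or.inr ⟨h1, h2⟩))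
    exact le_inf ((le_inf hB (hH.trans h2)).trans h6.le) hH

theorem isNontrivialCross_famC_famD {T : Submodule K V} {k l t : ℕ} (ht : 1 ≤ t)
    (hk : t + 1 ≤ k) (hl : t + 1 ≤ l) (hn : k + l + t + 3 ≤ finrank K V)
    (hT : finrank K T = t + 1) :
    IsNontrivialCross k l t (famC k T) (famD l t T) where
  dim_left A hA := hA.1
  dim_right B hB := hB.1
  cross := by
    rintro A ⟨-, hTA⟩ B ⟨-, hB⟩
    refine hB.trans (Submodule.finrank_mono ?_)
    rw [inf_comm]
    exact inf_le_inf_right _ hTA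
  nontrivial := by
    obtain ⟨X, h1, -, h2⟩ := exists_finrank_eq_between (bot_le : ⊥ ≤ T) (d := t) (by simp)
      (by omega)
    obtain ⟨H, h3, h4, h5⟩ := exists_hyperplane_not_ge (j := 0) ht h1 hT h2
    obtain ⟨A, h6, h7, -⟩ := exists_finrank_eq_between (le_top : T ≤ ⊤) (d := k) (by omega)
      (by rw [finrank_top]; omega)
    -- B and B' meet A exactly in the distinct hyperplanes X and H of T, so the common intersection
    -- lies in X ⊓ H.
    obtain ⟨B, b1, b2, b3⟩ := exists_finrank_eq_inf_eq (h2.trans h7) (d := l) (by omega) (by omega)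
    obtain ⟨B', c1, c2, c3⟩ := exists_finrank_eq_inf_eq (h4.trans h7) (d := l) (by omega)
      (by omega)
    refine lt_of_le_of_lt (Submodule.finrank_mono ?_) ((finrank_inf_lt h5).trans_eq h1)
    have hA : sInf (famC k T ∪ famD l t T) ≤ A := sInf_le (Or.inl ⟨h6, h7⟩)
    have hB : sInf (famC k T ∪ famD l t T) ≤ B :=
      sInf_le (Or.inr ⟨b1, h1.ge.trans (Submodule.finrank_mono (le_inf b2 h2))⟩)
    have hB' : sInf (famC k T ∪ famD l t T) ≤ B' :=
      sInf_le (Or.inr ⟨c1, h3.ge.trans (Submodule.finrank_mono (le_inf c2 h4))⟩)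
    exact le_inf ((le_inf hB hA).trans b3.le) ((le_inf hB' hA).trans c3.le)

end ExtremalFamilies
-- Non-extremal products lie below the margin
section ProductBounds

variable {q : ℕ} (hq : 2 ≤ q)
include hq

/-- As m ≤ l, θ_(m-t) is at most half of θ_(l-t+1), so x is at most 1/2 + 1/32 of its leading term.
The factor y exceeds its own by at most 1/8, and 17/32 · 9/8 < 7/8. -/
theorem mul_lt_margin_of_intermediate {n k l t m : ℕ} {R x y : ℚ} (ht : 1 ≤ t)
    (hk : t + 1 ≤ k) (hn : k + l + t + 3 ≤ n) (hm : t + 2 ≤ m) (hml : m ≤ l) (hR : 0 < R)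
    (hE : gaussBinom q (l - t + 1) 1 * (extCount q n k (t + 1) * extCount q n l t) ≤ R)
    (hy0 : 0 ≤ y)
    (hx : x ≤ gaussBinom q (m - t) 1 * extCount q n k (t + 1)
      + (gaussBinom q (l - t + 1) 1 - gaussBinom q (m - t) 1)
        * (gaussBinom q (l - t + 1) 1 * extCount q n k (t + 2)))
    (hy : y ≤ extCount q n l t
      + (q : ℚ) ^ (m - t) * gaussBinom q t 1 * extCount q n l (m - 1)) :
    x * y < margin q t * R := by
  have h1 := pow_mul_extCount_le hq (l := l) ht hk hn (by omega : 2 ≤ m - t)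
  rw [show t + (m - t) - 1 = m - 1 by omega] at h1
  have h2 := gaussBinom_mul_extCount_succ_le hq (n := n) (k := l) (l := k) (t + 1)
    (by omega : t ≤ l) (by omega)
  have h3 := two_mul_gaussBinom_one_le hq (by omega : m - t + 1 ≤ l - t + 1)
  have h4 := decay_le hq ht
  have h5 := extCount_nonneg hq n k (t + 1)
  have h6 := extCount_nonneg hq n l t
  have h7 := gaussBinom_nonneg hq (l - t + 1) 1
  have h8 := gaussBinom_nonneg hq (m - t) 1
  have h9 := margin_ge hq t
  simp only [show t + 1 + 1 = t + 2 by ring] at h2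
  have hy' : y ≤ 9 / 8 * extCount q n l t := by linarith
  have hx' : x ≤ 17 / 32 * (gaussBinom q (l - t + 1) 1 * extCount q n k (t + 1)) := by
    have a1 : gaussBinom q (l - t + 1) 1 * extCount q n k (t + 2)
        ≤ 1 / 16 * extCount q n k (t + 1) := h2.trans (by gcongr)
    have a2 := mul_le_mul_of_nonneg_left a1
      (by linarith : 0 ≤ gaussBinom q (l - t + 1) 1 - gaussBinom q (m - t) 1)
    have a3 := mul_le_mul_of_nonneg_right h3 h5
    linarith
  calc x * y ≤ 17 / 32 * (gaussBinom q (l - t + 1) 1 * extCount q n k (t + 1))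
        * (9 / 8 * extCount q n l t) := mul_le_mul hx' hy' hy0 (by positivity)
    _ = 153 / 256 * (gaussBinom q (l - t + 1) 1
        * (extCount q n k (t + 1) * extCount q n l t)) := by ring
    _ ≤ 153 / 256 * R := by gcongr
    _ < margin q t * R := by nlinarith

/-- Here x has only one unit of e(k, t+1) besides a sixteenth of the full leading term. The unit is
small against R because θ_(t+1) ≥ 3. -/
theorem mul_lt_margin_of_extra {n k l t : ℕ} {R x y : ℚ} (ht : 1 ≤ t)
    (hk : t + 1 ≤ k) (hl : t + 1 ≤ l) (hn : k + l + t + 3 ≤ n) (hR : 0 < R)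
    (hE : gaussBinom q (l - t + 1) 1 * (extCount q n k (t + 1) * extCount q n l t) ≤ R)
    (hE' : gaussBinom q (t + 1) 1 * (extCount q n k (t + 1) * extCount q n l t) ≤ R)
    (hy0 : 0 ≤ y)
    (hx : x ≤ extCount q n k (t + 1) + (gaussBinom q (l - t + 1) 1 - 1)
        * (gaussBinom q (l - t + 1) 1 * extCount q n k (t + 2)))
    (hy : y ≤ extCount q n l t
      + q * gaussBinom q t 1 * (gaussBinom q (k - t + 1) 1 * extCount q n l (t + 1))) :
    x * y < margin q t * R := by
  have h1 := gaussBinom_mul_extCount_succ_le hq (n := n) (k := k) (l := l) t (by omega : t ≤ k)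
    (by omega)
  have h2 := gaussBinom_mul_extCount_succ_le hq (n := n) (k := l) (l := k) (t + 1)
    (by omega : t ≤ l) (by omega)
  have h3 := gaussBinom_one_mul_decay_le hq ht
  have h4 := decay_le hq ht
  have h5 := extCount_nonneg hq n k (t + 1)
  have h6 := extCount_nonneg hq n l t
  have h7 := one_le_gaussBinom hq (by omega : 1 ≤ l - t + 1)
  have h9 := margin_ge hq t
  have h10 := gaussBinom_one_succ hq t
  have h11 := gaussBinom_nonneg hq t 1
  have h12 := decay_pos hq t
  have hθ : 3 ≤ gaussBinom q (t + 1) 1 := by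
    have := gaussBinom_one_mono hq (by omega : 2 ≤ t + 1)
    rw [gaussBinom_one_succ hq, gaussBinom_self hq] at this
    linarith [two_le_cast_of_two_le hq]
  simp only [show t + 1 + 1 = t + 2 by ring] at h2
  have hqt : q * gaussBinom q t 1 * decay q t ≤ 1 / 4 := by
    refine le_trans (mul_le_mul_of_nonneg_right ?_ h12.le) h3
    linarith
  have hy' : y ≤ 5 / 4 * extCount q n l t := by
    have a1 : q * gaussBinom q t 1 * (gaussBinom q (k - t + 1) 1 * extCount q n l (t + 1))
        ≤ q * gaussBinom q t 1 * (decay q t * extCount q n l t) := by gcongr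
    have a2 := mul_le_mul_of_nonneg_right hqt h6
    linarith
  have hx' : x ≤ extCount q n k (t + 1)
      + 1 / 16 * (gaussBinom q (l - t + 1) 1 * extCount q n k (t + 1)) := by
    have a1 : gaussBinom q (l - t + 1) 1 * extCount q n k (t + 2)
        ≤ 1 / 16 * extCount q n k (t + 1) := h2.trans (by gcongr)
    have a2 := mul_le_mul_of_nonneg_left a1
      (by linarith : 0 ≤ gaussBinom q (l - t + 1) 1 - 1)
    linarith
  have h13 := mul_nonneg h5 h6
  calc x * y ≤ (extCount q n k (t + 1)
        + 1 / 16 * (gaussBinom q (l - t + 1) 1 * extCount q n k (t + 1)))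
        * (5 / 4 * extCount q n l t) := mul_le_mul hx' hy' hy0 (by positivity)
    _ = 5 / 4 * (extCount q n k (t + 1) * extCount q n l t) + 5 / 64 * (gaussBinom q (l - t + 1) 1
        * (extCount q n k (t + 1) * extCount q n l t)) := by ring
    _ ≤ 5 / 4 * (1 / 3 * R) + 5 / 64 * R := by
        have := mul_le_mul_of_nonneg_right hθ h13
        linarith
    _ < margin q t * R := by nlinarith

theorem coverWeight_mul_lt_margin_of_two {n k l t : ℕ} {R : ℚ}
    (hl : t + 1 ≤ l) (hn : k + l + t + 3 ≤ n) (hR : 0 < R)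
    (hE : gaussBinom q (l - t + 1) 1 * (extCount q n k (t + 1) * extCount q n l t) ≤ R) :
    coverWeight q n k l t t * coverWeight q n l k t (t + 2) < margin q t * R := by
  have h2 := gaussBinom_mul_extCount_succ_le hq (n := n) (k := l) (l := k) (t + 1)
    (by omega : t ≤ l) (by omega)
  have h3 := gaussBinom_two_mul_decay_le hq t
  have h5 := extCount_nonneg hq n k (t + 1)
  have h6 := extCount_nonneg hq n l t
  have h7 := gaussBinom_nonneg hq (l - t + 1) 1
  have h8 := gaussBinom_nonneg hq (t + 2) t
  have h9 := margin_ge hq t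
  simp only [show t + 1 + 1 = t + 2 by ring] at h2
  unfold coverWeight
  rw [gaussBinom_self hq, Nat.sub_self, pow_zero, one_mul, one_mul, Nat.add_sub_cancel_left]
  calc extCount q n l t * (gaussBinom q (t + 2) t
        * (gaussBinom q (l - t + 1) 1 ^ 2 * extCount q n k (t + 2)))
      = extCount q n l t * (gaussBinom q (t + 2) t * (gaussBinom q (l - t + 1) 1
        * (gaussBinom q (l - t + 1) 1 * extCount q n k (t + 2)))) := by ring
    _ ≤ extCount q n l t * (gaussBinom q (t + 2) t * (gaussBinom q (l - t + 1) 1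
        * (decay q t * extCount q n k (t + 1)))) := by gcongr
    _ = gaussBinom q (t + 2) t * decay q t * (gaussBinom q (l - t + 1) 1
        * (extCount q n k (t + 1) * extCount q n l t)) := by ring
    _ ≤ 2 / 3 * R := mul_le_mul h3 hE (by positivity) (by norm_num)
    _ < margin q t * R := by nlinarith

/-- The tight case: no common t-space on either side. One factor θ_(k-t+1) is absorbed by `decay`,
which leaves θ_(t+1)² `decay` against `margin`. -/
theorem coverWeight_mul_lt_margin_of_one {n k l t : ℕ} {R : ℚ} (hk : t + 1 ≤ k)
    (hl : t + 1 ≤ l) (hn : k + l + t + 3 ≤ n)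
    (hE : gaussBinom q (l - t + 1) 1 * (extCount q n k (t + 1) * extCount q n l t) ≤ R) :
    coverWeight q n k l t (t + 1) * coverWeight q n l k t (t + 1) < margin q t * R := by
  have h1 := gaussBinom_mul_extCount_succ_le hq (n := n) (k := k) (l := l) t (by omega : t ≤ k)
    (by omega)
  have h3 := sq_mul_decay_lt_margin hq t
  have h5 := extCount_pos hq (n := n) hk (by omega)
  have h6 := extCount_pos hq (n := n) (by omega : t ≤ l) (by omega)
  have h7 := gaussBinom_pos hq (by omega : 1 ≤ l - t + 1)
  have h8 := gaussBinom_nonneg hq (t + 1) 1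
  have h9 := margin_ge hq t
  have e : gaussBinom q (t + 1) t = gaussBinom q (t + 1) 1 := (gaussBinom_symm hq t 1).symm
  unfold coverWeight
  rw [e, Nat.add_sub_cancel_left, pow_one, pow_one]
  calc gaussBinom q (t + 1) 1 * (gaussBinom q (k - t + 1) 1 * extCount q n l (t + 1))
        * (gaussBinom q (t + 1) 1 * (gaussBinom q (l - t + 1) 1 * extCount q n k (t + 1)))
      ≤ gaussBinom q (t + 1) 1 * (decay q t * extCount q n l t)
        * (gaussBinom q (t + 1) 1 * (gaussBinom q (l - t + 1) 1 * extCount q n k (t + 1))) := by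
        gcongr
    _ = gaussBinom q (t + 1) 1 ^ 2 * decay q t * (gaussBinom q (l - t + 1) 1
        * (extCount q n k (t + 1) * extCount q n l t)) := by ring
    _ < margin q t * (gaussBinom q (l - t + 1) 1
        * (extCount q n k (t + 1) * extCount q n l t)) := by
        refine mul_lt_mul_of_pos_right h3 ?_
        positivity
    _ ≤ margin q t * R := by
        refine mul_le_mul_of_nonneg_left hE ?_
        linarith

end ProductBounds

/-! ### Classification of non-trivial cross-intersecting pairs -/

section Classification

theorem eq_of_subset_of_ncard_mul_eq {α : Type*} [Finite α] {F₁ F₂ G₁ G₂ : Set α}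
    (h₁ : F₁ ⊆ G₁) (h₂ : F₂ ⊆ G₂) (hpos : (0 : ℚ) < (F₁.ncard : ℚ) * F₂.ncard)
    (h : (F₁.ncard : ℚ) * F₂.ncard = (G₁.ncard : ℚ) * G₂.ncard) : F₁ = G₁ ∧ F₂ = G₂ := by
  have h' : F₁.ncard * F₂.ncard = G₁.ncard * G₂.ncard := by exact_mod_cast h
  have hp : 0 < F₁.ncard * F₂.ncard := by exact_mod_cast hpos
  have hp₁ := Nat.pos_of_mul_pos_right hp
  have hp₂ := Nat.pos_of_mul_pos_left hp
  have l₁ := Set.ncard_le_ncard h₁ (Set.toFinite _)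
  have l₂ := Set.ncard_le_ncard h₂ (Set.toFinite _)
  constructor
  · refine Set.eq_of_subset_of_ncard_le h₁ ?_ (Set.toFinite _)
    by_contra hlt
    push Not at hlt
    nlinarith
  · refine Set.eq_of_subset_of_ncard_le h₂ ?_ (Set.toFinite _)
    by_contra hlt
    push Not at hlt
    nlinarith

variable {K V : Type*} [Field K] [AddCommGroup V] [Module K V] [Finite K] [FiniteDimensional K V]

omit [Finite K] in
theorem le_finrank_of_isCover {F : Set (Submodule K V)} {t : ℕ} {T : Submodule K V}
    (hF : F.Nonempty) (hT : IsCover t T F) : t ≤ finrank K T := by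
  obtain ⟨A, hA⟩ := hF
  exact (hT A hA).trans (Submodule.finrank_mono inf_le_right)

/-- A crossing pair in which all members of `F` share a `t`-dimensional subspace has one of the
two extremal shapes or a small product. -/
theorem classification_of_common {X : Submodule K V} {F G : Set (Submodule K V)} {k l t : ℕ}
    {R : ℚ} (ht : 1 ≤ t) (htl : t + 1 ≤ l) (htk : t + 1 ≤ k) (hn : k + l + t + 3 ≤ finrank K V)
    (hR : 0 < R)
    (hE : gaussBinom (Nat.card K) (l - t + 1) 1 * (extCount (Nat.card K) (finrank K V) k (t + 1)
      * extCount (Nat.card K) (finrank K V) l t) ≤ R)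
    (hE' : gaussBinom (Nat.card K) (t + 1) 1 * (extCount (Nat.card K) (finrank K V) k (t + 1)
      * extCount (Nat.card K) (finrank K V) l t) ≤ R)
    (hX : finrank K X = t)
    (hFG : IsNontrivialCross k l t F G) (hF0 : F.Nonempty)
    (hFX : ∀ A ∈ F, X ≤ A) (hGX : ∀ B : Submodule K V, finrank K B = l → X ≤ B → B ∈ G) :
    (∃ X M : Submodule K V, finrank K X = t ∧ finrank K M = l + 1 ∧ X ≤ M ∧
      F ⊆ famA k (t + 1) X M ∧ G ⊆ famB l X M) ∨
    (∃ T : Submodule K V, finrank K T = t + 1 ∧ F ⊆ famC k T ∧ G ⊆ famD l t T) ∨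
    (F.ncard : ℚ) * G.ncard < margin (Nat.card K) t * R := by
  have hq := two_le_natCard (K := K)
  have hnon : ∃ B ∈ G, ¬ X ≤ B := by
    by_contra h
    push Not at h
    have h1 : X ≤ sInf (F ∪ G) := le_sInf fun U hU => hU.elim (hFX U) (h U)
    have h2 := Submodule.finrank_mono h1
    have := hFG.nontrivial
    omega
  by_cases hcov : ∃ T : Submodule K V, finrank K T = t + 1 ∧ IsCover t T G
  · rcases hilton_milner_structure htl htk hn hX hFG.dim_left hFG.dim_right hFG.cross hFX hGX hnon
      hcov with ⟨M, h1, h2, h3, h4⟩ | h | ⟨m, h1, h2, h3, h4⟩ | ⟨h3, h4⟩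
    · exact Or.inl ⟨X, M, hX, h1, h2, h3, h4⟩
    · exact Or.inr (Or.inl h)
    · exact Or.inr (Or.inr (mul_lt_margin_of_intermediate hq ht htk hn h1 h2 hR hE
        (Nat.cast_nonneg _) h3 h4))
    · exact Or.inr (Or.inr (mul_lt_margin_of_extra hq ht htk htl hn hR hE hE'
        (Nat.cast_nonneg _) h3 h4))
  · right; right
    push Not at hcov
    have hG0 : G.Nonempty := by
      obtain ⟨B, hB, -⟩ := hnon
      exact ⟨B, hB⟩
    refine lt_of_le_of_lt (ncard_mul_ncard_le_coverWeight (s := t) (s' := t + 2) (by omega)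
      (by omega) hn hFG.dim_left hFG.dim_right hFG.cross hF0 hG0 le_rfl (by omega)
      (fun T hT => le_finrank_of_isCover hF0 hT) fun T hT => ?_)
      (coverWeight_mul_lt_margin_of_two hq htl hn hR hE)
    have h1 := le_finrank_of_isCover hG0 hT
    by_contra hlt
    obtain ⟨T', h2, h3, -⟩ := exists_finrank_eq_between (le_top : T ≤ ⊤) (d := t + 1) (by omega)
      (by rw [finrank_top]; omega)
    exact hcov T' h2 fun B hB => (hT B hB).trans (Submodule.finrank_mono (inf_le_inf_left _ h3))

omit [Finite K] in
/-- Every nontrivial cross pair extends to a maximal one. -/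
theorem IsNontrivialCross.exists_closed {k₁ k₂ t : ℕ} {F₁ F₂ : Set (Submodule K V)}
    (h : IsNontrivialCross k₁ k₂ t F₁ F₂) :
    ∃ G₁ G₂ : Set (Submodule K V), F₁ ⊆ G₁ ∧ F₂ ⊆ G₂ ∧ IsNontrivialCross k₁ k₂ t G₁ G₂ ∧
      (∀ A : Submodule K V, finrank K A = k₁ →
        (∀ B ∈ G₂, t ≤ finrank K (A ⊓ B : Submodule K V)) → A ∈ G₁) ∧
      (∀ B : Submodule K V, finrank K B = k₂ →
        (∀ A ∈ G₁, t ≤ finrank K (A ⊓ B : Submodule K V)) → B ∈ G₂) := by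
  -- G₁ is everything that crosses F₂, and G₂ everything that crosses G₁. As F₂ ⊆ G₂, whatever
  -- crosses G₂ already crosses F₂, so the pair is closed after these two steps.
  set G₁ : Set (Submodule K V) :=
    {A | finrank K A = k₁ ∧ ∀ B ∈ F₂, t ≤ finrank K (A ⊓ B : Submodule K V)}
  set G₂ : Set (Submodule K V) :=
    {B | finrank K B = k₂ ∧ ∀ A ∈ G₁, t ≤ finrank K (A ⊓ B : Submodule K V)}
  have h1 : F₁ ⊆ G₁ := fun A hA => ⟨h.dim_left A hA, fun B hB => h.cross A hA B hB⟩
  have h2 : F₂ ⊆ G₂ := fun B hB => ⟨h.dim_right B hB, fun A hA => hA.2 B hB⟩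
  refine ⟨G₁, G₂, h1, h2, ⟨fun A hA => hA.1, fun B hB => hB.1, fun A hA B hB => hB.2 A hA, ?_⟩,
    fun A hA hA' => ⟨hA, fun B hB => hA' B (h2 hB)⟩, fun B hB hB' => ⟨hB, hB'⟩⟩
  exact lt_of_le_of_lt (Submodule.finrank_mono (sInf_le_sInf (Set.union_subset_union h1 h2)))
    h.nontrivial

/-- The leading term of the extremal products. -/
def leadingTerm (q n k₁ k₂ t : ℕ) : ℚ :=
  max (gaussBinom q (k₂ - t + 1) 1) (gaussBinom q (t + 1) 1)
    * (extCount q n k₁ (t + 1) * extCount q n k₂ t)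

theorem IsNontrivialCross.classification {k₁ k₂ t : ℕ} {F₁ F₂ : Set (Submodule K V)}
    (h : IsNontrivialCross k₁ k₂ t F₁ F₂) (ht : 1 ≤ t) (hk : k₂ ≤ k₁) (hk₂ : t + 1 ≤ k₂)
    (hn : k₁ + k₂ + t + 3 ≤ finrank K V) :
    (∃ X M : Submodule K V, finrank K X = t ∧ finrank K M = k₂ + 1 ∧ X ≤ M ∧
      F₁ ⊆ famA k₁ (t + 1) X M ∧ F₂ ⊆ famB k₂ X M) ∨
    (∃ X M : Submodule K V, finrank K X = t ∧ finrank K M = k₁ + 1 ∧ X ≤ M ∧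
      F₁ ⊆ famB k₁ X M ∧ F₂ ⊆ famA k₂ (t + 1) X M) ∨
    (∃ T : Submodule K V, finrank K T = t + 1 ∧ F₁ ⊆ famC k₁ T ∧ F₂ ⊆ famD k₂ t T) ∨
    (∃ T : Submodule K V, finrank K T = t + 1 ∧ F₁ ⊆ famD k₁ t T ∧ F₂ ⊆ famC k₂ T) ∨
    (F₁.ncard : ℚ) * F₂.ncard
      < margin (Nat.card K) t * leadingTerm (Nat.card K) (finrank K V) k₁ k₂ t := by
  have hq := two_le_natCard (K := K)
  have hpos : 0 < extCount (Nat.card K) (finrank K V) k₁ (t + 1)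
      * extCount (Nat.card K) (finrank K V) k₂ t :=
    mul_pos (extCount_pos hq (by omega) (by omega)) (extCount_pos hq (by omega) (by omega))
  have hθ := gaussBinom_pos hq (by omega : 1 ≤ t + 1)
  have hR : 0 < leadingTerm (Nat.card K) (finrank K V) k₁ k₂ t :=
    mul_pos (lt_max_of_lt_right hθ) hpos
  have hE : gaussBinom (Nat.card K) (k₂ - t + 1) 1
      * (extCount (Nat.card K) (finrank K V) k₁ (t + 1) * extCount (Nat.card K) (finrank K V) k₂ t)
      ≤ leadingTerm (Nat.card K) (finrank K V) k₁ k₂ t :=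
    mul_le_mul_of_nonneg_right (le_max_left _ _) hpos.le
  have hE' : gaussBinom (Nat.card K) (t + 1) 1
      * (extCount (Nat.card K) (finrank K V) k₁ (t + 1) * extCount (Nat.card K) (finrank K V) k₂ t)
      ≤ leadingTerm (Nat.card K) (finrank K V) k₁ k₂ t :=
    mul_le_mul_of_nonneg_right (le_max_right _ _) hpos.le
  have hmargin := margin_ge hq t
  obtain ⟨G₁, G₂, h1, h2, hG, hG₁, hG₂⟩ := h.exists_closed
  have hmono : (F₁.ncard : ℚ) * F₂.ncard ≤ (G₁.ncard : ℚ) * G₂.ncard :=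
    mul_le_mul (cast_ncard_mono h1) (cast_ncard_mono h2) (Nat.cast_nonneg _) (Nat.cast_nonneg _)
  rcases G₁.eq_empty_or_nonempty with rfl | hG₁0
  · refine Or.inr (Or.inr (Or.inr (Or.inr (lt_of_le_of_lt hmono ?_))))
    rw [Set.ncard_empty, Nat.cast_zero, zero_mul]
    exact mul_pos (by linarith) hR
  rcases G₂.eq_empty_or_nonempty with rfl | hG₂0
  · refine Or.inr (Or.inr (Or.inr (Or.inr (lt_of_le_of_lt hmono ?_))))
    rw [Set.ncard_empty, Nat.cast_zero, mul_zero]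
    exact mul_pos (by linarith) hR
  by_cases hX₁ : ∃ X : Submodule K V, finrank K X = t ∧ ∀ A ∈ G₁, X ≤ A
  · obtain ⟨X, hX, hX₁⟩ := hX₁
    rcases classification_of_common ht hk₂ (by omega) hn hR hE hE' hX hG hG₁0 hX₁
      (fun B hB hXB => hG₂ B hB fun A hA =>
        hX.ge.trans (Submodule.finrank_mono (le_inf (hX₁ A hA) hXB))) with
      ⟨Y, M, e1, e2, e3, e4, e5⟩ | ⟨T, e1, e2, e3⟩ | e
    · exact Or.inl ⟨Y, M, e1, e2, e3, h1.trans e4, h2.trans e5⟩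
    · exact Or.inr (Or.inr (Or.inl ⟨T, e1, h1.trans e2, h2.trans e3⟩))
    · exact Or.inr (Or.inr (Or.inr (Or.inr (lt_of_le_of_lt hmono e))))
  by_cases hX₂ : ∃ X : Submodule K V, finrank K X = t ∧ ∀ B ∈ G₂, X ≤ B
  · obtain ⟨X, hX, hX₂⟩ := hX₂
    -- With the roles exchanged the relevant leading terms only decrease, because k₂ ≤ k₁; so the
    -- same `leadingTerm` serves both cases.
    have s1 := gaussBinom_mul_extCount_swap_le hq (n := finrank K V) hk hk₂ (by omega)
    have s2 := mul_le_mul_of_nonneg_left (extCount_swap_le hq (n := finrank K V) hk hk₂ (by omega))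
      hθ.le
    rw [mul_comm (extCount _ _ k₁ t)] at s1 s2
    rcases classification_of_common ht (by omega) hk₂ (by omega) hR (s1.trans hE) (s2.trans hE')
      hX hG.symm hG₂0 hX₂ (fun B hB hXB => hG₁ B hB fun A hA =>
        hX.ge.trans (Submodule.finrank_mono (le_inf hXB (hX₂ A hA)))) with
      ⟨Y, M, e1, e2, e3, e4, e5⟩ | ⟨T, e1, e2, e3⟩ | e
    · exact Or.inr (Or.inl ⟨Y, M, e1, e2, e3, h1.trans e5, h2.trans e4⟩)
    · exact Or.inr (Or.inr (Or.inr (Or.inl ⟨T, e1, h1.trans e3, h2.trans e2⟩)))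
    · rw [mul_comm] at e
      exact Or.inr (Or.inr (Or.inr (Or.inr (lt_of_le_of_lt hmono e))))
  -- A cover of dimension t would be contained in every member, hence be a common t-space.
  · have hcover : ∀ G : Set (Submodule K V), G.Nonempty →
        (¬ ∃ X : Submodule K V, finrank K X = t ∧ ∀ B ∈ G, X ≤ B) →
        ∀ T, IsCover t T G → t + 1 ≤ finrank K T := by
      intro G hG0 hno T hT
      have hT' := le_finrank_of_isCover hG0 hT
      by_contra hlt
      refine hno ⟨T, by omega, fun B hB => ?_⟩
      have h3 := hT B hB
      exact inf_eq_right.1 (Submodule.eq_of_le_of_finrank_le inf_le_right (by omega))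
    refine Or.inr (Or.inr (Or.inr (Or.inr (lt_of_le_of_lt hmono ?_))))
    exact lt_of_le_of_lt (ncard_mul_ncard_le_coverWeight (by omega) (by omega) hn hG.dim_left
      hG.dim_right hG.cross hG₁0 hG₂0 (Nat.le_succ t) (Nat.le_succ t) (hcover _ hG₁0 hX₁)
      (hcover _ hG₂0 hX₂)) (coverWeight_mul_lt_margin_of_one hq (by omega) hk₂ hn hE)

end Classification
-- Comparison of the extremal shapes and the upper bounds
section Extremal

theorem margin_mul_leadingTerm_le {q : ℕ} (hq : 2 ≤ q) {n k₁ k₂ t : ℕ} (hk₁ : t + 1 ≤ k₁)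
    (hk₂ : t + 1 ≤ k₂) (hn : k₁ + k₂ + t + 3 ≤ n) :
    (2 * t + 1 ≤ k₂ → margin q t * leadingTerm q n k₁ k₂ t ≤ boundAB q n k₁ k₂ t) ∧
    (k₂ ≤ 2 * t → margin q t * leadingTerm q n k₁ k₂ t ≤ boundCD q n k₁ k₂ t) := by
  refine ⟨fun h => ?_, fun h => ?_⟩
  · rw [leadingTerm, max_eq_left (gaussBinom_one_mono hq (by omega))]
    exact margin_mul_le_boundAB hq hk₁ hk₂ hn
  · rw [leadingTerm, max_eq_right (gaussBinom_one_mono hq (by omega))]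
    exact margin_mul_le_boundCD hq hk₁ hk₂ hn

theorem extCount_mul_extCount_pos {q : ℕ} (hq : 2 ≤ q) {n k₁ k₂ t : ℕ} (hk₁ : t + 1 ≤ k₁)
    (hk₂ : t + 1 ≤ k₂) (hn : k₁ + k₂ + t + 3 ≤ n) :
    0 < extCount q n k₁ (t + 1) * extCount q n k₂ t :=
  mul_pos (extCount_pos hq (by omega) (by omega)) (extCount_pos hq (by omega) (by omega))

/-- For k₂ ≥ 2t + 1, θ_(k₂-t+1) is at least 2 θ_(t+1), and 2 · 7/8 > 1. -/
theorem boundCD_lt_boundAB {q : ℕ} (hq : 2 ≤ q) {n k₁ k₂ t : ℕ} (hk : k₂ ≤ k₁)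
    (hk₂ : 2 * t + 1 ≤ k₂) (ht : 1 ≤ t) (hn : k₁ + k₂ + t + 3 ≤ n) :
    boundCD q n k₁ k₂ t < boundAB q n k₁ k₂ t ∧ boundCD q n k₂ k₁ t < boundAB q n k₁ k₂ t := by
  have hE := extCount_mul_extCount_pos hq (by omega : t + 1 ≤ k₁) (by omega : t + 1 ≤ k₂) hn
  have h1 := boundCD_le hq (n := n) (by omega : t + 1 ≤ k₁) (by omega : t + 1 ≤ k₂) (by omega)
  have h2 := boundCD_le hq (n := n) (by omega : t + 1 ≤ k₂) (by omega : t + 1 ≤ k₁) (by omega)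
  have h3 := extCount_swap_le hq (n := n) hk (by omega) (by omega : t < n)
  have h4 := two_mul_gaussBinom_one_le hq (by omega : t + 1 + 1 ≤ k₂ - t + 1)
  have h5 := margin_mul_le_boundAB hq (by omega : t + 1 ≤ k₁) (by omega : t + 1 ≤ k₂) hn
  have h6 := margin_ge hq t
  have h7 := gaussBinom_pos hq (by omega : 1 ≤ t + 1)
  rw [mul_comm (extCount q n k₁ t)] at h3
  have h8 := mul_le_mul_of_nonneg_left h3 h7.le
  have h9 := mul_le_mul_of_nonneg_right h4 hE.le
  have h10 := mul_pos h7 hE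
  have h11 : gaussBinom q (t + 1) 1 * (extCount q n k₁ (t + 1) * extCount q n k₂ t)
      < boundAB q n k₁ k₂ t := by
    refine lt_of_lt_of_le ?_ h5
    nlinarith
  exact ⟨h1.trans_lt h11, (h2.trans h8).trans_lt h11⟩

/-- For k₂ < k₁ the exchange halves the leading term, and 1/2 < 7/8. -/
theorem boundCD_swap_lt {q : ℕ} (hq : 2 ≤ q) {n k₁ k₂ t : ℕ} (hk : k₂ < k₁)
    (hk₂ : t + 1 ≤ k₂) (hn : k₁ + k₂ + t + 3 ≤ n) :
    boundCD q n k₂ k₁ t < boundCD q n k₁ k₂ t := by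
  have hE := extCount_mul_extCount_pos hq (by omega : t + 1 ≤ k₁) hk₂ hn
  have h2 := boundCD_le hq (n := n) hk₂ (by omega : t + 1 ≤ k₁) (by omega)
  have h3 := two_mul_extCount_swap_le hq (n := n) hk hk₂ (by omega)
  have h5 := margin_mul_le_boundCD hq (by omega : t + 1 ≤ k₁) hk₂ hn
  have h6 := margin_ge hq t
  have h7 := gaussBinom_pos hq (by omega : 1 ≤ t + 1)
  rw [mul_comm (extCount q n k₁ t)] at h3
  have h8 := mul_le_mul_of_nonneg_left h3 h7.le
  have h10 := mul_pos h7 hE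
  nlinarith

variable {K V : Type*} [Field K] [AddCommGroup V] [Module K V] [Finite K] [FiniteDimensional K V]

theorem le_and_eq_of_subset {F₁ F₂ G₁ G₂ : Set (Submodule K V)} {Z : ℚ} {P : Prop} (hZ : 0 < Z)
    (h₁ : F₁ ⊆ G₁) (h₂ : F₂ ⊆ G₂) (h : (G₁.ncard : ℚ) * G₂.ncard = Z)
    (hP : F₁ = G₁ → F₂ = G₂ → P) :
    (F₁.ncard : ℚ) * F₂.ncard ≤ Z ∧ ((F₁.ncard : ℚ) * F₂.ncard = Z → P) := by
  refine ⟨?_, fun he => ?_⟩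
  · rw [← h]
    exact mul_le_mul (cast_ncard_mono h₁) (cast_ncard_mono h₂) (Nat.cast_nonneg _)
      (Nat.cast_nonneg _)
  · obtain ⟨e₁, e₂⟩ := eq_of_subset_of_ncard_mul_eq h₁ h₂ (he ▸ hZ) (he.trans h.symm)
    exact hP e₁ e₂

omit [Finite K] [FiniteDimensional K V] in
theorem le_and_eq_of_lt {F₁ F₂ : Set (Submodule K V)} {Z : ℚ} {P : Prop}
    (h : (F₁.ncard : ℚ) * F₂.ncard < Z) :
    (F₁.ncard : ℚ) * F₂.ncard ≤ Z ∧ ((F₁.ncard : ℚ) * F₂.ncard = Z → P) :=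
  ⟨h.le, fun he => absurd he h.ne⟩

theorem ncard_mul_lt_of_subset {F₁ F₂ G₁ G₂ : Set (Submodule K V)} {Z : ℚ}
    (h₁ : F₁ ⊆ G₁) (h₂ : F₂ ⊆ G₂) (h : (G₁.ncard : ℚ) * G₂.ncard < Z) :
    (F₁.ncard : ℚ) * F₂.ncard < Z :=
  lt_of_le_of_lt (mul_le_mul (cast_ncard_mono h₁) (cast_ncard_mono h₂) (Nat.cast_nonneg _)
    (Nat.cast_nonneg _)) h

variable {k₁ k₂ t : ℕ} {F₁ F₂ : Set (Submodule K V)}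

theorem IsNontrivialCross.le_boundAB (h : IsNontrivialCross k₁ k₂ t F₁ F₂) (ht : 1 ≤ t)
    (hk : k₂ ≤ k₁) (hn : k₁ + k₂ + t + 3 ≤ finrank K V) (hk₂ : 2 * t + 1 ≤ k₂) :
    (F₁.ncard : ℚ) * F₂.ncard ≤ boundAB (Nat.card K) (finrank K V) k₁ k₂ t ∧
    ((F₁.ncard : ℚ) * F₂.ncard = boundAB (Nat.card K) (finrank K V) k₁ k₂ t →
      ∃ X M : Submodule K V, finrank K X = t ∧ finrank K M = k₂ + 1 ∧ X ≤ M ∧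
        ((F₁ = famA k₁ (t + 1) X M ∧ F₂ = famB k₂ X M) ∨
          (k₁ = k₂ ∧ F₁ = famB k₁ X M ∧ F₂ = famA k₂ (t + 1) X M))) := by
  have hq := two_le_natCard (K := K)
  have hlead := (margin_mul_leadingTerm_le hq (by omega : t + 1 ≤ k₁)
    (by omega : t + 1 ≤ k₂) hn).1 hk₂
  have hCD := boundCD_lt_boundAB hq hk hk₂ ht hn
  have hpos : 0 < boundAB (Nat.card K) (finrank K V) k₁ k₂ t := by
    refine lt_of_le_of_lt ?_ hCD.1
    have h5 := margin_mul_le_boundCD hq (by omega : t + 1 ≤ k₁) (by omega : t + 1 ≤ k₂) hn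
    have h6 := margin_ge hq t
    have h7 := gaussBinom_pos hq (by omega : 1 ≤ t + 1)
    have h8 := extCount_mul_extCount_pos hq (by omega : t + 1 ≤ k₁) (by omega : t + 1 ≤ k₂) hn
    exact (mul_nonneg (by linarith) (mul_pos h7 h8).le).trans h5
  rcases h.classification ht hk (by omega) hn with
    ⟨X, M, hX, hM, hXM, h1, h2⟩ | ⟨X, M, hX, hM, hXM, h1, h2⟩ | ⟨T, hT, h1, h2⟩ | ⟨T, hT, h1, h2⟩
      | hlt
  · exact le_and_eq_of_subset hpos h1 h2
      (ncard_famA_mul_ncard_famB hX hXM (by omega) (by omega) hM)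
      fun e1 e2 => ⟨X, M, hX, hM, hXM, Or.inl ⟨e1, e2⟩⟩
  · have hc := ncard_famA_mul_ncard_famB hX hXM (by omega : t ≤ k₂) (by omega) hM
    rw [mul_comm] at hc
    rcases hk.eq_or_lt with rfl | hk
    · exact le_and_eq_of_subset hpos h1 h2 hc
        fun e1 e2 => ⟨X, M, hX, hM, hXM, Or.inr ⟨rfl, e1, e2⟩⟩
    · refine le_and_eq_of_lt (ncard_mul_lt_of_subset h1 h2 ?_)
      rw [hc]
      exact boundAB_swap_lt hq hk (by omega) ht hn
  · refine le_and_eq_of_lt (ncard_mul_lt_of_subset h1 h2 ?_)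
    rw [ncard_famC_mul_ncard_famD hT (by omega) (by omega)]
    exact hCD.1
  · refine le_and_eq_of_lt (ncard_mul_lt_of_subset h1 h2 ?_)
    rw [mul_comm, ncard_famC_mul_ncard_famD hT (by omega) (by omega)]
    exact hCD.2
  · exact le_and_eq_of_lt (hlt.trans_le hlead)

theorem IsNontrivialCross.le_boundCD (h : IsNontrivialCross k₁ k₂ t F₁ F₂) (ht : 1 ≤ t)
    (hk : k₂ ≤ k₁) (hk₂ : t + 1 ≤ k₂) (hn : k₁ + k₂ + t + 3 ≤ finrank K V)
    (h₂ : (k₁, k₂, t) ≠ (2, 2, 1)) (h₃ : (k₁, k₂, t) ≠ (3, 2, 1)) (h₄ : (k₁, k₂, t) ≠ (4, 2, 1))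
    (hk₂' : k₂ ≤ 2 * t) :
    (F₁.ncard : ℚ) * F₂.ncard ≤ boundCD (Nat.card K) (finrank K V) k₁ k₂ t ∧
    ((F₁.ncard : ℚ) * F₂.ncard = boundCD (Nat.card K) (finrank K V) k₁ k₂ t →
      ∃ T : Submodule K V, finrank K T = t + 1 ∧
        ((F₁ = famC k₁ T ∧ F₂ = famD k₂ t T) ∨
          (k₁ = k₂ ∧ F₁ = famD k₁ t T ∧ F₂ = famC k₂ T))) := by
  have hq := two_le_natCard (K := K)
  have hlead := (margin_mul_leadingTerm_le hq (by omega : t + 1 ≤ k₁) hk₂ hn).2 hk₂'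
  have hAB := boundAB_lt_boundCD hq ht hk hk₂ hn h₂ h₃ h₄ hk₂'
  have hpos : 0 < boundCD (Nat.card K) (finrank K V) k₁ k₂ t := by
    have h5 := margin_mul_le_boundCD hq (by omega : t + 1 ≤ k₁) (by omega : t + 1 ≤ k₂) hn
    have h6 := margin_ge hq t
    have h7 := gaussBinom_pos hq (by omega : 1 ≤ t + 1)
    have h8 := extCount_mul_extCount_pos hq (by omega : t + 1 ≤ k₁) (by omega : t + 1 ≤ k₂) hn
    exact (mul_pos (by linarith) (mul_pos h7 h8)).trans_le h5
  rcases h.classification ht hk (by omega) hn with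
    ⟨X, M, hX, hM, hXM, h1, h2⟩ | ⟨X, M, hX, hM, hXM, h1, h2⟩ | ⟨T, hT, h1, h2⟩ | ⟨T, hT, h1, h2⟩
      | hlt
  · refine le_and_eq_of_lt (ncard_mul_lt_of_subset h1 h2 ?_)
    rw [ncard_famA_mul_ncard_famB hX hXM (by omega) (by omega) hM]
    exact hAB
  · refine le_and_eq_of_lt (ncard_mul_lt_of_subset h1 h2 ?_)
    rw [mul_comm, ncard_famA_mul_ncard_famB hX hXM (by omega) (by omega) hM]
    rcases hk.eq_or_lt with rfl | hk
    · exact hAB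
    · exact (boundAB_swap_lt hq hk hk₂ ht hn).trans hAB
  · exact le_and_eq_of_subset hpos h1 h2 (ncard_famC_mul_ncard_famD hT (by omega) hk₂)
      fun e1 e2 => ⟨T, hT, Or.inl ⟨e1, e2⟩⟩
  · have hc := ncard_famC_mul_ncard_famD hT hk₂ (by omega : t + 1 ≤ k₁)
    rw [mul_comm] at hc
    rcases hk.eq_or_lt with rfl | hk
    · exact le_and_eq_of_subset hpos h1 h2 hc fun e1 e2 => ⟨T, hT, Or.inr ⟨rfl, e1, e2⟩⟩
    · refine le_and_eq_of_lt (ncard_mul_lt_of_subset h1 h2 ?_)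
      rw [hc]
      exact boundCD_swap_lt hq hk hk₂ hn
  · exact le_and_eq_of_lt (hlt.trans_le hlead)

end Extremal

/-! ### The main theorem -/

theorem theorem1p2 {K V : Type*} [Field K] [Finite K] [AddCommGroup V] [Module K V]
    [FiniteDimensional K V] (n k₁ k₂ t : ℕ) (hV : finrank K V = n) (ht : 1 ≤ t)
    (hk : k₂ ≤ k₁) (hk₂ : t + 1 ≤ k₂) (hn : k₁ + k₂ + t + 3 ≤ n)
    (h₂ : (k₁, k₂, t) ≠ (2, 2, 1)) (h₃ : (k₁, k₂, t) ≠ (3, 2, 1))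
    (h₄ : (k₁, k₂, t) ≠ (4, 2, 1)) :
    (2 * t + 1 ≤ k₂ →
      IsGreatest
        {m : ℚ | ∃ F₁ F₂ : Set (Submodule K V), IsNontrivialCross k₁ k₂ t F₁ F₂ ∧
          m = (F₁.ncard : ℚ) * (F₂.ncard : ℚ)}
        (boundAB (Nat.card K) n k₁ k₂ t) ∧
      ∀ F₁ F₂ : Set (Submodule K V),
        (IsNontrivialCross k₁ k₂ t F₁ F₂ ∧
          (F₁.ncard : ℚ) * (F₂.ncard : ℚ) = boundAB (Nat.card K) n k₁ k₂ t) ↔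
        ∃ X M : Submodule K V, finrank K X = t ∧ finrank K M = k₂ + 1 ∧ X ≤ M ∧
          ((F₁ = famA k₁ (t + 1) X M ∧ F₂ = famB k₂ X M) ∨
            (k₁ = k₂ ∧ F₁ = famB k₁ X M ∧ F₂ = famA k₂ (t + 1) X M))) ∧
    (k₂ ≤ 2 * t →
      IsGreatest
        {m : ℚ | ∃ F₁ F₂ : Set (Submodule K V), IsNontrivialCross k₁ k₂ t F₁ F₂ ∧
          m = (F₁.ncard : ℚ) * (F₂.ncard : ℚ)}
        (boundCD (Nat.card K) n k₁ k₂ t) ∧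
      ∀ F₁ F₂ : Set (Submodule K V),
        (IsNontrivialCross k₁ k₂ t F₁ F₂ ∧
          (F₁.ncard : ℚ) * (F₂.ncard : ℚ) = boundCD (Nat.card K) n k₁ k₂ t) ↔
        ∃ T : Submodule K V, finrank K T = t + 1 ∧
          ((F₁ = famC k₁ T ∧ F₂ = famD k₂ t T) ∨
            (k₁ = k₂ ∧ F₁ = famD k₁ t T ∧ F₂ = famC k₂ T))) := by
  subst hV
  refine ⟨fun hk₂' => ?_, fun hk₂' => ?_⟩
  · have hattain : ∀ X M : Submodule K V, finrank K X = t → finrank K M = k₂ + 1 → X ≤ M →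
        IsNontrivialCross k₁ k₂ t (famA k₁ (t + 1) X M) (famB k₂ X M) ∧
        ((famA k₁ (t + 1) X M).ncard : ℚ) * (famB k₂ X M).ncard
          = boundAB (Nat.card K) (finrank K V) k₁ k₂ t := fun X M hX hM hXM =>
      ⟨isNontrivialCross_famA_famB ht hk₂ (by omega) hX hXM hM,
        ncard_famA_mul_ncard_famB hX hXM (by omega) (by omega) hM⟩
    refine ⟨⟨?_, ?_⟩, fun F₁ F₂ => ⟨fun h => (h.1.le_boundAB ht hk hn hk₂').2 h.2, ?_⟩⟩
    · obtain ⟨M, hM, -, -⟩ := exists_finrank_eq_between (bot_le : (⊥ : Submodule K V) ≤ ⊤)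
        (d := k₂ + 1) (by simp) (by rw [finrank_top]; omega)
      obtain ⟨X, hX, -, hXM⟩ := exists_finrank_eq_between (bot_le : ⊥ ≤ M) (d := t) (by simp)
        (by omega)
      exact ⟨_, _, (hattain X M hX hM hXM).1, (hattain X M hX hM hXM).2.symm⟩
    · rintro _ ⟨F₁, F₂, h, rfl⟩
      exact (h.le_boundAB ht hk hn hk₂').1
    · rintro ⟨X, M, hX, hM, hXM, ⟨rfl, rfl⟩ | ⟨rfl, rfl, rfl⟩⟩
      · exact hattain X M hX hM hXM
      · exact ⟨(hattain X M hX hM hXM).1.symm, by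
          rw [mul_comm]; exact (hattain X M hX hM hXM).2⟩
  · have hattain : ∀ T : Submodule K V, finrank K T = t + 1 →
        IsNontrivialCross k₁ k₂ t (famC k₁ T) (famD k₂ t T) ∧
        ((famC k₁ T).ncard : ℚ) * (famD k₂ t T).ncard
          = boundCD (Nat.card K) (finrank K V) k₁ k₂ t := fun T hT =>
      ⟨isNontrivialCross_famC_famD ht (by omega) hk₂ hn hT,
        ncard_famC_mul_ncard_famD hT (by omega) hk₂⟩
    refine ⟨⟨?_, ?_⟩, fun F₁ F₂ =>
      ⟨fun h => (h.1.le_boundCD ht hk hk₂ hn h₂ h₃ h₄ hk₂').2 h.2, ?_⟩⟩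
    · obtain ⟨T, hT, -, -⟩ := exists_finrank_eq_between (bot_le : (⊥ : Submodule K V) ≤ ⊤)
        (d := t + 1) (by simp) (by rw [finrank_top]; omega)
      exact ⟨_, _, (hattain T hT).1, (hattain T hT).2.symm⟩
    · rintro _ ⟨F₁, F₂, h, rfl⟩
      exact (h.le_boundCD ht hk hk₂ hn h₂ h₃ h₄ hk₂').1
    · rintro ⟨T, hT, ⟨rfl, rfl⟩ | ⟨rfl, rfl, rfl⟩⟩
      · exact hattain T hT
      · exact ⟨(hattain T hT).1.symm, by rw [mul_comm]; exact (hattain T hT).2⟩
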